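/- Let $\|\cdot\|$ be the maximum norm on $\mathbb{C}^n$, and let $T^*\mathbb{C}^n=\{(z;\zeta)\}=\mathbb{C}^n\times\mathbb{C}^n$ with projection $\pi(z;\zeta)=z$. Let $S=\{\eta\in\mathbb{C}:\ 0<|\eta|<r,\ |\arg\eta|<\theta/4\}$ with $r,\theta\in\,]0,\tfrac12[$. Let $\Omega\subset T^*\mathbb{C}^n$ be open, conic (stable under $(z;\zeta)\mapsto(z;s\zeta)$, $s>0$) and contained in the cone generated by a compact subset of $T^*\mathbb{C}^n$. For $0<\rho<1$ and $d>0$ put $$\Omega_\rho=\operatorname{Cl}\bigcup_{(z;\zeta)\in\Omega}\{(z+z';\zeta+\zeta'):\ \|z'\|\le\rho,\ \|\zeta'\|\le\rho\|\zeta\|\},\qquad d_\rho=d(1-\rho),\qquad \Omega_\rho[d_\rho]=\{(z;\zeta)\in\Omega_\rho:\ \|\zeta\|\ge d_\rho\}.$$ For a formal series $P(t;z,\zeta,\eta)=\sum_{\nu\ge0}t^\nu P_\nu(z,\zeta,\eta)$: * $P\in\widehat{\mathfrak N}_{\rm cl}(\Omega;S)$ (classical formal null-symbols with an apparent parameter)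 if for some $d>0$ and $\rho\in\,]0,1[$ all $P_\nu$ are holomorphic on a neighbourhood of $\Omega_\rho[d_\rho]\times S$, and there is $A>0$ such that for every compact $Z\subset S$ and every $h>0$ there is $C>0$ with $$\Bigl|\sum_{\nu=0}^{m-1}P_\nu(z,\zeta,\eta)\Bigr|\le\frac{C\,m!\,A^m e^{h\|\zeta\|}}{\|\eta\zeta\|^m}\qquad(m\ge1,\ (z;\zeta)\in\Omega_\rho[d_\rho],\ \eta\in Z).$$ * $P\in\widehat{\mathfrak S}_{\rm cl}(\Omega;S)$ (classical formal symbols with an apparent parameter) if for some $d>0$ and $\rho\in\,]0,1[$ all $P_\nu$ are holomorphic on a neighbourhood of $\Omega_\rho[d_\rho]\times S$, there is $A>0$ such that for every compact $Z\subset S$ and every $h>0$ there is $C>0$ with $$|P_\nu(z,\zeta,\eta)|\le\frac{C\,\nu!\,A^\nu e^{h\|\zeta\|}}{\|\eta\zeta\|^\nu}\qquad(\nu\ge0,\ (z;\zeta)\in\Omega_\rho[d_\rho],\ \eta\in Z),$$ and $\partial_\eta P=\sum_\nu t^\nu\partial_\eta P_\nu\in\widehat{\mathfrak N}_{\rm cl}(\Omega;S)$.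 Two formal symbols on $\Omega$ are identified if their coefficients agree on $\Omega_\rho[d_\rho]\times S$ for some $d>0$ and $\rho\in\,]0,1[$. A complex coordinate transformation $z=\Phi(w)$ near $\operatorname{Cl}\pi(\Omega)$ is a biholomorphic map $\Phi$ between open subsets of $\mathbb{C}^n$ whose image contains $\operatorname{Cl}\pi(\Omega)$. In the corresponding coordinates $(w;\lambda)$, where $\zeta={}^{\mathsf t}\bigl[\tfrac{\partial w}{\partial z}\bigr]\lambda$, the set $\Omega$ becomes $$\Omega^\Phi=\bigl\{(w;\lambda):\ \bigl(\Phi(w);{}^{\mathsf t}\bigl[\tfrac{\partial w}{\partial z}(\Phi(w))\bigr]\lambda\bigr)\in\Omega\bigr\}.$$ Let $J^*_\Phi(z',z)$ be a matrix of functions, holomorphic near the diagonal, with $\Phi^{-1}(z')-\Phi^{-1}(z)=J^*_\Phi(z',z)(z'-z)$ there. Put $\Phi^*P=\sum_\nu t^\nu(\Phi^*P)_\nu$, where $$(\Phi^*P)_\nu(w,\lambda,\eta)=\sum_{k+|\alpha|=\nu}\frac1{\alpha!}\,\partial_{\zeta'}^{\alpha}\partial_{z'}^{\alpha}P_k\bigl(\Phi(w),\zeta'+{}^{\mathsf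 t}J^*_\Phi(\Phi(w)+z',\Phi(w))\lambda,\eta\bigr)\Big|_{z'=0,\ \zeta'=0},$$ that is, $\Phi^*P=e^{t\langle\partial_{\zeta'},\partial_{z'}\rangle}P\bigl(t;\Phi(w),\zeta'+{}^{\mathsf t}J^*_\Phi(\Phi(w)+z',\Phi(w))\lambda,\eta\bigr)\big|_{z'=\zeta'=0}$. **Theorem.** (1) For every complex coordinate transformation $\Phi$ near $\operatorname{Cl}\pi(\Omega)$ a matrix $J^*_\Phi$ exists, and for every choice of it: if $P\in\widehat{\mathfrak S}_{\rm cl}(\Omega;S)$, then $\Phi^*P\in\widehat{\mathfrak S}_{\rm cl}(\Omega^\Phi;S)$; and if $P\in\widehat{\mathfrak N}_{\rm cl}(\Omega;S)$, then $\Phi^*P\in\widehat{\mathfrak N}_{\rm cl}(\Omega^\Phi;S)$. (2) Let $P\in\widehat{\mathfrak S}_{\rm cl}(\Omega;S)$. For the identity transformation $\mathbf 1$ of any open neighbourhood of $\operatorname{Cl}\pi(\Omega)$ one has $\mathbf 1^*P=P$. If $z=\Phi(w)$ and $w=\Psi(v)$ are complex coordinate transformations near $\operatorname{Cl}\pi(\Omega)$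 and $\operatorname{Cl}\pi(\Omega^\Phi)$ respectively, then $(\Omega^\Phi)^\Psi=\Omega^{\Phi\Psi}$ and $\Psi^*\Phi^*P=(\Phi\Psi)^*P$ as formal symbols on $\Omega^{\Phi\Psi}$. Both identities hold for every choice of the matrices $J^*$ involved. -/

import Mathlib

open Filter Topology Set

/-- The space `ℂⁿ`; its norm is the maximum norm `‖z‖ = max |z_i|`. -/
abbrev CSp (n : ℕ) : Type := Fin n → ℂ

/-- The cotangent space `T*ℂⁿ = ℂⁿ × ℂⁿ` with points `(z; ζ)`. -/
abbrev Cotan (n : ℕ) : Type := CSp n × CSp n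

/-- A formal series `∑ tᵛ P_ν(z, ζ, η)`, given by its sequence of coefficients. Only the germ of
each coefficient along the relevant closed set matters. -/
abbrev FormalSer (n : ℕ) : Type := ℕ → CSp n × CSp n × ℂ → ℂ

/-- The open sector of the apparent parameter: `0 < |η| < r`, `|arg η| < θ / 4`. -/
def sector (r θ : ℝ) : Set ℂ :=
  {η | 0 < ‖η‖ ∧ ‖η‖ < r ∧ |Complex.arg η| < θ / 4}

/-- A subset of `T*ℂⁿ` is conic if it is stable under the positive dilations of the fibres. -/
def IsConic {n : ℕ} (Ω : Set (Cotan n)) : Prop :=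
  ∀ p ∈ Ω, ∀ t : ℝ, 0 < t → ((p.1, (t : ℂ) • p.2) : Cotan n) ∈ Ω

/-- `Ω` is conically relatively compact in `T*ℂⁿ`: it is contained in the cone generated by a
compact set. -/
def ConicRelCompact {n : ℕ} (Ω : Set (Cotan n)) : Prop :=
  ∃ K : Set (Cotan n), IsCompact K ∧
    ∀ p ∈ Ω, ∃ q ∈ K, ∃ t : ℝ, 0 < t ∧ p = (q.1, (t : ℂ) • q.2)

/-- The closed enlargement `Ω_ρ`. -/
def enlarge {n : ℕ} (Ω : Set (Cotan n)) (ρ : ℝ) : Set (Cotan n) :=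
  closure {q | ∃ p ∈ Ω, ∃ z' ζ' : CSp n,
    ‖z'‖ ≤ ρ ∧ ‖ζ'‖ ≤ ρ * ‖p.2‖ ∧ q = (p.1 + z', p.2 + ζ')}

/-- The set `Ω_ρ[d_ρ] × Z` with `d_ρ = d (1 - ρ)`. -/
def symDom {n : ℕ} (Ω : Set (Cotan n)) (d ρ : ℝ) (Z : Set ℂ) : Set (CSp n × CSp n × ℂ) :=
  {x | (x.1, x.2.1) ∈ enlarge Ω ρ ∧ d * (1 - ρ) ≤ ‖x.2.1‖ ∧ x.2.2 ∈ Z}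

/-- Classical formal null-symbols on `Ω` with an apparent parameter in `S`. -/
def IsNullSymbol {n : ℕ} (Ω : Set (Cotan n)) (S : Set ℂ) (P : FormalSer n) : Prop :=
  ∃ d > 0, ∃ ρ ∈ Ioo (0 : ℝ) 1,
    (∀ ν, AnalyticOnNhd ℂ (P ν) (symDom Ω d ρ S)) ∧
    ∃ A : ℝ, 0 < A ∧ ∀ Z : Set ℂ, IsCompact Z → Z ⊆ S → ∀ h : ℝ, 0 < h → ∃ C : ℝ, 0 < C ∧
      ∀ m : ℕ, 1 ≤ m → ∀ x ∈ symDom Ω d ρ Z,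
        ‖∑ ν ∈ Finset.range m, P ν x‖ ≤
          C * (m.factorial : ℝ) * A ^ m * Real.exp (h * ‖x.2.1‖) / ‖x.2.2 • x.2.1‖ ^ m

/-- The coefficientwise derivative `∂_η P`. -/
noncomputable def etaDeriv {n : ℕ} (P : FormalSer n) : FormalSer n :=
  fun ν x => deriv (fun s : ℂ => P ν (x.1, x.2.1, s)) x.2.2

/-- Classical formal symbols on `Ω` with an apparent parameter in `S`. -/
def IsSymbol {n : ℕ} (Ω : Set (Cotan n)) (S : Set ℂ) (P : FormalSer n) : Prop :=
  (∃ d > 0, ∃ ρ ∈ Ioo (0 : ℝ) 1,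
    (∀ ν, AnalyticOnNhd ℂ (P ν) (symDom Ω d ρ S)) ∧
    ∃ A : ℝ, 0 < A ∧ ∀ Z : Set ℂ, IsCompact Z → Z ⊆ S → ∀ h : ℝ, 0 < h → ∃ C : ℝ, 0 < C ∧
      ∀ ν : ℕ, ∀ x ∈ symDom Ω d ρ Z,
        ‖P ν x‖ ≤
          C * (ν.factorial : ℝ) * A ^ ν * Real.exp (h * ‖x.2.1‖) / ‖x.2.2 • x.2.1‖ ^ ν) ∧
  IsNullSymbol Ω S (etaDeriv P)

/-- Equality as formal symbols on `Ω`: the coefficients coincide on a common domain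
`Ω_ρ[d_ρ] × S`. -/
def SymEq {n : ℕ} (Ω : Set (Cotan n)) (S : Set ℂ) (P Q : FormalSer n) : Prop :=
  ∃ d > 0, ∃ ρ ∈ Ioo (0 : ℝ) 1, ∀ ν, EqOn (P ν) (Q ν) (symDom Ω d ρ S)

/-- The Jacobian matrix of a map of `ℂⁿ` at a point. -/
noncomputable def jacobianMat {n : ℕ} (f : CSp n → CSp n) (z : CSp n) :
    Matrix (Fin n) (Fin n) ℂ :=
  Matrix.of fun i j => fderiv ℂ f z (Pi.single j 1) i

/-- `z = Φ(w)` is a complex coordinate transformation near `Cl π(Ω)`, where `Ω` is given in the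
coordinates `(z; ζ)`: `Φ` is biholomorphic from the open set `Φ.source` onto the open set
`Φ.target`, and the latter contains `Cl π(Ω)`. -/
structure IsCoordChange {n : ℕ} (Φ : OpenPartialHomeomorph (CSp n) (CSp n))
    (Ω : Set (Cotan n)) : Prop where
  holo : AnalyticOnNhd ℂ Φ Φ.source
  holo_symm : AnalyticOnNhd ℂ Φ.symm Φ.target
  closure_subset : closure (Prod.fst '' Ω) ⊆ Φ.target

/-- The set `Ω` written in the coordinates `(w; λ)`, where `z = Φ(w)`, `ζ = ᵗ[∂w/∂z] λ`. -/
def inCoord {n : ℕ} (Φ : OpenPartialHomeomorph (CSp n) (CSp n)) (Ω : Set (Cotan n)) :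
    Set (Cotan n) :=
  {p | p.1 ∈ Φ.source ∧ (Φ p.1, (jacobianMat Φ.symm (Φ p.1)).transpose.mulVec p.2) ∈ Ω}

/-- `J` is a matrix `J*_Φ(z', z)`: it is holomorphic near the diagonal and satisfies there
`Φ⁻¹(z') - Φ⁻¹(z) = J*_Φ(z', z) (z' - z)`. For `n ≥ 2` there are several such matrices. -/
def IsJStar {n : ℕ} (Φ : OpenPartialHomeomorph (CSp n) (CSp n))
    (J : CSp n → CSp n → Matrix (Fin n) (Fin n) ℂ) : Prop :=
  ∀ z ∈ Φ.target,
    (∀ i j, AnalyticAt ℂ (fun p : CSp n × CSp n => J p.1 p.2 i j) (z, z)) ∧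
    ∀ᶠ p : CSp n × CSp n in 𝓝 (z, z), Φ.symm p.1 - Φ.symm p.2 = (J p.1 p.2).mulVec (p.1 - p.2)

/-- The iterated partial derivative `∏ i, (∂/∂v_i)^{α_i}` of `F`. -/
noncomputable def multiDeriv {n : ℕ} {E : Type*} [NormedAddCommGroup E] [NormedSpace ℂ E]
    (v : Fin n → E) (α : Fin n → ℕ) (F : E → ℂ) : E → ℂ :=
  (List.finRange n).foldr
    (fun i G => (fun H : E → ℂ => fun x => lineDeriv ℂ H x (v i))^[α i] G) F

/-- The operator `∂_{ζ'}^α ∂_{z'}^α` on functions of `(z', ζ')`. -/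
noncomputable def mixedDeriv {n : ℕ} (α : Fin n → ℕ) (F : CSp n × CSp n → ℂ) :
    CSp n × CSp n → ℂ :=
  multiDeriv (fun i => ((0, Pi.single i 1) : CSp n × CSp n)) α
    (multiDeriv (fun i => ((Pi.single i 1, 0) : CSp n × CSp n)) α F)

/-- The transform `Φ*P`: the coefficient of `tᵛ` at `(w, λ, η)` is the sum over `k + |α| = ν` of
`(1/α!) ∂_{ζ'}^α ∂_{z'}^α P_k(Φ(w), ζ' + ᵗJ*_Φ(Φ(w) + z', Φ(w)) λ, η)` at `z' = 0`, `ζ' = 0`. -/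
noncomputable def pullback {n : ℕ} (Φ : OpenPartialHomeomorph (CSp n) (CSp n))
    (J : CSp n → CSp n → Matrix (Fin n) (Fin n) ℂ) (P : FormalSer n) : FormalSer n :=
  fun ν x =>
    ∑ kl ∈ Finset.HasAntidiagonal.antidiagonal ν, ∑ α ∈ Finset.piAntidiag (Finset.univ : Finset (Fin n)) kl.2,
      (∏ i, ((α i).factorial : ℂ))⁻¹ *
        mixedDeriv α (fun y : CSp n × CSp n =>
          P kl.1 (Φ x.1, y.2 + (J (Φ x.1 + y.1) (Φ x.1)).transpose.mulVec x.2.1, x.2.2)) (0, 0)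

/-! Fix z = Φ(w) and η. The coefficient of t^ν in Φ*P is the sum over k + l = ν of operators
`fibreOp` of order l. They act on the function ζ ↦ P_k(z, ζ, η) alone and depend on the
transformation only through B(z') = J*(z + z', z).

Functoriality. The operator of order l kills every p vanishing to order 2l + 1 at the base covector,
so it depends on a finite jet. A linear functional of this kind is determined by its values on the
exponentials e^{⟨ζ,x⟩} (`functional_eq_zero`). On these, `fibreOp_exp` gives the l-th Taylor
coefficient at t = 0 of e^{⟨λ, B(tx)x⟩}. Since tB(tx)x = Φ⁻¹(z + tx) - Φ⁻¹(z) for small t, this does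
not depend on the choice of J*. For Φ = 1 the exponent is constant in t, so only the coefficient of
order 0 survives. For a composite, inserting one displacement into the other gives a function of two
parameters (s, t) which on the diagonal s = t is the generating function of ΦΨ. The binomial theorem
then identifies the sum over l + m = j with the j-th derivative along that diagonal
(`fibreOp_exp_comp`, `fibreOp_comp`, `pullback_pullback`).

Estimates. By compactness of Cl π(Ω), for (w; λ) in a small enlargement of Ω^Φ with λ large, the
points ζ' + ᵗJ*(z + z', z)λ with ‖z'‖ ≤ ε and ‖ζ'‖ ≤ ε‖λ‖ stay in the given domain of P and have
norm comparable to ‖λ‖ (`exists_polydisc_in_symDom`). Cauchy's inequalities on this polydisc bound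
the operator of order l by l!(n/ε²)^l‖λ‖^{-l} (`norm_fibreOp_le`), and such bounds convolve with
k!A^k to the same type. Partial sums of Φ*P are sums of operators applied to partial sums of P
(`sum_range_pullback`), which handles null-symbols. Finally ∂_η commutes with everything.

A matrix J* exists: the mean of the Jacobian of Φ⁻¹ along the segment from z to z'. -/

/-! ### Iterated directional derivatives of analytic functions -/

section DirDeriv

variable {E E' : Type*} [NormedAddCommGroup E] [NormedSpace ℂ E]
  [NormedAddCommGroup E'] [NormedSpace ℂ E']

/-- The derivative of a function in the direction `v`. -/
noncomputable def dirDeriv (v : E) (H : E → ℂ) : E → ℂ := fun x => lineDeriv ℂ H x v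

/-- Iterated directional derivatives along a list of indexed directions. -/
noncomputable def iterDir {ι : Type*} (v : ι → E) (α : ι → ℕ) (L : List ι) (F : E → ℂ) : E → ℂ :=
  L.foldr (fun i G => (dirDeriv (v i))^[α i] G) F

theorem iterDir_cons {ι : Type*} (v : ι → E) (α : ι → ℕ) (i : ι) (L : List ι) (F : E → ℂ) :
    iterDir v α (i :: L) F = (dirDeriv (v i))^[α i] (iterDir v α L F) := rfl

theorem multiDeriv_eq_iterDir {n : ℕ} (v : Fin n → E) (α : Fin n → ℕ) (F : E → ℂ) :
    multiDeriv v α F = iterDir v α (List.finRange n) F := rfl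

theorem dirDeriv_eqOn {U : Set E} (hU : IsOpen U) {f g : E → ℂ} (h : EqOn f g U) (v : E) :
    EqOn (dirDeriv v f) (dirDeriv v g) U := fun _ hx =>
  Filter.EventuallyEq.lineDeriv_eq (Filter.eventuallyEq_of_mem (hU.mem_nhds hx) h)

theorem iterate_dirDeriv_eqOn {U : Set E} (hU : IsOpen U) {f g : E → ℂ} (h : EqOn f g U) (v : E)
    (k : ℕ) : EqOn ((dirDeriv v)^[k] f) ((dirDeriv v)^[k] g) U := by
  induction k with
  | zero => exact h
  | succ k ih =>
    rw [Function.iterate_succ_apply', Function.iterate_succ_apply']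
    exact dirDeriv_eqOn hU ih v

theorem iterDir_eqOn {ι : Type*} {U : Set E} (hU : IsOpen U) {f g : E → ℂ} (h : EqOn f g U)
    (v : ι → E) (α : ι → ℕ) (L : List ι) : EqOn (iterDir v α L f) (iterDir v α L g) U := by
  induction L with
  | nil => exact h
  | cons i L ih =>
    rw [iterDir_cons, iterDir_cons]
    exact iterate_dirDeriv_eqOn hU ih _ _

theorem AnalyticAt.dirDeriv_eventuallyEq {f : E → ℂ} {x : E} (hf : AnalyticAt ℂ f x) (v : E) :
    dirDeriv v f =ᶠ[𝓝 x] fun y => fderiv ℂ f y v := by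
  filter_upwards [hf.eventually_analyticAt] with y hy
  exact hy.differentiableAt.lineDeriv_eq_fderiv

theorem AnalyticAt.dirDeriv_eq {f : E → ℂ} {x : E} (hf : AnalyticAt ℂ f x) (v : E) :
    dirDeriv v f x = fderiv ℂ f x v :=
  hf.differentiableAt.lineDeriv_eq_fderiv

theorem AnalyticAt.dirDeriv {f : E → ℂ} {x : E} (hf : AnalyticAt ℂ f x) (v : E) :
    AnalyticAt ℂ (dirDeriv v f) x := by
  refine AnalyticAt.congr ?_ (hf.dirDeriv_eventuallyEq v).symm
  exact ((ContinuousLinearMap.apply ℂ ℂ v).analyticAt _).comp hf.fderiv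

theorem AnalyticAt.iterate_dirDeriv {f : E → ℂ} {x : E} (hf : AnalyticAt ℂ f x) (v : E) (k : ℕ) :
    AnalyticAt ℂ ((_root_.dirDeriv v)^[k] f) x := by
  induction k with
  | zero => exact hf
  | succ k ih => rw [Function.iterate_succ_apply']; exact ih.dirDeriv v

theorem AnalyticAt.iterDir {ι : Type*} {f : E → ℂ} {x : E} (hf : AnalyticAt ℂ f x) (v : ι → E)
    (α : ι → ℕ) (L : List ι) : AnalyticAt ℂ (iterDir v α L f) x := by
  induction L with
  | nil => exact hf
  | cons i L ih => exact ih.iterate_dirDeriv _ _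

/-- Directional derivatives commute with affine substitutions. -/
theorem dirDeriv_comp_affine (A : E → E') (v : E) (w : E')
    (hA : ∀ (x : E) (t : ℂ), A (x + t • v) = A x + t • w) (f : E' → ℂ) :
    dirDeriv v (fun x => f (A x)) = fun x => dirDeriv w f (A x) := by
  funext x
  simp only [dirDeriv, lineDeriv, hA]

theorem iterate_dirDeriv_comp_affine (A : E → E') (v : E) (w : E')
    (hA : ∀ (x : E) (t : ℂ), A (x + t • v) = A x + t • w) (f : E' → ℂ) (k : ℕ) :
    (dirDeriv v)^[k] (fun x => f (A x)) = fun x => (dirDeriv w)^[k] f (A x) := by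
  induction k with
  | zero => rfl
  | succ k ih =>
    rw [Function.iterate_succ_apply', ih, dirDeriv_comp_affine A v w hA]
    simp only [Function.iterate_succ_apply']

theorem iterDir_comp_affine {ι : Type*} (A : E → E') (v : ι → E) (w : ι → E')
    (hA : ∀ i (x : E) (t : ℂ), A (x + t • v i) = A x + t • w i) (α : ι → ℕ) (L : List ι)
    (f : E' → ℂ) :
    iterDir v α L (fun x => f (A x)) = fun x => iterDir w α L f (A x) := by
  induction L with
  | nil => rfl
  | cons i L ih =>
    rw [iterDir_cons, ih, iterate_dirDeriv_comp_affine A (v i) (w i) (hA i)]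
    rfl

/-- The functions which are analytic on `U` and vanish off `U`. -/
def analyticOnSubmodule (U : Set E) : Submodule ℂ (E → ℂ) where
  carrier := {f | AnalyticOnNhd ℂ f U ∧ ∀ x ∉ U, f x = 0}
  add_mem' := fun hf hg =>
    ⟨hf.1.add hg.1, fun x hx => by simp [hf.2 x hx, hg.2 x hx]⟩
  zero_mem' := ⟨analyticOnNhd_const, fun _ _ => rfl⟩
  smul_mem' := fun c f hf =>
    ⟨fun x hx => analyticAt_const.smul (hf.1 x hx), fun x hx => by simp [hf.2 x hx]⟩

/-- Extension by zero puts germs into a genuine vector space: two members agreeing on U are equal.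
Directional derivatives thus become endomorphisms, and commutation, the binomial and the multinomial
theorem can be quoted from ring theory. -/
theorem indicator_mem_analyticOnSubmodule {U : Set E} (hU : IsOpen U) {f : E → ℂ}
    (hf : AnalyticOnNhd ℂ f U) : U.indicator f ∈ analyticOnSubmodule U :=
  ⟨fun x hx => (hf x hx).congr
      (Filter.eventuallyEq_of_mem (hU.mem_nhds hx) (fun _ hy => (indicator_of_mem hy f).symm)),
    fun _ hx => indicator_of_notMem hx f⟩

/-- The directional derivative as an operator on the functions analytic on `U`. -/
noncomputable def dirDerivEnd {U : Set E} (hU : IsOpen U) (v : E) :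
    Module.End ℂ (analyticOnSubmodule U) where
  toFun f := ⟨U.indicator (dirDeriv v f.1),
    indicator_mem_analyticOnSubmodule hU fun x hx => (f.2.1 x hx).dirDeriv v⟩
  map_add' f g := by
    ext x
    by_cases hx : x ∈ U
    · simp only [Submodule.coe_add, Pi.add_apply, indicator_of_mem hx]
      rw [((f.2.1 x hx).add (g.2.1 x hx)).dirDeriv_eq, (f.2.1 x hx).dirDeriv_eq,
        (g.2.1 x hx).dirDeriv_eq,
        fderiv_add (f.2.1 x hx).differentiableAt (g.2.1 x hx).differentiableAt]
      rfl
    · simp [indicator_of_notMem hx]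
  map_smul' c f := by
    ext x
    by_cases hx : x ∈ U
    · simp only [Submodule.coe_smul, Pi.smul_apply, indicator_of_mem hx, RingHom.id_apply]
      rw [(analyticAt_const.smul (f.2.1 x hx)).dirDeriv_eq (f := c • f.1), (f.2.1 x hx).dirDeriv_eq,
        fderiv_const_smul (f.2.1 x hx).differentiableAt]
      rfl
    · simp [indicator_of_notMem hx]

theorem dirDerivEnd_eqOn {U : Set E} (hU : IsOpen U) (v : E) (f : analyticOnSubmodule U) :
    EqOn (dirDerivEnd hU v f).1 (dirDeriv v f.1) U := fun _ hx => indicator_of_mem hx _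

theorem dirDerivEnd_pow_eqOn {U : Set E} (hU : IsOpen U) (v : E) (f : analyticOnSubmodule U)
    (k : ℕ) : EqOn ((dirDerivEnd hU v ^ k) f).1 ((dirDeriv v)^[k] f.1) U := by
  induction k with
  | zero => exact fun _ _ => rfl
  | succ k ih =>
    rw [pow_succ', Function.iterate_succ_apply']
    exact (dirDerivEnd_eqOn hU v _).trans (dirDeriv_eqOn hU ih v)

theorem dirDerivEnd_prod_eqOn {ι : Type*} {U : Set E} (hU : IsOpen U) (v : ι → E) (α : ι → ℕ)
    (L : List ι) (f : analyticOnSubmodule U) :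
    EqOn (((L.map fun i => dirDerivEnd hU (v i) ^ α i).prod) f).1 (iterDir v α L f.1) U := by
  induction L with
  | nil => exact fun _ _ => rfl
  | cons i L ih =>
    rw [List.map_cons, List.prod_cons, iterDir_cons]
    exact (dirDerivEnd_pow_eqOn hU (v i) _ _).trans (iterate_dirDeriv_eqOn hU ih _ _)

/-- On U this is the symmetry of the second derivative; off U both sides vanish. -/
theorem dirDerivEnd_commute {U : Set E} (hU : IsOpen U) (v w : E) :
    Commute (dirDerivEnd hU v) (dirDerivEnd hU w) := by
  have key : ∀ (v w : E) (f : analyticOnSubmodule U) (x : E), x ∈ U →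
      (dirDerivEnd hU v (dirDerivEnd hU w f)).1 x = fderiv ℂ (fderiv ℂ f.1) x v w := by
    intro v w f x hx
    have h1 : (dirDerivEnd hU w f).1 =ᶠ[𝓝 x] fun y => fderiv ℂ f.1 y w := by
      filter_upwards [hU.mem_nhds hx] with y hy
      rw [dirDerivEnd_eqOn hU w f hy, (f.2.1 y hy).dirDeriv_eq]
    rw [dirDerivEnd_eqOn hU v _ hx, ((dirDerivEnd hU w f).2.1 x hx).dirDeriv_eq, h1.fderiv_eq]
    have h2 : HasFDerivAt (fun y => fderiv ℂ f.1 y w) _ x :=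
      ((f.2.1 x hx).fderiv.differentiableAt.hasFDerivAt).clm_apply (hasFDerivAt_const w x)
    rw [h2.fderiv]
    simp
  apply LinearMap.ext
  intro f
  apply Subtype.ext
  funext x
  by_cases hx : x ∈ U
  · change (dirDerivEnd hU v (dirDerivEnd hU w f)).1 x = (dirDerivEnd hU w (dirDerivEnd hU v f)).1 x
    rw [key v w f x hx, key w v f x hx]
    exact ((f.2.1 x hx).contDiffAt.isSymmSndFDerivAt_of_omega) v w
  · exact ((dirDerivEnd hU v (dirDerivEnd hU w f)).2.2 x hx).trans
      ((dirDerivEnd hU w (dirDerivEnd hU v f)).2.2 x hx).symm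

theorem dirDerivEnd_sum {ι : Type*} {U : Set E} (hU : IsOpen U) (s : Finset ι) (c : ι → ℂ)
    (v : ι → E) : dirDerivEnd hU (∑ i ∈ s, c i • v i) = ∑ i ∈ s, c i • dirDerivEnd hU (v i) := by
  apply LinearMap.ext
  intro f
  apply Subtype.ext
  funext x
  rw [LinearMap.sum_apply]
  by_cases hx : x ∈ U
  · rw [dirDerivEnd_eqOn hU _ _ hx, (f.2.1 x hx).dirDeriv_eq, map_sum, Submodule.coe_sum,
      Finset.sum_apply]
    refine Finset.sum_congr rfl fun i _ => ?_
    rw [map_smul, LinearMap.smul_apply, Submodule.coe_smul, Pi.smul_apply,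
      dirDerivEnd_eqOn hU _ _ hx, (f.2.1 x hx).dirDeriv_eq]
  · rw [(Subtype.prop _ : _ ∈ analyticOnSubmodule U).2 x hx,
      (Subtype.prop _ : _ ∈ analyticOnSubmodule U).2 x hx]

theorem exists_analyticOnSubmodule {f : E → ℂ} {x : E} (hf : AnalyticAt ℂ f x) :
    ∃ U : Set E, IsOpen U ∧ x ∈ U ∧ ∃ g : analyticOnSubmodule U, EqOn f g.1 U := by
  obtain ⟨U, hU, hUo, hxU⟩ := eventually_nhds_iff.1 hf.eventually_analyticAt
  exact ⟨U, hUo, hxU, ⟨_, indicator_mem_analyticOnSubmodule hUo fun y hy => hU y hy⟩,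
    fun y hy => (indicator_of_mem hy f).symm⟩

theorem exists_analyticOnSubmodule_finset {κ : Type*} (s : Finset κ) {f : κ → E → ℂ} {x : E}
    (hf : ∀ i ∈ s, AnalyticAt ℂ (f i) x) :
    ∃ U : Set E, IsOpen U ∧ x ∈ U ∧ ∃ g : κ → analyticOnSubmodule U,
      ∀ i ∈ s, EqOn (f i) (g i).1 U := by
  have h : ∀ᶠ y in 𝓝 x, ∀ i ∈ s, AnalyticAt ℂ (f i) y :=
    (Filter.eventually_all_finset s).2 fun i hi => (hf i hi).eventually_analyticAt
  obtain ⟨U, hU, hUo, hxU⟩ := eventually_nhds_iff.1 h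
  classical
  refine ⟨U, hUo, hxU, fun i => if hi : i ∈ s then
    ⟨_, indicator_mem_analyticOnSubmodule hUo fun y hy => hU y hy i hi⟩ else 0, fun i hi y hy => ?_⟩
  simp [hi, indicator_of_mem hy]

/-- Iterated directional derivatives commute with each other. -/
theorem iterDir_comm {ι κ : Type*} {f : E → ℂ} {x : E} (hf : AnalyticAt ℂ f x) (v : ι → E)
    (α : ι → ℕ) (L : List ι) (w : κ → E) (β : κ → ℕ) (M : List κ) :
    iterDir v α L (iterDir w β M f) x = iterDir w β M (iterDir v α L f) x := by
  obtain ⟨U, hU, hx, g, hg⟩ := exists_analyticOnSubmodule hf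
  have hc : Commute ((L.map fun i => dirDerivEnd hU (v i) ^ α i).prod)
      ((M.map fun i => dirDerivEnd hU (w i) ^ β i).prod) := by
    refine Commute.list_prod_left _ _ fun a ha => Commute.list_prod_right _ _ fun b hb => ?_
    obtain ⟨i, -, rfl⟩ := List.mem_map.1 ha
    obtain ⟨j, -, rfl⟩ := List.mem_map.1 hb
    exact (dirDerivEnd_commute hU _ _).pow_pow _ _
  have e1 := fun (φ : analyticOnSubmodule U) => dirDerivEnd_prod_eqOn hU v α L φ
  have e2 := fun (φ : analyticOnSubmodule U) => dirDerivEnd_prod_eqOn hU w β M φ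
  rw [iterDir_eqOn hU ((iterDir_eqOn hU hg w β M).trans (e2 g).symm) v α L hx, ← e1 _ hx,
    iterDir_eqOn hU ((iterDir_eqOn hU hg v α L).trans (e1 g).symm) w β M hx, ← e2 _ hx]
  exact congrFun (congrArg Subtype.val (congrArg (fun F : Module.End ℂ _ => F g) hc.eq)) x

/-- Iterated directional derivatives are linear on analytic functions. -/
theorem iterDir_sum {ι κ : Type*} (s : Finset κ) (c : κ → ℂ) {f : κ → E → ℂ} {x : E}
    (hf : ∀ k ∈ s, AnalyticAt ℂ (f k) x) (v : ι → E) (α : ι → ℕ) (L : List ι) :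
    iterDir v α L (fun y => ∑ k ∈ s, c k * f k y) x = ∑ k ∈ s, c k * iterDir v α L (f k) x := by
  obtain ⟨U, hU, hx, g, hg⟩ := exists_analyticOnSubmodule_finset s hf
  have h1 : EqOn (fun y => ∑ k ∈ s, c k * f k y) (∑ k ∈ s, c k • g k).1 U := fun y hy => by
    rw [Submodule.coe_sum, Finset.sum_apply]
    exact Finset.sum_congr rfl fun k hk => by simp [hg k hk hy]
  rw [iterDir_eqOn hU h1 v α L hx, ← dirDerivEnd_prod_eqOn hU v α L _ hx, map_sum,
    Submodule.coe_sum, Finset.sum_apply]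
  refine Finset.sum_congr rfl fun k hk => ?_
  rw [map_smul, Submodule.coe_smul, Pi.smul_apply, dirDerivEnd_prod_eqOn hU v α L _ hx,
    iterDir_eqOn hU (hg k hk) v α L hx, smul_eq_mul]

/-- A power of one derivative is an `iterDir` over a one-element index set, so the commutation and
linearity results apply to it. -/
theorem iterate_dirDeriv_eq_iterDir (v : E) (k : ℕ) (f : E → ℂ) :
    (dirDeriv v)^[k] f = iterDir (fun _ : Unit => v) (fun _ => k) [()] f := rfl

theorem List.prod_finRange_eq_noncommProd {M : Type*} [Monoid M] {n : ℕ} (f : Fin n → M)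
    (h : (↑(Finset.univ : Finset (Fin n)) : Set (Fin n)).Pairwise (Function.onFun Commute f)) :
    Finset.univ.noncommProd f h = ((List.finRange n).map f).prod := by
  rw [← Finset.noncommProd_toFinset (List.finRange n) f (by simpa using h) (List.nodup_finRange n)]
  congr 1
  simp

/-- The multinomial theorem for directional derivatives. -/
theorem sum_multiDeriv_eq {n : ℕ} {f : E → ℂ} {x : E} (hf : AnalyticAt ℂ f x) (v : Fin n → E)
    (c : Fin n → ℂ) (l : ℕ) :
    ∑ α ∈ Finset.piAntidiag (Finset.univ : Finset (Fin n)) l,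
      (∏ i, ((α i).factorial : ℂ))⁻¹ * ((∏ i, c i ^ α i) * multiDeriv v α f x) =
    ((l.factorial : ℂ))⁻¹ * (dirDeriv (∑ i, c i • v i))^[l] f x := by
  obtain ⟨U, hU, hx, g, hg⟩ := exists_analyticOnSubmodule hf
  -- Commuting operators obey the multinomial theorem; its ordered noncommutative product is the
  -- composition occurring in `multiDeriv`.
  have hcomm : (↑(Finset.univ : Finset (Fin n)) : Set (Fin n)).Pairwise
      (Function.onFun Commute fun i => c i • dirDerivEnd hU (v i)) := fun i _ j _ _ =>
    ((dirDerivEnd_commute hU (v i) (v j)).smul_left _).smul_right _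
  have h1 : (dirDeriv (∑ i, c i • v i))^[l] f x =
      ((dirDerivEnd hU (∑ i, c i • v i) ^ l) g).1 x := by
    rw [iterate_dirDeriv_eqOn hU hg _ _ hx, dirDerivEnd_pow_eqOn hU _ _ _ hx]
  rw [h1, dirDerivEnd_sum, Finset.sum_pow_eq_sum_piAntidiag_of_commute _ _ hcomm,
    LinearMap.sum_apply, Submodule.coe_sum, Finset.sum_apply, Finset.mul_sum]
  refine Finset.sum_congr rfl fun α hα => ?_
  have hsum : ∑ i, α i = l := (Finset.mem_piAntidiag.1 hα).1
  rw [List.prod_finRange_eq_noncommProd, multiDeriv_eq_iterDir, iterDir_eqOn hU hg _ _ _ hx,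
    ← dirDerivEnd_prod_eqOn hU v α _ _ hx]
  have h2 : ∀ L : List (Fin n), (L.map fun i => (c i • dirDerivEnd hU (v i)) ^ α i).prod =
      (L.map fun i => c i ^ α i).prod • (L.map fun i => dirDerivEnd hU (v i) ^ α i).prod := by
    intro L
    induction L with
    | nil => simp
    | cons i L ih =>
      rw [List.map_cons, List.prod_cons, ih, List.map_cons, List.prod_cons, List.map_cons,
        List.prod_cons, smul_pow, smul_mul_smul_comm]
  have h3 : ((List.finRange n).map fun i => c i ^ α i).prod = ∏ i, c i ^ α i := by
    rw [← List.ofFn_eq_map, List.prod_ofFn]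
  have h4 : (∏ i, ((α i).factorial : ℂ)) * (Nat.multinomial Finset.univ α : ℂ) = l.factorial := by
    rw [← hsum, ← Nat.multinomial_spec]; push_cast; rfl
  have h5 : (∏ i, ((α i).factorial : ℂ)) ≠ 0 :=
    Finset.prod_ne_zero_iff.2 fun i _ => Nat.cast_ne_zero.2 (Nat.factorial_ne_zero _)
  have h6 : (l.factorial : ℂ) ≠ 0 := Nat.cast_ne_zero.2 (Nat.factorial_ne_zero _)
  rw [h2, h3, Module.End.mul_apply, LinearMap.smul_apply, Module.End.natCast_apply,
    ← Nat.cast_smul_eq_nsmul ℂ, Submodule.coe_smul, Pi.smul_apply, Submodule.coe_smul,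
    Pi.smul_apply, smul_eq_mul, smul_eq_mul, ← h4]
  have h7 : (Nat.multinomial Finset.univ α : ℂ) ≠ 0 := fun h => h6 (by rw [← h4, h, mul_zero])
  field_simp

/-- The binomial theorem for directional derivatives. -/
theorem sum_antidiagonal_dirDeriv {f : E → ℂ} {x : E} (hf : AnalyticAt ℂ f x) (v w : E) (j : ℕ) :
    ∑ p ∈ Finset.HasAntidiagonal.antidiagonal j,
      ((p.1.factorial : ℂ))⁻¹ * ((p.2.factorial : ℂ)⁻¹ *
        (dirDeriv v)^[p.1] ((dirDeriv w)^[p.2] f) x) =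
    ((j.factorial : ℂ))⁻¹ * (dirDeriv (v + w))^[j] f x := by
  obtain ⟨U, hU, hx, g, hg⟩ := exists_analyticOnSubmodule hf
  have hadd : dirDerivEnd hU (v + w) = dirDerivEnd hU v + dirDerivEnd hU w := by
    have := dirDerivEnd_sum hU Finset.univ (fun _ : Fin 2 => 1) ![v, w]
    simpa [Fin.sum_univ_two] using this
  rw [iterate_dirDeriv_eqOn hU hg _ _ hx, ← dirDerivEnd_pow_eqOn hU _ _ _ hx, hadd,
    (dirDerivEnd_commute hU v w).add_pow', LinearMap.sum_apply, Submodule.coe_sum,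
    Finset.sum_apply, Finset.mul_sum]
  refine Finset.sum_congr rfl fun p hp => ?_
  rw [iterate_dirDeriv_eqOn hU ((iterate_dirDeriv_eqOn hU hg w p.2).trans
    (dirDerivEnd_pow_eqOn hU w g p.2).symm) v p.1 hx, ← dirDerivEnd_pow_eqOn hU _ _ _ hx,
    LinearMap.smul_apply, ← Nat.cast_smul_eq_nsmul ℂ, Submodule.coe_smul, Pi.smul_apply,
    smul_eq_mul, Module.End.mul_apply, ← Finset.HasAntidiagonal.mem_antidiagonal.1 hp, Nat.choose_symm_add, Nat.add_choose,
    Nat.cast_div (Nat.factorial_mul_factorial_dvd_factorial_add _ _)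
      (by exact_mod_cast Nat.mul_ne_zero (Nat.factorial_ne_zero _) (Nat.factorial_ne_zero _))]
  have h1 : (p.1.factorial : ℂ) ≠ 0 := Nat.cast_ne_zero.2 (Nat.factorial_ne_zero _)
  have h2 : (p.2.factorial : ℂ) ≠ 0 := Nat.cast_ne_zero.2 (Nat.factorial_ne_zero _)
  have h3 : ((p.1 + p.2).factorial : ℂ) ≠ 0 := Nat.cast_ne_zero.2 (Nat.factorial_ne_zero _)
  push_cast
  field_simp

end DirDeriv

/-! ### Cauchy estimates and vanishing orders -/

section Cauchy

variable {E : Type*} [NormedAddCommGroup E] [NormedSpace ℂ E]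

theorem dirDeriv_one : dirDeriv (1 : ℂ) = deriv := by
  funext h x
  simp only [dirDeriv, lineDeriv, smul_eq_mul, mul_one]
  rw [deriv_comp_const_add, add_zero]

theorem iterate_dirDeriv_eq_iteratedDeriv (v : E) (k : ℕ) (G : E → ℂ) (y : E) :
    (dirDeriv v)^[k] G y = iteratedDeriv k (fun s : ℂ => G (y + s • v)) 0 := by
  have h := iterate_dirDeriv_comp_affine (fun s : ℂ => y + s • v) 1 v
    (fun x t => by simp only [smul_eq_mul, mul_one, add_smul, add_assoc]) G k
  rw [dirDeriv_one, ← iteratedDeriv_eq_iterate] at h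
  rw [h]
  simp

/-- This is the one-variable Cauchy estimate on the complex line s ↦ y + sv. -/
theorem norm_iterate_dirDeriv_le {G : E → ℂ} {y v : E} {R M : ℝ} (hR : 0 < R) (k : ℕ)
    (hG : ∀ s : ℂ, ‖s‖ ≤ R → AnalyticAt ℂ G (y + s • v) ∧ ‖G (y + s • v)‖ ≤ M) :
    ‖(dirDeriv v)^[k] G y‖ ≤ k.factorial * M / R ^ k := by
  rw [iterate_dirDeriv_eq_iteratedDeriv]
  refine Complex.norm_iteratedDeriv_le_of_forall_mem_sphere_norm_le k hR ?_ fun z hz =>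
    (hG z (mem_sphere_zero_iff_norm.1 hz).le).2
  refine DifferentiableOn.diffContOnCl fun s hs => ?_
  rw [closure_ball _ hR.ne', mem_closedBall_zero_iff] at hs
  have h1 : DifferentiableAt ℂ (fun s : ℂ => y + s • v) s := by fun_prop
  exact ((hG s hs).1.differentiableAt.comp s h1).differentiableWithinAt

/-- Cauchy estimates for iterated directional derivatives on a polydisc. -/
theorem norm_iterDir_le {ι : Type*} (v : ι → E) {R : ι → ℝ} (hR : ∀ i, 0 < R i) (M : ℝ) (α : ι → ℕ)
    (F : E → ℂ) (L : List ι) (hL : L.Nodup) (y : E)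
    (hF : ∀ s : ι → ℂ, (∀ i, ‖s i‖ ≤ R i) →
      AnalyticAt ℂ F (y + (L.map fun i => s i • v i).sum) ∧
        ‖F (y + (L.map fun i => s i • v i).sum)‖ ≤ M) :
    ‖iterDir v α L F y‖ ≤ M * (L.map fun i => ((α i).factorial : ℝ) / R i ^ α i).prod := by
  classical
  induction L generalizing y with
  | nil => simpa [iterDir] using (hF 0 fun _ => by simpa using (hR _).le).2
  | cons i L ih =>
    obtain ⟨hi, hL'⟩ := List.nodup_cons.1 hL
    rw [iterDir_cons]
    -- The i-th coordinate is moved to s and the others are left free. As i does not recur in L,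
    -- updating it leaves the remaining sum unchanged.
    have key : ∀ s : ℂ, ‖s‖ ≤ R i → ∀ s' : ι → ℂ, (∀ j, ‖s' j‖ ≤ R j) →
        AnalyticAt ℂ F (y + s • v i + (L.map fun j => s' j • v j).sum) ∧
        ‖F (y + s • v i + (L.map fun j => s' j • v j).sum)‖ ≤ M := by
      intro s hs s' hs'
      have h := hF (Function.update s' i s) fun j => by
        by_cases hj : j = i
        · subst hj; simpa using hs
        · simpa [hj] using hs' j
      have h2 : (L.map fun j => Function.update s' i s j • v j) = L.map fun j => s' j • v j :=
        List.map_congr_left fun j hj => by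
          have hne : j ≠ i := fun h => hi (h ▸ hj)
          rw [Function.update_of_ne hne]
      rwa [List.map_cons, List.sum_cons, h2, Function.update_self, ← add_assoc] at h
    refine (norm_iterate_dirDeriv_le (M := M *
      (L.map fun i => ((α i).factorial : ℝ) / R i ^ α i).prod) (hR i) (α i) fun s hs =>
      ⟨?_, ih hL' _ (key s hs)⟩).trans (le_of_eq ?_)
    · have := (key s hs 0 fun _ => by simpa using (hR _).le).1
      simp only [Pi.zero_apply, zero_smul, List.map_const', List.sum_replicate, smul_zero,
        add_zero] at this
      exact this.iterDir _ _ _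
    · rw [List.map_cons, List.prod_cons]
      ring

/-- Cauchy's estimate on a circle of radius comparable to ‖y - x‖ costs exactly one order of
vanishing. -/
theorem AnalyticAt.dirDeriv_isBigO {f : E → ℂ} {x : E} (hf : AnalyticAt ℂ f x) {m : ℕ}
    (h : f =O[𝓝 x] fun y => ‖y - x‖ ^ (m + 1)) (v : E) :
    _root_.dirDeriv v f =O[𝓝 x] fun y => ‖y - x‖ ^ m := by
  obtain ⟨C, hC0, hC⟩ := h.exists_pos
  obtain ⟨δ, hδ, hb⟩ := Metric.eventually_nhds_iff_ball.1 (hC.bound.and hf.eventually_analyticAt)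
  refine Asymptotics.IsBigO.of_bound (C * 2 ^ (m + 1) * (‖v‖ + 1)) ?_
  filter_upwards [Metric.ball_mem_nhds x (half_pos hδ)] with y hy
  rw [mem_ball_iff_norm] at hy
  have hv : 0 < ‖v‖ + 1 := by positivity
  -- The radius must be positive even at y = x, so R > ‖y - x‖ is used and R → ‖y - x‖ is taken at
  -- the end. Dividing it by ‖v‖ + 1 gives ‖sv‖ ≤ R, also for v = 0.
  have key : ∀ᶠ R in 𝓝[>] ‖y - x‖, ‖_root_.dirDeriv v f y‖ ≤
      C * 2 ^ (m + 1) * (‖v‖ + 1) * R ^ m := by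
    filter_upwards [Ioo_mem_nhdsGT hy] with R hR
    have hR0 : 0 < R := (norm_nonneg _).trans_lt hR.1
    have := norm_iterate_dirDeriv_le (G := f) (y := y) (v := v) (R := R / (‖v‖ + 1))
      (M := C * (2 * R) ^ (m + 1)) (by positivity) 1 fun s hs => by
        have h1 : ‖s • v‖ ≤ R := by
          rw [norm_smul]
          calc ‖s‖ * ‖v‖ ≤ R / (‖v‖ + 1) * (‖v‖ + 1) := by gcongr; linarith
            _ = R := by field_simp
        have h2 : ‖y + s • v - x‖ ≤ 2 * R := by
          calc ‖y + s • v - x‖ = ‖(y - x) + s • v‖ := by congr 1; abel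
            _ ≤ ‖y - x‖ + ‖s • v‖ := norm_add_le _ _
            _ ≤ 2 * R := by linarith [hR.1]
        have h3 := hb (y + s • v) (by rw [mem_ball_iff_norm]; linarith [hR.2])
        refine ⟨h3.2, h3.1.trans ?_⟩
        rw [norm_pow, norm_norm]
        gcongr
    refine this.trans (le_of_eq ?_)
    simp only [Nat.factorial_one, Nat.cast_one, mul_pow, pow_succ]
    field_simp
  have hc : Tendsto (fun R : ℝ => C * 2 ^ (m + 1) * (‖v‖ + 1) * R ^ m) (𝓝[>] ‖y - x‖)
      (𝓝 (C * 2 ^ (m + 1) * (‖v‖ + 1) * ‖y - x‖ ^ m)) :=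
    ((by fun_prop : Continuous fun R : ℝ =>
      C * 2 ^ (m + 1) * (‖v‖ + 1) * R ^ m).tendsto _).mono_left nhdsWithin_le_nhds
  simpa using ge_of_tendsto hc key

theorem AnalyticAt.iterate_dirDeriv_isBigO {f : E → ℂ} {x : E} (hf : AnalyticAt ℂ f x) {m k : ℕ}
    (h : f =O[𝓝 x] fun y => ‖y - x‖ ^ (m + k)) (v : E) :
    (_root_.dirDeriv v)^[k] f =O[𝓝 x] fun y => ‖y - x‖ ^ m := by
  induction k generalizing m with
  | zero => exact h
  | succ k ih =>
    rw [Function.iterate_succ_apply']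
    refine (hf.iterate_dirDeriv v k).dirDeriv_isBigO (ih (m := m + 1) ?_) v
    rwa [add_assoc, add_comm 1 k]

theorem AnalyticAt.iterDir_isBigO {ι : Type*} {f : E → ℂ} {x : E} (hf : AnalyticAt ℂ f x)
    (v : ι → E) (α : ι → ℕ) (L : List ι) {m : ℕ}
    (h : f =O[𝓝 x] fun y => ‖y - x‖ ^ (m + (L.map α).sum)) :
    _root_.iterDir v α L f =O[𝓝 x] fun y => ‖y - x‖ ^ m := by
  induction L generalizing m with
  | nil => simpa [_root_.iterDir] using h
  | cons i L ih =>
    rw [iterDir_cons]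
    refine (hf.iterDir v α L).iterate_dirDeriv_isBigO (ih (m := m + α i) ?_) (v i)
    rwa [add_assoc, ← List.sum_cons, ← List.map_cons]

end Cauchy

/-! ### The operator `e^{t⟨∂_{ζ'}, ∂_{z'}⟩}` on a fibre -/

section Fibre

variable {n : ℕ} {X : Type*} [NormedAddCommGroup X] [NormedSpace ℂ X]

/-- The directions `∂_{z'_i}` and `∂_{ζ'_i}`. -/
def mixedDirection (n : ℕ) : Fin n ⊕ Fin n → CSp n × CSp n :=
  Sum.elim (fun i => (Pi.single i 1, 0)) (fun i => (0, Pi.single i 1))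

/-- The order in which the derivatives in `mixedDeriv` are taken. -/
def mixedList (n : ℕ) : List (Fin n ⊕ Fin n) :=
  (List.finRange n).map Sum.inr ++ (List.finRange n).map Sum.inl

/-- Both families of derivatives form one iterated derivative over the index set `Fin n ⊕ Fin n`,
with α used twice; Cauchy estimates and vanishing orders then come from the general case. -/
theorem mixedDeriv_eq_iterDir (α : Fin n → ℕ) (F : CSp n × CSp n → ℂ) :
    mixedDeriv α F = iterDir (mixedDirection n) (Sum.elim α α) (mixedList n) F := by
  simp only [mixedDeriv, multiDeriv, iterDir, mixedList, List.foldr_append, List.foldr_map]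
  rfl

theorem nodup_mixedList : (mixedList n).Nodup := by
  refine List.Nodup.append ((List.nodup_finRange n).map Sum.inr_injective)
    ((List.nodup_finRange n).map Sum.inl_injective) ?_
  intro a ha hb
  obtain ⟨i, -, rfl⟩ := List.mem_map.1 ha
  obtain ⟨j, -, h⟩ := List.mem_map.1 hb
  simp at h

/-- The parameter is made a variable of a product space, where the derivatives go in the directions
(0, v). Analyticity in the parameter and commutation with its derivatives follow. -/
theorem mixedDeriv_slice (α : Fin n → ℕ) (F : X × (CSp n × CSp n) → ℂ) (x : X)
    (y : CSp n × CSp n) :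
    mixedDeriv α (fun y => F (x, y)) y =
      iterDir (fun i => ((0, mixedDirection n i) : X × (CSp n × CSp n))) (Sum.elim α α)
        (mixedList n) F (x, y) := by
  rw [mixedDeriv_eq_iterDir, iterDir_comp_affine (fun y => (x, y)) _
    (fun i => ((0, mixedDirection n i) : X × (CSp n × CSp n)))]
  intro i y t
  simp

theorem analyticAt_mixedDeriv_slice (α : Fin n → ℕ) {F : X × (CSp n × CSp n) → ℂ} {x : X}
    {y : CSp n × CSp n} (hF : AnalyticAt ℂ F (x, y)) :
    AnalyticAt ℂ (fun x => mixedDeriv α (fun y => F (x, y)) y) x := by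
  simp only [mixedDeriv_slice]
  exact (hF.iterDir _ _ _).fun_comp (f := fun x => (x, y)) (analyticAt_id.prod analyticAt_const)

/-- Each of the two groups of derivatives has order l, hence the loss of 2l. -/
theorem mixedDeriv_slice_isBigO {α : Fin n → ℕ} {l m : ℕ} (hα : ∑ i, α i = l)
    {F : X × (CSp n × CSp n) → ℂ} {x : X} {y : CSp n × CSp n} (hF : AnalyticAt ℂ F (x, y))
    (h : F =O[𝓝 (x, y)] fun q => ‖q - (x, y)‖ ^ (m + 2 * l)) :
    (fun x => mixedDeriv α (fun y => F (x, y)) y) =O[𝓝 x] fun x' => ‖x' - x‖ ^ m := by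
  simp only [mixedDeriv_slice]
  have hs : ((mixedList n).map (Sum.elim α α)).sum = 2 * l := by
    simp only [mixedList, List.map_append, List.map_map, List.sum_append, two_mul, ← hα]
    rw [← List.sum_ofFn, List.ofFn_eq_map]
    rfl
  have h1 := hF.iterDir_isBigO (fun i => ((0, mixedDirection n i) : X × (CSp n × CSp n)))
    (Sum.elim α α) (mixedList n) (m := m) (by rwa [hs])
  have hc : Tendsto (fun x' : X => (x', y)) (𝓝 x) (𝓝 (x, y)) :=
    (by fun_prop : Continuous fun x' : X => (x', y)).tendsto x
  refine (h1.comp_tendsto hc).trans (Asymptotics.isBigO_of_le _ fun x' => ?_)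
  simp [Prod.norm_def]

theorem iterate_dirDeriv_mixedDeriv (α : Fin n → ℕ) {F : X × (CSp n × CSp n) → ℂ} {x : X}
    {y : CSp n × CSp n} (hF : AnalyticAt ℂ F (x, y)) (a : X) (k : ℕ) :
    (dirDeriv a)^[k] (fun x => mixedDeriv α (fun y => F (x, y)) y) x =
      mixedDeriv α (fun y => (dirDeriv a)^[k] (fun x => F (x, y)) x) y := by
  have hA : ∀ (y : CSp n × CSp n) (G : X × (CSp n × CSp n) → ℂ),
      (dirDeriv a)^[k] (fun x => G (x, y)) = fun x => (dirDeriv (a, 0))^[k] G (x, y) :=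
    fun y G => iterate_dirDeriv_comp_affine (fun x => (x, y)) a (a, 0)
      (fun x t => by simp) G k
  simp only [hA, mixedDeriv_slice]
  rw [iterate_dirDeriv_eq_iterDir, iterate_dirDeriv_eq_iterDir]
  exact iterDir_comm hF _ _ _ _ _ _

theorem mixedDeriv_sum {κ : Type*} (s : Finset κ) (c : κ → ℂ) {f : κ → CSp n × CSp n → ℂ}
    {y : CSp n × CSp n} (hf : ∀ k ∈ s, AnalyticAt ℂ (f k) y) (α : Fin n → ℕ) :
    mixedDeriv α (fun y => ∑ k ∈ s, c k * f k y) y = ∑ k ∈ s, c k * mixedDeriv α (f k) y := by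
  simp only [mixedDeriv_eq_iterDir]
  exact iterDir_sum s c hf _ _ _

/-- The coefficient of `tˡ` in `e^{t⟨∂_{ζ'}, ∂_{z'}⟩} p(ζ' + ᵗB(z') λ)` at `z' = 0`, `ζ' = 0`. -/
noncomputable def fibreOp (B : CSp n → Matrix (Fin n) (Fin n) ℂ) (l : ℕ) (p : CSp n → ℂ)
    (lam : CSp n) : ℂ :=
  ∑ α ∈ Finset.piAntidiag (Finset.univ : Finset (Fin n)) l,
    (∏ i, ((α i).factorial : ℂ))⁻¹ *
      mixedDeriv α (fun y : CSp n × CSp n => p (y.2 + (B y.1).transpose.mulVec lam)) (0, 0)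

/-- The reduction to a fibre: z and η are frozen, and only B and the function ζ ↦ P_k(z, ζ, η)
remain. -/
theorem pullback_eq_sum_fibreOp (Φ : OpenPartialHomeomorph (CSp n) (CSp n))
    (J : CSp n → CSp n → Matrix (Fin n) (Fin n) ℂ) (P : FormalSer n) (ν : ℕ)
    (x : CSp n × CSp n × ℂ) :
    pullback Φ J P ν x = ∑ kl ∈ Finset.HasAntidiagonal.antidiagonal ν,
      fibreOp (fun z' => J (Φ x.1 + z') (Φ x.1)) kl.2 (fun ζ => P kl.1 (Φ x.1, ζ, x.2.2)) x.2.1 :=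
  rfl

theorem analyticAt_mulVec {f : X → Matrix (Fin n) (Fin n) ℂ} {g : X → CSp n} {x : X}
    (hf : ∀ i j, AnalyticAt ℂ (fun x => f x i j) x) (hg : AnalyticAt ℂ g x) :
    AnalyticAt ℂ (fun x => (f x).mulVec (g x)) x := by
  rw [analyticAt_pi_iff]
  intro i
  simp only [Matrix.mulVec, dotProduct]
  exact Finset.analyticAt_fun_sum _ fun j _ => (hf i j).mul (analyticAt_pi_iff.1 hg j)

theorem analyticAt_dotProduct {f g : X → CSp n} {x : X} (hf : AnalyticAt ℂ f x)
    (hg : AnalyticAt ℂ g x) : AnalyticAt ℂ (fun x => f x ⬝ᵥ g x) x := by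
  simp only [dotProduct]
  exact Finset.analyticAt_fun_sum _ fun j _ =>
    (analyticAt_pi_iff.1 hf j).mul (analyticAt_pi_iff.1 hg j)

theorem analyticAt_fibreArg {B : CSp n → Matrix (Fin n) (Fin n) ℂ}
    (hB : ∀ i j, AnalyticAt ℂ (fun z => B z i j) 0) (lam ζ : CSp n) :
    AnalyticAt ℂ (fun q : CSp n × (CSp n × CSp n) =>
      q.2.2 + (B q.2.1).transpose.mulVec q.1) (lam, (0, ζ)) := by
  refine ((analyticAt_snd.fun_comp analyticAt_snd)).add (analyticAt_mulVec (fun i j => ?_) analyticAt_fst)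
  exact (hB j i).fun_comp_of_eq (analyticAt_fst.fun_comp analyticAt_snd) rfl

theorem analyticAt_fibreComp {B : CSp n → Matrix (Fin n) (Fin n) ℂ}
    (hB : ∀ i j, AnalyticAt ℂ (fun z => B z i j) 0) {p : CSp n → ℂ} {lam : CSp n}
    (hp : AnalyticAt ℂ p ((B 0).transpose.mulVec lam)) :
    AnalyticAt ℂ (fun q : CSp n × (CSp n × CSp n) =>
      p (q.2.2 + (B q.2.1).transpose.mulVec q.1)) (lam, (0, 0)) :=
  hp.fun_comp_of_eq (analyticAt_fibreArg hB lam 0) (by simp)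

theorem fibreOp_sum {κ : Type*} (s : Finset κ) (c : κ → ℂ) {B : CSp n → Matrix (Fin n) (Fin n) ℂ}
    (hB : ∀ i j, AnalyticAt ℂ (fun z => B z i j) 0) {p : κ → CSp n → ℂ} {lam : CSp n}
    (hp : ∀ k ∈ s, AnalyticAt ℂ (p k) ((B 0).transpose.mulVec lam)) (l : ℕ) :
    fibreOp B l (fun ζ => ∑ k ∈ s, c k * p k ζ) lam = ∑ k ∈ s, c k * fibreOp B l (p k) lam := by
  simp only [fibreOp, Finset.mul_sum]
  rw [Finset.sum_comm]
  refine Finset.sum_congr rfl fun α _ => ?_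
  rw [mixedDeriv_sum s c (f := fun k y => p k (y.2 + (B y.1).transpose.mulVec lam)) fun k hk =>
    (analyticAt_fibreComp hB (hp k hk)).fun_comp_of_eq (f := fun y => (lam, y))
      (analyticAt_const.prod analyticAt_id) rfl, Finset.mul_sum]
  exact Finset.sum_congr rfl fun k _ => by ring

theorem analyticAt_fibreOp {B : CSp n → Matrix (Fin n) (Fin n) ℂ}
    (hB : ∀ i j, AnalyticAt ℂ (fun z => B z i j) 0) {p : CSp n → ℂ} {lam : CSp n}
    (hp : AnalyticAt ℂ p ((B 0).transpose.mulVec lam)) (l : ℕ) :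
    AnalyticAt ℂ (fibreOp B l p) lam :=
  Finset.analyticAt_fun_sum _ fun α _ => analyticAt_const.mul
    (analyticAt_mixedDeriv_slice α (analyticAt_fibreComp hB hp))

/-- The argument ζ' + ᵗB(z')λ is differentiable in all variables, so composing with it preserves the
vanishing order; the 2l derivatives then lower it. -/
theorem fibreOp_isBigO {B : CSp n → Matrix (Fin n) (Fin n) ℂ}
    (hB : ∀ i j, AnalyticAt ℂ (fun z => B z i j) 0) {p : CSp n → ℂ} {lam ζ : CSp n}
    (hζ : (B 0).transpose.mulVec lam = ζ) (hp : AnalyticAt ℂ p ζ) {l m : ℕ}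
    (h : p =O[𝓝 ζ] fun ζ' => ‖ζ' - ζ‖ ^ (m + 2 * l)) :
    fibreOp B l p =O[𝓝 lam] fun lam' => ‖lam' - lam‖ ^ m := by
  subst hζ
  have hA := analyticAt_fibreArg hB lam 0
  refine Asymptotics.IsBigO.fun_sum fun α hα => Asymptotics.IsBigO.const_mul_left
    (mixedDeriv_slice_isBigO (Finset.mem_piAntidiag.1 hα).1 (analyticAt_fibreComp hB hp) ?_) _
  have hc := hA.continuousAt.tendsto
  simp only [zero_add] at hc
  refine (h.comp_tendsto hc).trans ?_
  have hd := hA.differentiableAt.isBigO_sub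
  simp only [zero_add] at hd
  exact hd.norm_norm.pow (m + 2 * l)

theorem iterDir_fst_mul {ι : Type*} (v : ι → CSp n) (α : ι → ℕ) (L : List ι) (c g : CSp n → ℂ) :
    iterDir (fun i => ((v i, 0) : CSp n × CSp n)) α L (fun y => c y.2 * g y.1) =
      fun y => c y.2 * iterDir v α L g y.1 := by
  have h1 : ∀ (w : CSp n) (g : CSp n → ℂ), dirDeriv ((w, 0) : CSp n × CSp n)
      (fun y => c y.2 * g y.1) = fun y => c y.2 * dirDeriv w g y.1 := by
    intro w g
    funext y
    simp [dirDeriv, lineDeriv, deriv_const_mul_field]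
  have h2 : ∀ (w : CSp n) (g : CSp n → ℂ) (k : ℕ), (dirDeriv ((w, 0) : CSp n × CSp n))^[k]
      (fun y => c y.2 * g y.1) = fun y => c y.2 * (dirDeriv w)^[k] g y.1 := by
    intro w g k
    induction k with
    | zero => rfl
    | succ k ih => rw [Function.iterate_succ_apply', ih, h1]; simp only [Function.iterate_succ_apply']
  induction L with
  | nil => rfl
  | cons i L ih => rw [iterDir_cons, ih, h2]; rfl

theorem iterDir_snd_exp (α : Fin n → ℕ) (L : List (Fin n)) (x : CSp n) (g : CSp n → ℂ) :
    iterDir (fun i => ((0, Pi.single i 1) : CSp n × CSp n)) α L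
        (fun y => Complex.exp (y.2 ⬝ᵥ x) * g y.1) =
      fun y => Complex.exp (y.2 ⬝ᵥ x) * ((L.map fun i => x i ^ α i).prod * g y.1) := by
  have h1 : ∀ (i : Fin n) (g : CSp n → ℂ), dirDeriv ((0, Pi.single i 1) : CSp n × CSp n)
      (fun y => Complex.exp (y.2 ⬝ᵥ x) * g y.1) =
        fun y => Complex.exp (y.2 ⬝ᵥ x) * (x i * g y.1) := by
    intro i g
    funext y
    simp only [dirDeriv, lineDeriv, Prod.fst_add, Prod.snd_add, Prod.smul_fst, Prod.smul_snd,
      smul_zero, add_zero, deriv_mul_const_field, add_dotProduct, smul_dotProduct,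
      single_dotProduct, smul_eq_mul, one_mul]
    have h : HasDerivAt (fun t : ℂ => Complex.exp (y.2 ⬝ᵥ x + t * x i))
        (Complex.exp (y.2 ⬝ᵥ x + 0 * x i) * (1 * x i)) 0 :=
      (((hasDerivAt_id (0 : ℂ)).mul_const (x i)).const_add _).cexp
    rw [h.deriv]
    simp only [zero_mul, add_zero, one_mul]
    ring
  have h2 : ∀ (i : Fin n) (g : CSp n → ℂ) (k : ℕ),
      (dirDeriv ((0, Pi.single i 1) : CSp n × CSp n))^[k]
      (fun y => Complex.exp (y.2 ⬝ᵥ x) * g y.1) =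
        fun y => Complex.exp (y.2 ⬝ᵥ x) * (x i ^ k * g y.1) := by
    intro i g k
    induction k with
    | zero => simp
    | succ k ih =>
      rw [Function.iterate_succ_apply', ih, h1 i (fun z => x i ^ k * g z)]
      funext y
      ring
  induction L with
  | nil => simp [iterDir]
  | cons i L ih =>
    rw [iterDir_cons, ih, h2 i (fun z => (L.map fun i => x i ^ α i).prod * g z)]
    simp only [List.map_cons, List.prod_cons, mul_assoc]

/-- The integrand splits as e^{⟨ζ',x⟩} e^{⟨λ, B(z')x⟩}. The ζ'-derivatives produce x^α, and the sum
of x^α ∂_{z'}^α / α! over |α| = l is the l-th Taylor term in the direction x. -/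
theorem fibreOp_exp {B : CSp n → Matrix (Fin n) (Fin n) ℂ}
    (hB : ∀ i j, AnalyticAt ℂ (fun z => B z i j) 0) (l : ℕ) (x lam : CSp n) :
    fibreOp B l (fun ζ => Complex.exp (ζ ⬝ᵥ x)) lam =
      (l.factorial : ℂ)⁻¹ *
        (dirDeriv 1)^[l] (fun t : ℂ => Complex.exp (lam ⬝ᵥ (B (t • x)).mulVec x)) 0 := by
  set g : CSp n → ℂ := fun z => Complex.exp (lam ⬝ᵥ (B z).mulVec x) with hg
  have hga : AnalyticAt ℂ g 0 :=
    (analyticAt_dotProduct analyticAt_const (analyticAt_mulVec hB analyticAt_const)).cexp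
  have h1 : ∀ α : Fin n → ℕ, mixedDeriv α (fun y : CSp n × CSp n =>
      Complex.exp ((y.2 + (B y.1).transpose.mulVec lam) ⬝ᵥ x)) (0, 0) =
      (∏ i, x i ^ α i) * multiDeriv (fun i => (Pi.single i 1 : CSp n)) α g 0 := by
    intro α
    have h2 : (fun y : CSp n × CSp n =>
        Complex.exp ((y.2 + (B y.1).transpose.mulVec lam) ⬝ᵥ x)) =
        fun y => Complex.exp (y.2 ⬝ᵥ x) * g y.1 := by
      funext y
      rw [add_dotProduct, Complex.exp_add, hg, Matrix.mulVec_transpose, ← Matrix.dotProduct_mulVec]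
    rw [h2, mixedDeriv, multiDeriv_eq_iterDir, multiDeriv_eq_iterDir, iterDir_fst_mul _ _ _ (fun ζ => Complex.exp (ζ ⬝ᵥ x)),
      iterDir_snd_exp, multiDeriv_eq_iterDir, ← List.ofFn_eq_map, List.prod_ofFn]
    simp
  simp only [fibreOp, h1]
  rw [sum_multiDeriv_eq hga]
  have h3 : ∑ i, x i • (Pi.single i 1 : CSp n) = x := by
    funext j
    simp [Finset.sum_apply, Pi.single_apply]
  rw [h3, iterate_dirDeriv_comp_affine (fun t : ℂ => t • x) 1 x
    (fun s t => by simp [add_smul]) g]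
  simp

/-- A linear functional on germs of analytic functions which depends on a finite jet only is
determined by its values on exponentials. -/
theorem functional_eq_zero {L : (CSp n → ℂ) → ℂ} {ζ₀ : CSp n} (N : ℕ)
    (hlin : ∀ {κ : Type} (s : Finset κ) (c : κ → ℂ) (f : κ → CSp n → ℂ),
      (∀ k ∈ s, AnalyticAt ℂ (f k) ζ₀) →
        L (fun y => ∑ k ∈ s, c k * f k y) = ∑ k ∈ s, c k * L (f k))
    (hvan : ∀ f, AnalyticAt ℂ f ζ₀ → (f =O[𝓝 ζ₀] fun y => ‖y - ζ₀‖ ^ N) → L f = 0)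
    (hexp : ∀ x : CSp n, L (fun ζ => Complex.exp (ζ ⬝ᵥ x)) = 0) {p : CSp n → ℂ}
    (hp : AnalyticAt ℂ p ζ₀) : L p = 0 := by
  -- By linearity and the vanishing hypothesis, L depends only on the function modulo terms of order
  -- N.
  have hcongr : ∀ f g, AnalyticAt ℂ f ζ₀ → AnalyticAt ℂ g ζ₀ →
      ((fun y => f y - g y) =O[𝓝 ζ₀] fun y => ‖y - ζ₀‖ ^ N) → L f = L g := by
    intro f g hf hg h
    have h1 := hlin (Finset.univ : Finset (Fin 2)) ![1, -1] ![f, g] (fun k _ => by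
      fin_cases k; exacts [hf, hg])
    have h2 := hvan _ (hf.sub hg) h
    simp only [Fin.sum_univ_two, Matrix.cons_val_zero, Matrix.cons_val_one, one_mul, neg_mul,
      ← sub_eq_add_neg] at h1
    exact sub_eq_zero.1 (h1.symm.trans h2)
  have hcoord : ∀ i, AnalyticAt ℂ (fun y : CSp n => y i - ζ₀ i) ζ₀ := fun i =>
    (analyticAt_pi_iff.1 analyticAt_id i).sub analyticAt_const
  set mono : (Fin n → ℕ) → CSp n → ℂ := fun α y => ∏ i, (y i - ζ₀ i) ^ α i with hmono
  have hmonoA : ∀ α, AnalyticAt ℂ (mono α) ζ₀ := fun α =>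
    Finset.analyticAt_fun_prod _ fun i _ => (hcoord i).pow _
  set s : Finset (Fin n → ℕ) :=
    (Finset.range N).biUnion (Finset.piAntidiag (Finset.univ : Finset (Fin n))) with hs
  have hmem : ∀ α, α ∈ s ↔ ∑ i, α i < N := by
    intro α
    simp [hs]
  have hzero : ∀ α ∈ s, L (mono α) = 0 := by
    -- Modulo order N, e^{⟨ζ - ζ₀, x⟩} is its truncated exponential series, sorted here by monomials
    -- in ζ - ζ₀. Applying L yields a polynomial in x that vanishes everywhere.
    have hpoly : ∀ x : CSp n, ∑ α ∈ s, (∏ i, ((α i).factorial : ℂ))⁻¹ * (∏ i, x i ^ α i) *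
        L (mono α) = 0 := by
      intro x
      rw [← hlin s _ _ fun α _ => hmonoA α]
      have h1 : L (fun ζ => Complex.exp (-(ζ₀ ⬝ᵥ x)) * Complex.exp (ζ ⬝ᵥ x)) = 0 := by
        have := hlin (Finset.univ : Finset Unit) (fun _ => Complex.exp (-(ζ₀ ⬝ᵥ x)))
          (fun _ ζ => Complex.exp (ζ ⬝ᵥ x))
          (fun _ _ => (analyticAt_dotProduct analyticAt_id analyticAt_const).cexp)
        simpa [hexp] using this
      rw [← h1]
      refine hcongr _ _ (Finset.analyticAt_fun_sum _ fun α _ => analyticAt_const.mul (hmonoA α))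
        (analyticAt_const.mul (analyticAt_dotProduct analyticAt_id analyticAt_const).cexp) ?_
      have h2 : ∀ y : CSp n, ∑ α ∈ s, (∏ i, ((α i).factorial : ℂ))⁻¹ * (∏ i, x i ^ α i) *
          mono α y = ∑ m ∈ Finset.range N, ((y - ζ₀) ⬝ᵥ x) ^ m / m.factorial := by
        intro y
        rw [hs, Finset.sum_biUnion (fun m _ m' _ hmm => Finset.disjoint_left.2 fun α h h' =>
          hmm ((Finset.mem_piAntidiag.1 h).1.symm.trans (Finset.mem_piAntidiag.1 h').1))]
        refine Finset.sum_congr rfl fun m _ => ?_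
        rw [dotProduct, Finset.sum_pow_eq_sum_piAntidiag, Finset.sum_div]
        refine Finset.sum_congr rfl fun α hα => ?_
        have h4 : (∏ i, ((α i).factorial : ℂ)) * (Nat.multinomial Finset.univ α : ℂ) =
            m.factorial := by
          rw [← (Finset.mem_piAntidiag.1 hα).1, ← Nat.multinomial_spec]; push_cast; rfl
        have h5 : (∏ i, ((α i).factorial : ℂ)) ≠ 0 :=
          Finset.prod_ne_zero_iff.2 fun i _ => Nat.cast_ne_zero.2 (Nat.factorial_ne_zero _)
        have h6 : (m.factorial : ℂ) ≠ 0 := Nat.cast_ne_zero.2 (Nat.factorial_ne_zero _)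
        have h7 : (Nat.multinomial Finset.univ α : ℂ) ≠ 0 :=
          fun h => h6 (by rw [← h4, h, mul_zero])
        simp only [hmono, Pi.sub_apply, mul_pow, Finset.prod_mul_distrib, ← h4]
        field_simp
      simp only [h2]
      have h3 : ∀ y : CSp n, Complex.exp (-(ζ₀ ⬝ᵥ x)) * Complex.exp (y ⬝ᵥ x) =
          Complex.exp ((y - ζ₀) ⬝ᵥ x) := by
        intro y
        rw [← Complex.exp_add, sub_dotProduct]
        congr 1
        ring
      simp only [h3]
      have hE : (fun t : ℂ => ∑ m ∈ Finset.range N, t ^ m / m.factorial - Complex.exp t) =O[𝓝 0]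
          fun t => ‖t‖ ^ N := by
        refine ((Complex.exp_sub_sum_range_isBigO_pow N).neg_left.trans
          (Asymptotics.isBigO_of_le _ fun t => by simp)).congr_left fun t => ?_
        ring
      have ht : Tendsto (fun y : CSp n => (y - ζ₀) ⬝ᵥ x) (𝓝 ζ₀) (𝓝 0) := by
        have := (analyticAt_dotProduct (analyticAt_id.sub (analyticAt_const (v := ζ₀)))
          (analyticAt_const (v := x)) (x := ζ₀)).continuousAt.tendsto
        simpa using this
      refine (hE.comp_tendsto ht).trans ?_
      have hd := (analyticAt_dotProduct (analyticAt_id.sub (analyticAt_const (v := ζ₀)))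
          (analyticAt_const (v := x)) (x := ζ₀)).differentiableAt.isBigO_sub
      simp only [id_eq, Pi.sub_apply, sub_self, zero_dotProduct, sub_zero] at hd
      exact hd.norm_norm.pow N
    intro α hα
    -- A polynomial vanishing on all of ℂⁿ is zero; its coefficients are L(mono α)/α!.
    set Q : MvPolynomial (Fin n) ℂ := ∑ α ∈ s, MvPolynomial.monomial
      (Finsupp.equivFunOnFinite.symm α) ((∏ i, ((α i).factorial : ℂ))⁻¹ * L (mono α)) with hQ
    have hQ0 : Q = 0 := by
      refine MvPolynomial.funext fun x => ?_
      rw [hQ, map_sum, map_zero, ← hpoly x]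
      refine Finset.sum_congr rfl fun β _ => ?_
      rw [MvPolynomial.eval_monomial, Finsupp.prod_fintype _ _ (by simp)]
      simp only [Finsupp.equivFunOnFinite_symm_apply_apply]
      ring
    have hco := congrArg (MvPolynomial.coeff (Finsupp.equivFunOnFinite.symm α)) hQ0
    rw [hQ, MvPolynomial.coeff_sum, MvPolynomial.coeff_zero] at hco
    simp only [MvPolynomial.coeff_monomial, EmbeddingLike.apply_eq_iff_eq] at hco
    rw [Finset.sum_ite_eq' s α, if_pos hα] at hco
    exact (mul_eq_zero.1 hco).resolve_left (inv_ne_zero (Finset.prod_ne_zero_iff.2 fun i _ =>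
      Nat.cast_ne_zero.2 (Nat.factorial_ne_zero _)))
  -- A general p is replaced by its Taylor polynomial. Expanding each multilinear term in the
  -- standard basis writes it through products of coordinates of y - ζ₀, indexed by maps `Fin m →
  -- Fin n`.
  obtain ⟨q, hq⟩ := hp
  have hO := hq.isBigO_sub_partialSum_pow N
  set c : (Σ m : ℕ, Fin m → Fin n) → ℂ := fun f => q f.1 fun j => Pi.single (f.2 j) 1 with hc
  set e : (Σ m : ℕ, Fin m → Fin n) → CSp n → ℂ := fun f y => ∏ j, (y (f.2 j) - ζ₀ (f.2 j)) with he
  have heA : ∀ f, AnalyticAt ℂ (e f) ζ₀ := fun f =>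
    Finset.analyticAt_fun_prod _ fun j _ => hcoord _
  set S : Finset (Σ m : ℕ, Fin m → Fin n) := (Finset.range N).sigma fun _ => Finset.univ with hS
  have hsum : ∀ y, q.partialSum N (y - ζ₀) = ∑ f ∈ S, c f * e f y := by
    intro y
    rw [FormalMultilinearSeries.partialSum, hS, Finset.sum_sigma]
    refine Finset.sum_congr rfl fun m _ => ?_
    have h1 : y - ζ₀ = ∑ i, (y i - ζ₀ i) • (Pi.single i 1 : CSp n) := by
      funext j
      simp [Finset.sum_apply, Pi.single_apply]
    rw [h1]
    have h2 := (q m).toMultilinearMap.map_sum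
      (g := fun (_ : Fin m) (i : Fin n) => (y i - ζ₀ i) • (Pi.single i 1 : CSp n))
    refine h2.trans (Finset.sum_congr rfl fun f _ => ?_)
    rw [MultilinearMap.map_smul_univ, smul_eq_mul, mul_comm]
    rfl
  have hLe : ∀ f ∈ S, L (e f) = 0 := by
    rintro ⟨m, f⟩ hf
    have hm : m < N := by simpa [hS] using hf
    -- The exponents are the cardinalities of the fibres of f.
    have : e ⟨m, f⟩ = mono fun i => (Finset.univ.filter fun j => f j = i).card := by
      funext y
      simp only [he, hmono]
      rw [← Finset.prod_fiberwise' Finset.univ f fun i => y i - ζ₀ i]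
      simp
    rw [this]
    refine hzero _ ((hmem _).2 (lt_of_eq_of_lt ?_ hm))
    rw [← Finset.card_eq_sum_card_fiberwise (fun _ _ => Finset.mem_univ _)]
    simp
  have hfin : L p = L (fun y => ∑ f ∈ S, c f * e f y) := by
    refine hcongr _ _ ⟨q, hq⟩ (Finset.analyticAt_fun_sum _ fun f _ =>
      analyticAt_const.mul (heA f)) ?_
    have ht : Tendsto (fun y : CSp n => y - ζ₀) (𝓝 ζ₀) (𝓝 0) := by
      have : Continuous fun y : CSp n => y - ζ₀ := by fun_prop
      simpa using this.tendsto ζ₀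
    have h3 := hO.comp_tendsto ht
    simpa [Function.comp_def, hsum] using h3
  rw [hfin, hlin S c e fun f _ => heA f]
  exact Finset.sum_eq_zero fun f hf => by rw [hLe f hf, mul_zero]

end Fibre

/-! ### Composition of the fibre operators -/

section Composition

variable {n : ℕ}

theorem iterate_dirDeriv_congr {E : Type*} [NormedAddCommGroup E] [NormedSpace ℂ E] {f g : E → ℂ}
    {x : E} (h : f =ᶠ[𝓝 x] g) (v : E) (k : ℕ) :
    (dirDeriv v)^[k] f x = (dirDeriv v)^[k] g x := by
  obtain ⟨U, hU, hUo, hx⟩ := eventually_nhds_iff.1 h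
  exact iterate_dirDeriv_eqOn hUo (fun y hy => hU y hy) v k hx

theorem iterate_dirDeriv_sum {E : Type*} [NormedAddCommGroup E] [NormedSpace ℂ E] {κ : Type*}
    (s : Finset κ) (c : κ → ℂ) {f : κ → E → ℂ} {x : E} (hf : ∀ k ∈ s, AnalyticAt ℂ (f k) x)
    (v : E) (m : ℕ) :
    (dirDeriv v)^[m] (fun y => ∑ k ∈ s, c k * f k y) x =
      ∑ k ∈ s, c k * (dirDeriv v)^[m] (f k) x := by
  simp only [iterate_dirDeriv_eq_iterDir]
  exact iterDir_sum s c hf _ _ _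

theorem iterate_dirDeriv_const_mul {E : Type*} [NormedAddCommGroup E] [NormedSpace ℂ E]
    (c : ℂ) {f : E → ℂ} {x : E} (hf : AnalyticAt ℂ f x) (v : E) (m : ℕ) :
    (dirDeriv v)^[m] (fun y => c * f y) x = c * (dirDeriv v)^[m] f x := by
  simpa using iterate_dirDeriv_sum (Finset.univ : Finset Unit) (fun _ => c) (f := fun _ => f)
    (fun _ _ => hf) v m

theorem fibreOp_const_mul (c : ℂ) {B : CSp n → Matrix (Fin n) (Fin n) ℂ}
    (hB : ∀ i j, AnalyticAt ℂ (fun z => B z i j) 0) {p : CSp n → ℂ} {lam : CSp n}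
    (hp : AnalyticAt ℂ p ((B 0).transpose.mulVec lam)) (l : ℕ) :
    fibreOp B l (fun ζ => c * p ζ) lam = c * fibreOp B l p lam := by
  simpa using fibreOp_sum (Finset.univ : Finset Unit) (fun _ => c) hB (p := fun _ => p)
    (fun _ _ => hp) l

theorem mixedDeriv_congr {F G : CSp n × CSp n → ℂ} {y : CSp n × CSp n} (h : F =ᶠ[𝓝 y] G)
    (α : Fin n → ℕ) : mixedDeriv α F y = mixedDeriv α G y := by
  obtain ⟨U, hU, hUo, hx⟩ := eventually_nhds_iff.1 h
  simp only [mixedDeriv_eq_iterDir]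
  exact iterDir_eqOn hUo (fun y hy => hU y hy) _ _ _ hx

theorem fibreOp_congr {B : CSp n → Matrix (Fin n) (Fin n) ℂ}
    (hB : ∀ i j, AnalyticAt ℂ (fun z => B z i j) 0) {p q : CSp n → ℂ} {lam : CSp n}
    (h : p =ᶠ[𝓝 ((B 0).transpose.mulVec lam)] q) (l : ℕ) :
    fibreOp B l p lam = fibreOp B l q lam := by
  refine Finset.sum_congr rfl fun α _ => congrArg _ (mixedDeriv_congr ?_ α)
  have hc : ContinuousAt (fun y : CSp n × CSp n => y.2 + (B y.1).transpose.mulVec lam) (0, 0) :=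
    ((analyticAt_fibreArg hB lam 0).fun_comp_of_eq (f := fun y : CSp n × CSp n => (lam, y))
      (analyticAt_const.prod analyticAt_id) rfl).continuousAt
  have ht := hc.tendsto
  simp only [zero_add] at ht
  exact ht.eventually h

theorem analyticAt_exp_dotProduct (x ζ : CSp n) :
    AnalyticAt ℂ (fun ζ : CSp n => Complex.exp (ζ ⬝ᵥ x)) ζ :=
  (analyticAt_dotProduct analyticAt_id analyticAt_const).cexp

/-- With V(s) = B₁(sx)x, the function H(s, t) = exp⟨μ, B₂(tV(s))V(s)⟩ generates the iterated
operators: s counts the order of the inner one, t that of the outer one. -/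
theorem fibreOp_exp_comp {B₁ B₂ B₃ : CSp n → Matrix (Fin n) (Fin n) ℂ}
    (h₁ : ∀ i j, AnalyticAt ℂ (fun z => B₁ z i j) 0)
    (h₂ : ∀ i j, AnalyticAt ℂ (fun z => B₂ z i j) 0)
    (h₃ : ∀ i j, AnalyticAt ℂ (fun z => B₃ z i j) 0) (x μ : CSp n)
    (h : ∀ᶠ t : ℂ in 𝓝[≠] 0, (B₂ (t • (B₁ (t • x)).mulVec x)).mulVec ((B₁ (t • x)).mulVec x) =
      (B₃ (t • x)).mulVec x) (j : ℕ) :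
    ∑ lm ∈ Finset.HasAntidiagonal.antidiagonal j,
      fibreOp B₂ lm.2 (fibreOp B₁ lm.1 fun ζ => Complex.exp (ζ ⬝ᵥ x)) μ =
    fibreOp B₃ j (fun ζ => Complex.exp (ζ ⬝ᵥ x)) μ := by
  have hsmul : AnalyticAt ℂ (fun t : ℂ => t • x) 0 := analyticAt_id.smul analyticAt_const
  set V : ℂ → CSp n := fun s => (B₁ (s • x)).mulVec x with hV
  have hVa : AnalyticAt ℂ V 0 := analyticAt_mulVec
    (fun i j => (h₁ i j).fun_comp_of_eq hsmul (zero_smul _ _)) analyticAt_const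
  set H : ℂ × ℂ → ℂ := fun q => Complex.exp (μ ⬝ᵥ (B₂ (q.2 • V q.1)).mulVec (V q.1)) with hH
  have hV1 : AnalyticAt ℂ (fun q : ℂ × ℂ => V q.1) (0, 0) :=
    hVa.fun_comp_of_eq analyticAt_fst rfl
  have hHa : AnalyticAt ℂ H (0, 0) :=
    (analyticAt_dotProduct analyticAt_const (analyticAt_mulVec
      (fun i j => (h₂ i j).fun_comp_of_eq (analyticAt_snd.smul hV1) (by simp)) hV1)).cexp
  have hterm : ∀ l m : ℕ, fibreOp B₂ m (fibreOp B₁ l fun ζ => Complex.exp (ζ ⬝ᵥ x)) μ =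
      (l.factorial : ℂ)⁻¹ * ((m.factorial : ℂ)⁻¹ *
        (dirDeriv (1, 0))^[l] ((dirDeriv (0, 1))^[m] H) (0, 0)) := by
    intro l m
    have e1 : (fibreOp B₁ l fun ζ => Complex.exp (ζ ⬝ᵥ x)) = fun lam =>
        (l.factorial : ℂ)⁻¹ * (dirDeriv 1)^[l] (fun s => Complex.exp (lam ⬝ᵥ V s)) 0 := by
      funext lam
      exact fibreOp_exp h₁ l x lam
    have hl : (l.factorial : ℂ) ≠ 0 := Nat.cast_ne_zero.2 (Nat.factorial_ne_zero _)
    have e2 : ∀ lam, AnalyticAt ℂ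
        (fun lam => (dirDeriv 1)^[l] (fun s => Complex.exp (lam ⬝ᵥ V s)) 0) lam := by
      intro lam
      have := (analyticAt_const (v := (l.factorial : ℂ))).mul
        (analyticAt_fibreOp h₁ (analyticAt_exp_dotProduct x _) l (lam := lam))
      rw [e1] at this
      refine this.congr (Eventually.of_forall fun lam => ?_)
      simp only [Pi.mul_apply]
      rw [mul_inv_cancel_left₀ hl]
    rw [e1, fibreOp_const_mul _ h₂ (e2 _)]
    congr 1
    set F : ℂ × (CSp n × CSp n) → ℂ := fun q =>
      Complex.exp ((q.2.2 + (B₂ q.2.1).transpose.mulVec μ) ⬝ᵥ V q.1) with hF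
    have hFa : AnalyticAt ℂ F (0, (0, 0)) := by
      refine (analyticAt_dotProduct ?_ (hVa.fun_comp_of_eq analyticAt_fst rfl)).cexp
      exact (analyticAt_fibreArg h₂ μ 0).fun_comp_of_eq (f := fun q : ℂ × (CSp n × CSp n) =>
        ((μ, q.2) : CSp n × (CSp n × CSp n))) (analyticAt_const.prod analyticAt_snd) rfl
    -- The s-derivatives commute with the outer operator, which then acts on a genuine exponential
    -- e^{⟨ζ, V(s)⟩}.
    have e3 : fibreOp B₂ m (fun lam => (dirDeriv 1)^[l] (fun s => Complex.exp (lam ⬝ᵥ V s)) 0) μ =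
        (dirDeriv 1)^[l] (fun s => fibreOp B₂ m (fun ζ => Complex.exp (ζ ⬝ᵥ V s)) μ) 0 := by
      simp only [fibreOp]
      rw [iterate_dirDeriv_sum _ _ fun α _ => analyticAt_mixedDeriv_slice α hFa]
      exact Finset.sum_congr rfl fun α _ => congrArg _
        (iterate_dirDeriv_mixedDeriv α hFa 1 l).symm
    have e4 : (fun s => fibreOp B₂ m (fun ζ => Complex.exp (ζ ⬝ᵥ V s)) μ) = fun s =>
        (m.factorial : ℂ)⁻¹ * (dirDeriv (0, 1))^[m] H (s, 0) := by
      funext s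
      rw [fibreOp_exp h₂]
      congr 1
      have := iterate_dirDeriv_comp_affine (fun t : ℂ => (s, t)) 1 (0, 1)
        (fun x t => by simp) H m
      exact congrFun this 0
    have hGa := hHa.iterate_dirDeriv (0, 1) m
    rw [e3, e4, iterate_dirDeriv_const_mul _ (hGa.fun_comp_of_eq
      (f := fun s : ℂ => (s, (0 : ℂ))) (analyticAt_id.prod analyticAt_const) rfl)]
    congr 1
    exact congrFun (iterate_dirDeriv_comp_affine (fun s : ℂ => (s, (0 : ℂ))) 1 (1, 0)
      (fun x t => by simp) ((dirDeriv (0, 1))^[m] H) l) 0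
  simp only [hterm]
  -- By the binomial theorem the sum over l + m = j is one derivative in the direction (1, 1), that
  -- is, along the diagonal s = t where the hypothesis applies.
  rw [sum_antidiagonal_dirDeriv hHa, fibreOp_exp h₃]
  congr 1
  have e5 := congrFun (iterate_dirDeriv_comp_affine (fun s : ℂ => (s, s)) 1 (1, 1)
      (fun x t => by simp) H j) 0
  simp only [Prod.mk_add_mk, add_zero, zero_add]
  rw [← e5]
  refine iterate_dirDeriv_congr ?_ 1 j
  -- The hypothesis concerns t ≠ 0 only, since it is obtained by dividing by t; continuity supplies
  -- t = 0.
  refine (ContinuousAt.eventuallyEq_nhds_iff_eventuallyEq_nhdsNE ?_ ?_).1 ?_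
  · exact (hHa.fun_comp_of_eq (f := fun s : ℂ => (s, s)) (analyticAt_id.prod analyticAt_id)
      rfl).continuousAt
  · exact ((analyticAt_dotProduct analyticAt_const (analyticAt_mulVec
      (fun i j => (h₃ i j).fun_comp_of_eq hsmul (zero_smul _ _)) analyticAt_const)).cexp).continuousAt
  · filter_upwards [h] with t ht
    simp only [hH, hV, ht]

theorem fibreOp_apply_eq_zero {B : CSp n → Matrix (Fin n) (Fin n) ℂ}
    (hB : ∀ i j, AnalyticAt ℂ (fun z => B z i j) 0) {p : CSp n → ℂ} {lam ζ : CSp n}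
    (hζ : (B 0).transpose.mulVec lam = ζ) (hp : AnalyticAt ℂ p ζ) {l : ℕ}
    (h : p =O[𝓝 ζ] fun ζ' => ‖ζ' - ζ‖ ^ (1 + 2 * l)) : fibreOp B l p lam = 0 :=
  (fibreOp_isBigO hB hζ hp h).eq_zero_of_norm_pow one_ne_zero

/-- The fibre operators compose as the coordinate transformations do. -/
theorem fibreOp_comp {B₁ B₂ B₃ : CSp n → Matrix (Fin n) (Fin n) ℂ}
    (h₁ : ∀ i j, AnalyticAt ℂ (fun z => B₁ z i j) 0)
    (h₂ : ∀ i j, AnalyticAt ℂ (fun z => B₂ z i j) 0)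
    (h₃ : ∀ i j, AnalyticAt ℂ (fun z => B₃ z i j) 0)
    (h : ∀ x : CSp n, ∀ᶠ t : ℂ in 𝓝[≠] 0,
      (B₂ (t • (B₁ (t • x)).mulVec x)).mulVec ((B₁ (t • x)).mulVec x) = (B₃ (t • x)).mulVec x)
    {μ lam ζ : CSp n} (hlam : (B₂ 0).transpose.mulVec μ = lam)
    (hζ : (B₁ 0).transpose.mulVec lam = ζ) (hζ' : (B₃ 0).transpose.mulVec μ = ζ)
    {p : CSp n → ℂ} (hp : AnalyticAt ℂ p ζ) (j : ℕ) :
    ∑ lm ∈ Finset.HasAntidiagonal.antidiagonal j, fibreOp B₂ lm.2 (fibreOp B₁ lm.1 p) μ =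
      fibreOp B₃ j p μ := by
  have han : ∀ (f : CSp n → ℂ) (l : ℕ), AnalyticAt ℂ f ζ → AnalyticAt ℂ (fibreOp B₁ l f) lam :=
    fun f l hf => analyticAt_fibreOp h₁ (by rwa [hζ]) l
  rw [← sub_eq_zero]
  refine functional_eq_zero (L := fun p => ∑ lm ∈ Finset.HasAntidiagonal.antidiagonal j,
    fibreOp B₂ lm.2 (fibreOp B₁ lm.1 p) μ - fibreOp B₃ j p μ) (1 + 2 * j) ?_ ?_ ?_ hp
  · intro κ s c f hf
    rw [fibreOp_sum s c h₃ (by rwa [hζ'])]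
    have e1 : ∀ lm : ℕ × ℕ, fibreOp B₂ lm.2 (fibreOp B₁ lm.1 fun y => ∑ k ∈ s, c k * f k y) μ =
        ∑ k ∈ s, c k * fibreOp B₂ lm.2 (fibreOp B₁ lm.1 (f k)) μ := by
      intro lm
      rw [← fibreOp_sum s c h₂ (by rw [hlam]; exact fun k hk => han _ _ (hf k hk))]
      -- The outer operator differentiates in λ, so linearity of the inner one is needed on a whole
      -- neighbourhood of `lam`.
      have e2 : (fibreOp B₁ lm.1 fun y => ∑ k ∈ s, c k * f k y) =ᶠ[𝓝 lam]
          fun lam => ∑ k ∈ s, c k * fibreOp B₁ lm.1 (f k) lam := by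
        have hc : Tendsto (fun lam => (B₁ 0).transpose.mulVec lam) (𝓝 lam) (𝓝 ζ) := by
          rw [← hζ]
          exact (by fun_prop : Continuous fun lam : CSp n =>
            (B₁ 0).transpose.mulVec lam).tendsto lam
        have h4 : ∀ᶠ y in 𝓝 ζ, ∀ k ∈ s, AnalyticAt ℂ (f k) y :=
          (Filter.eventually_all_finset s).2 fun k hk => (hf k hk).eventually_analyticAt
        filter_upwards [hc.eventually h4] with lam' hlam'
        exact fibreOp_sum s c h₁ hlam' _
      exact fibreOp_congr h₂ (by rwa [hlam]) _
    simp only [e1]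
    rw [Finset.sum_comm, ← Finset.sum_sub_distrib]
    exact Finset.sum_congr rfl fun k _ => by rw [← Finset.mul_sum, mul_sub]
  · intro f hf hO
    -- The order 1 + 2j suffices for every term: the inner operator uses up 2l, the outer 2m, and l
    -- + m = j.
    rw [fibreOp_apply_eq_zero h₃ hζ' hf hO, sub_zero]
    refine Finset.sum_eq_zero fun lm hlm => ?_
    rw [Finset.HasAntidiagonal.mem_antidiagonal] at hlm
    refine fibreOp_apply_eq_zero h₂ hlam (han _ _ hf) (fibreOp_isBigO h₁ hζ hf ?_)
    rwa [add_assoc, ← mul_add, add_comm lm.2, hlm]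
  · intro x
    rw [fibreOp_exp_comp h₁ h₂ h₃ x μ (h x), sub_self]

/-- The generating function is constant in t, so its derivatives of positive order vanish. -/
theorem fibreOp_exp_of_mulVec_self {B : CSp n → Matrix (Fin n) (Fin n) ℂ}
    (hB : ∀ i j, AnalyticAt ℂ (fun z => B z i j) 0) (x μ : CSp n)
    (h : ∀ᶠ t : ℂ in 𝓝[≠] 0, (B (t • x)).mulVec x = x) (j : ℕ) :
    fibreOp B j (fun ζ => Complex.exp (ζ ⬝ᵥ x)) μ = if j = 0 then Complex.exp (μ ⬝ᵥ x) else 0 := by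
  rw [fibreOp_exp hB]
  have e : (fun t : ℂ => Complex.exp (μ ⬝ᵥ (B (t • x)).mulVec x)) =ᶠ[𝓝 0]
      fun _ => Complex.exp (μ ⬝ᵥ x) := by
    refine (ContinuousAt.eventuallyEq_nhds_iff_eventuallyEq_nhdsNE ?_ continuousAt_const).1 ?_
    · exact ((analyticAt_dotProduct analyticAt_const (analyticAt_mulVec
        (fun i j => (hB i j).fun_comp_of_eq (f := fun t : ℂ => t • x)
          (analyticAt_id.smul analyticAt_const) (zero_smul _ _)) analyticAt_const)).cexp).continuousAt
    · filter_upwards [h] with t ht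
      rw [ht]
  rw [iterate_dirDeriv_congr e, dirDeriv_one, ← iteratedDeriv_eq_iterate, iteratedDeriv_const]
  split_ifs with hj
  · simp [hj]
  · simp

/-- The fibre operators of the identity transformation. -/
theorem fibreOp_of_mulVec_self {B : CSp n → Matrix (Fin n) (Fin n) ℂ}
    (hB : ∀ i j, AnalyticAt ℂ (fun z => B z i j) 0)
    (h : ∀ x : CSp n, ∀ᶠ t : ℂ in 𝓝[≠] 0, (B (t • x)).mulVec x = x)
    {μ : CSp n} (hμ : (B 0).transpose.mulVec μ = μ) {p : CSp n → ℂ} (hp : AnalyticAt ℂ p μ)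
    (j : ℕ) : fibreOp B j p μ = if j = 0 then p μ else 0 := by
  rw [← sub_eq_zero]
  refine functional_eq_zero (L := fun p => fibreOp B j p μ - if j = 0 then p μ else 0)
    (1 + 2 * j) ?_ ?_ ?_ hp
  · intro κ s c f hf
    rw [fibreOp_sum s c hB (by rwa [hμ])]
    split_ifs
    · rw [← Finset.sum_sub_distrib]
      exact Finset.sum_congr rfl fun k _ => by rw [mul_sub]
    · simp
  · intro f hf hO
    rw [fibreOp_apply_eq_zero hB hμ hf hO, hO.eq_zero_of_norm_pow (by omega), ite_self, sub_zero]
  · intro x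
    rw [fibreOp_exp_of_mulVec_self hB x μ (h x), sub_self]

end Composition

/-! ### The matrices `J*` and the Jacobian -/

section JStar

variable {n : ℕ}

/-- The linear map `(z', z) ↦ s z' + (1 - s) z`. -/
noncomputable def segmentMap (E : Type*) [NormedAddCommGroup E] [NormedSpace ℂ E] (s : ℝ) :
    E × E →L[ℂ] E :=
  ((1 - s : ℝ) : ℂ) • ContinuousLinearMap.snd ℂ E E + (s : ℂ) • ContinuousLinearMap.fst ℂ E E

theorem norm_segmentMap_apply_le {E : Type*} [NormedAddCommGroup E] [NormedSpace ℂ E] {s : ℝ}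
    (hs : s ∈ Icc (0 : ℝ) 1) (q : E × E) : ‖segmentMap E s q‖ ≤ ‖q‖ := by
  have h1 : ‖segmentMap E s q‖ ≤ (1 - s) * ‖q.2‖ + s * ‖q.1‖ := by
    have e : segmentMap E s q = ((1 - s : ℝ) : ℂ) • q.2 + (s : ℂ) • q.1 := rfl
    rw [e]
    refine (norm_add_le _ _).trans (le_of_eq ?_)
    rw [norm_smul, norm_smul, Complex.norm_real, Complex.norm_real, Real.norm_eq_abs,
      Real.norm_eq_abs, abs_of_nonneg hs.1, abs_of_nonneg (sub_nonneg.2 hs.2)]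
  have h2 : (1 - s) * ‖q.2‖ ≤ (1 - s) * ‖q‖ :=
    mul_le_mul_of_nonneg_left (norm_snd_le q) (sub_nonneg.2 hs.2)
  have h3 : s * ‖q.1‖ ≤ s * ‖q‖ := mul_le_mul_of_nonneg_left (norm_fst_le q) hs.1
  linarith

theorem continuous_segmentMap (E : Type*) [NormedAddCommGroup E] [NormedSpace ℂ E] :
    Continuous (segmentMap E) := by
  unfold segmentMap
  fun_prop

/-- The mean of an analytic function along the segments near a point is analytic in the
end points. -/
theorem analyticAt_integral_segment {E : Type*} [NormedAddCommGroup E] [NormedSpace ℂ E]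
    {g : E → ℂ} {z₀ : E} (hg : AnalyticAt ℂ g z₀) :
    AnalyticAt ℂ (fun p : E × E => ∫ s in (0 : ℝ)..1, g (p.2 + (s : ℂ) • (p.1 - p.2))) (z₀, z₀) := by
  obtain ⟨a, r, ha⟩ := hg
  obtain ⟨r', hr'0, hr'⟩ := ENNReal.lt_iff_exists_nnreal_btwn.1 ha.r_pos
  have hr'0 : 0 < r' := by exact_mod_cast hr'0
  -- The power series of g at z₀, pulled back by (z', z) ↦ sz' + (1 - s)z. This map has norm at most
  -- 1 for the maximum norm, so averaging over s does not enlarge the coefficients and keeps the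
  -- convergence.
  set c : (m : ℕ) → ℝ → ContinuousMultilinearMap ℂ (fun _ : Fin m => E × E) ℂ :=
    fun m s => a.compContinuousLinearMap (segmentMap E s) m with hc
  have hcc : ∀ m, Continuous (c m) := by
    intro m
    have h1 := (ContinuousMultilinearMap.compContinuousLinearMapContinuousMultilinear ℂ
      (fun _ : Fin m => E × E) (fun _ : Fin m => E) ℂ).cont
    have h2 : Continuous fun s : ℝ => fun _ : Fin m => segmentMap E s :=
      continuous_pi fun _ => continuous_segmentMap E
    exact ((ContinuousLinearMap.apply ℂ _ (a m)).continuous).comp (h1.comp h2)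
  have hcn : ∀ m, ∀ s ∈ Icc (0 : ℝ) 1, ‖c m s‖ ≤ ‖a m‖ := by
    intro m s hs
    refine ContinuousMultilinearMap.opNorm_le_bound (norm_nonneg _) fun q => ?_
    refine ((a m).le_opNorm _).trans ?_
    gcongr with i _
    exact norm_segmentMap_apply_le hs _
  set b : FormalMultilinearSeries ℂ (E × E) ℂ := fun m => ∫ s in (0 : ℝ)..1, c m s with hb
  have hbn : ∀ m, ‖b m‖ ≤ ‖a m‖ := by
    intro m
    have := intervalIntegral.norm_integral_le_of_norm_le_const (a := (0 : ℝ)) (b := 1)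
      (f := c m) (C := ‖a m‖) fun s hs => hcn m s (by
        rw [uIoc_of_le zero_le_one] at hs; exact ⟨hs.1.le, hs.2⟩)
    simpa using this
  have hrad : (r' : ENNReal) < a.radius := hr'.trans_le ha.r_le
  refine ⟨b, r', ?_, by exact_mod_cast hr'0, ?_⟩
  · obtain ⟨C, -, hC⟩ := a.norm_mul_pow_le_of_lt_radius hrad
    exact b.le_radius_of_bound C fun m =>
      (mul_le_mul_of_nonneg_right (hbn m) (by positivity)).trans (hC m)
  · intro q hq
    have hq' : ‖q‖ < r' := by simpa [Metric.mem_eball, edist_zero_right, enorm] using hq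
    have hsum : Summable fun m => ‖a m‖ * ‖q‖ ^ m :=
      .of_nonneg_of_le (fun _ => by positivity)
        (fun m => mul_le_mul_of_nonneg_left (pow_le_pow_left₀ (norm_nonneg _) hq'.le m)
          (norm_nonneg _)) (a.summable_norm_mul_pow hrad)
    have e1 : ∀ m, b m (fun _ => q) = ∫ s in (0 : ℝ)..1, c m s fun _ => q := by
      intro m
      exact ((ContinuousMultilinearMap.apply ℂ (fun _ : Fin m => E × E) ℂ
        fun _ => q).intervalIntegral_comp_comm ((hcc m).intervalIntegrable 0 1)).symm
    simp only [e1]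
    refine intervalIntegral.hasSum_integral_of_dominated_convergence
      (fun m _ => ‖a m‖ * ‖q‖ ^ m) (fun m => ?_) (fun m => ?_) ?_ ?_ ?_
    · exact (((ContinuousMultilinearMap.apply ℂ (fun _ : Fin m => E × E) ℂ
        fun _ => q).continuous.comp (hcc m))).aestronglyMeasurable
    · refine Eventually.of_forall fun s hs => ?_
      rw [uIoc_of_le zero_le_one] at hs
      refine ((c m s).le_opNorm _).trans ?_
      simp only [Finset.prod_const, Finset.card_univ, Fintype.card_fin]
      exact mul_le_mul_of_nonneg_right (hcn m s ⟨hs.1.le, hs.2⟩) (by positivity)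
    · exact Eventually.of_forall fun s _ => hsum
    · exact intervalIntegrable_const
    · refine Eventually.of_forall fun s hs => ?_
      rw [uIoc_of_le zero_le_one] at hs
      have hn := norm_segmentMap_apply_le ⟨hs.1.le, hs.2⟩ q
      have h3 : segmentMap E s q ∈ Metric.eball (0 : E) r := by
        refine Metric.eball_subset_eball hr'.le ?_
        simpa [Metric.mem_eball, edist_zero_right, enorm] using
          (show ‖segmentMap E s q‖ < r' from hn.trans_lt hq')
      have h4 := ha.hasSum h3
      have e2 : z₀ + segmentMap E s q = ((z₀, z₀) + q).2 +
          (s : ℂ) • (((z₀, z₀) + q).1 - ((z₀, z₀) + q).2) := by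
        simp only [segmentMap, Prod.snd_add, Prod.fst_add]
        change z₀ + (((1 - s : ℝ) : ℂ) • q.2 + (s : ℂ) • q.1) = _
        push_cast
        module
      rwa [e2] at h4

/-- A matrix `J*_Φ` given by the means of the Jacobian along segments. -/
noncomputable def meanJacobian (f : CSp n → CSp n) (z' z : CSp n) : Matrix (Fin n) (Fin n) ℂ :=
  Matrix.of fun i j => ∫ s in (0 : ℝ)..1, jacobianMat f (z + (s : ℂ) • (z' - z)) i j

theorem analyticAt_jacobianMat {f : CSp n → CSp n} {z : CSp n} (hf : AnalyticAt ℂ f z)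
    (i j : Fin n) : AnalyticAt ℂ (fun z => jacobianMat f z i j) z := by
  have h1 : AnalyticAt ℂ (fun z => fderiv ℂ f z (Pi.single j 1)) z :=
    ((ContinuousLinearMap.apply ℂ (CSp n) (Pi.single j 1 : CSp n)).analyticAt _).fun_comp hf.fderiv
  exact analyticAt_pi_iff.1 h1 i

theorem jacobianMat_mulVec {f : CSp n → CSp n} {z v : CSp n} :
    (jacobianMat f z).mulVec v = fderiv ℂ f z v := by
  have h1 : v = ∑ i, v i • (Pi.single i 1 : CSp n) := by
    funext j
    simp [Finset.sum_apply, Pi.single_apply]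
  conv_rhs => rw [h1]
  funext i
  simp only [map_sum, map_smul, Matrix.mulVec, dotProduct, jacobianMat, Matrix.of_apply,
    Finset.sum_apply, Pi.smul_apply, smul_eq_mul]
  exact Finset.sum_congr rfl fun j _ => mul_comm _ _

/-- The fundamental theorem of calculus along the segment from z to z', which stays in a ball inside
the target. -/
theorem isJStar_meanJacobian {Φ : OpenPartialHomeomorph (CSp n) (CSp n)}
    (h : AnalyticOnNhd ℂ Φ.symm Φ.target) : IsJStar Φ (meanJacobian Φ.symm) := by
  intro z hz
  refine ⟨fun i j => analyticAt_integral_segment (analyticAt_jacobianMat (h z hz) i j), ?_⟩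
  obtain ⟨r, hr, hb⟩ := Metric.isOpen_iff.1 Φ.open_target z hz
  have hev : ∀ᶠ p : CSp n × CSp n in 𝓝 (z, z), p.1 ∈ Metric.ball z r ∧ p.2 ∈ Metric.ball z r :=
    (continuous_fst.tendsto (z, z)).eventually (Metric.ball_mem_nhds z hr) |>.and
      ((continuous_snd.tendsto (z, z)).eventually (Metric.ball_mem_nhds z hr))
  filter_upwards [hev] with p hp
  set γ : ℝ → CSp n := fun s => p.2 + (s : ℂ) • (p.1 - p.2) with hγ
  have hγm : ∀ s ∈ Icc (0 : ℝ) 1, AnalyticAt ℂ Φ.symm (γ s) := by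
    intro s hs
    refine h _ (hb ?_)
    have := (convex_ball z r).add_smul_sub_mem hp.2 hp.1 hs
    simpa [hγ] using this
  have hγc : Continuous γ := by fun_prop
  have hint : ∀ i j, IntervalIntegrable (fun s : ℝ => jacobianMat Φ.symm (γ s) i j)
      MeasureTheory.volume 0 1 := by
    intro i j
    refine ContinuousOn.intervalIntegrable fun s hs => ?_
    rw [uIcc_of_le zero_le_one] at hs
    exact ((analyticAt_jacobianMat (hγm s hs) i j).continuousAt.comp
      hγc.continuousAt).continuousWithinAt
  funext i
  have hder : ∀ s ∈ uIcc (0 : ℝ) 1, HasDerivAt (fun s : ℝ => Φ.symm (γ s) i)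
      (∑ j, jacobianMat Φ.symm (γ s) i j * (p.1 - p.2) j) s := by
    intro s hs
    rw [uIcc_of_le zero_le_one] at hs
    have h1 : HasDerivAt (fun t : ℂ => p.2 + t • (p.1 - p.2)) (p.1 - p.2) (s : ℂ) := by
      simpa using ((hasDerivAt_id (s : ℂ)).smul_const (p.1 - p.2)).const_add p.2
    have h2 := HasFDerivAt.comp_hasDerivAt (s : ℂ) (f := fun t : ℂ => p.2 + t • (p.1 - p.2))
      (hγm s hs).differentiableAt.hasFDerivAt h1
    rw [← jacobianMat_mulVec] at h2
    exact ((hasDerivAt_pi.1 h2) i).comp_ofReal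
  have hF := intervalIntegral.integral_eq_sub_of_hasDerivAt hder
    ((IntervalIntegrable.sum Finset.univ fun j _ => (hint i j).mul_const ((p.1 - p.2) j)).congr
      (fun s _ => by simp))
  rw [intervalIntegral.integral_finsetSum fun j _ => (hint i j).mul_const _] at hF
  simp only [intervalIntegral.integral_mul_const] at hF
  simp only [Pi.sub_apply, Matrix.mulVec, dotProduct, meanJacobian, Matrix.of_apply]
  simp only [hγ, Complex.ofReal_one, one_smul, add_sub_cancel, Complex.ofReal_zero, zero_smul,
    add_zero, Pi.sub_apply] at hF
  exact hF.symm

theorem IsJStar.analyticAt_shift {Φ : OpenPartialHomeomorph (CSp n) (CSp n)}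
    {J : CSp n → CSp n → Matrix (Fin n) (Fin n) ℂ} (hJ : IsJStar Φ J) {z : CSp n}
    (hz : z ∈ Φ.target) (i j : Fin n) : AnalyticAt ℂ (fun z' => J (z + z') z i j) 0 :=
  ((hJ z hz).1 i j).fun_comp_of_eq (f := fun z' => (z + z', z))
    ((analyticAt_const.add analyticAt_id).prod analyticAt_const) (by simp)

theorem IsJStar.eventually_shift {Φ : OpenPartialHomeomorph (CSp n) (CSp n)}
    {J : CSp n → CSp n → Matrix (Fin n) (Fin n) ℂ} (hJ : IsJStar Φ J) {z : CSp n}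
    (hz : z ∈ Φ.target) :
    ∀ᶠ z' in 𝓝 (0 : CSp n), Φ.symm (z + z') - Φ.symm z = (J (z + z') z).mulVec z' := by
  have hc : Tendsto (fun z' : CSp n => (z + z', z)) (𝓝 0) (𝓝 (z, z)) := by
    have : Continuous fun z' : CSp n => (z + z', z) := by fun_prop
    simpa using this.tendsto 0
  filter_upwards [hc.eventually (hJ z hz).2] with z' h
  simpa using h

/-- On the diagonal J* is forced: both sides of its defining relation are differentiated at t = 0
along z' = z + te. -/
theorem IsJStar.eq_jacobianMat {Φ : OpenPartialHomeomorph (CSp n) (CSp n)}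
    {J : CSp n → CSp n → Matrix (Fin n) (Fin n) ℂ} (hJ : IsJStar Φ J) {z : CSp n}
    (hz : z ∈ Φ.target) (h : DifferentiableAt ℂ Φ.symm z) : J z z = jacobianMat Φ.symm z := by
  refine Matrix.ext_of_mulVec_single fun j => ?_
  rw [jacobianMat_mulVec]
  set e : CSp n := Pi.single j 1 with he
  have hJa : AnalyticAt ℂ (fun t : ℂ => (J (z + t • e) z).mulVec e) 0 :=
    analyticAt_mulVec (fun i k => (hJ.analyticAt_shift hz i k).fun_comp_of_eq
      (f := fun t : ℂ => t • e) (analyticAt_id.smul analyticAt_const) (zero_smul _ _))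
      analyticAt_const
  have h1 : HasDerivAt (fun t : ℂ => t • (J (z + t • e) z).mulVec e) ((J z z).mulVec e) 0 := by
    have := (hasDerivAt_id' (0 : ℂ)).fun_smul hJa.differentiableAt.hasDerivAt
    simpa using this
  have h2 : HasDerivAt (fun t : ℂ => Φ.symm (z + t • e)) (fderiv ℂ Φ.symm z e) 0 := by
    have h3 : HasDerivAt (fun t : ℂ => z + t • e) e 0 := by
      simpa using ((hasDerivAt_id (0 : ℂ)).smul_const e).const_add z
    have h4 : HasFDerivAt Φ.symm (fderiv ℂ Φ.symm z) (z + (0 : ℂ) • e) := by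
      simpa using h.hasFDerivAt
    exact h4.comp_hasDerivAt (0 : ℂ) h3
  have hc : Tendsto (fun t : ℂ => t • e) (𝓝 0) (𝓝 0) := by
    have : Continuous fun t : ℂ => t • e := by fun_prop
    simpa using this.tendsto 0
  have h5 : (fun t : ℂ => Φ.symm (z + t • e) - Φ.symm z) =ᶠ[𝓝 0]
      fun t : ℂ => t • (J (z + t • e) z).mulVec e := by
    filter_upwards [hc.eventually (hJ.eventually_shift hz)] with t ht
    rw [ht, Matrix.mulVec_smul]
  exact (h1.congr_of_eventuallyEq h5).unique (h2.sub_const _)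

theorem jacobianMat_comp {f g : CSp n → CSp n} {z : CSp n} (hf : DifferentiableAt ℂ f (g z))
    (hg : DifferentiableAt ℂ g z) :
    jacobianMat (f ∘ g) z = jacobianMat f (g z) * jacobianMat g z := by
  refine Matrix.ext_of_mulVec_single fun j => ?_
  rw [← Matrix.mulVec_mulVec, jacobianMat_mulVec, jacobianMat_mulVec, jacobianMat_mulVec,
    fderiv_comp z hf hg]
  rfl

theorem jacobianMat_congr {f g : CSp n → CSp n} {z : CSp n} (h : f =ᶠ[𝓝 z] g) :
    jacobianMat f z = jacobianMat g z := by
  simp only [jacobianMat, h.fderiv_eq]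

theorem jacobianMat_id (z : CSp n) : jacobianMat (fun z : CSp n => z) z = 1 := by
  refine Matrix.ext_of_mulVec_single fun j => ?_
  rw [jacobianMat_mulVec, Matrix.one_mulVec, fderiv_fun_id]
  rfl

theorem jacobianMat_symm_mul {Φ : OpenPartialHomeomorph (CSp n) (CSp n)}
    (h : AnalyticOnNhd ℂ Φ Φ.source) (h' : AnalyticOnNhd ℂ Φ.symm Φ.target) {w : CSp n}
    (hw : w ∈ Φ.source) : jacobianMat Φ.symm (Φ w) * jacobianMat Φ w = 1 := by
  rw [← jacobianMat_comp (h' _ (Φ.map_source hw)).differentiableAt (h w hw).differentiableAt,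
    ← jacobianMat_id w]
  refine jacobianMat_congr ?_
  filter_upwards [Φ.open_source.mem_nhds hw] with y hy
  exact Φ.left_inv hy

end JStar

/-! ### Conic sets in changed coordinates -/

section Geometry

variable {n : ℕ}

/-- The sum of the absolute values of the entries of a matrix. -/
noncomputable def entrySum (M : Matrix (Fin n) (Fin n) ℂ) : ℝ := ∑ i, ∑ j, ‖M i j‖

theorem entrySum_nonneg (M : Matrix (Fin n) (Fin n) ℂ) : 0 ≤ entrySum M :=
  Finset.sum_nonneg fun _ _ => Finset.sum_nonneg fun _ _ => norm_nonneg _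

theorem norm_transpose_mulVec_le (M : Matrix (Fin n) (Fin n) ℂ) (v : CSp n) :
    ‖M.transpose.mulVec v‖ ≤ entrySum M * ‖v‖ := by
  refine (pi_norm_le_iff_of_nonneg (mul_nonneg (entrySum_nonneg M) (norm_nonneg v))).2 fun j => ?_
  rw [entrySum, Finset.sum_comm]
  calc ‖M.transpose.mulVec v j‖ ≤ ∑ i, ‖M i j‖ * ‖v‖ := by
        have e : M.transpose.mulVec v j = ∑ i, M.transpose j i * v i := rfl
        rw [e]
        refine (norm_sum_le _ _).trans (Finset.sum_le_sum fun i _ => ?_)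
        rw [Matrix.transpose_apply, norm_mul]
        exact mul_le_mul_of_nonneg_left (norm_le_pi_norm v i) (norm_nonneg _)
    _ = (∑ i, ‖M i j‖) * ‖v‖ := by rw [Finset.sum_mul]
    _ ≤ _ := by
        refine mul_le_mul_of_nonneg_right ?_ (norm_nonneg v)
        exact Finset.single_le_sum (f := fun j => ∑ i, ‖M i j‖)
          (fun _ _ => Finset.sum_nonneg fun _ _ => norm_nonneg _) (Finset.mem_univ j)

theorem continuousAt_entrySum {X : Type*} [TopologicalSpace X] {f : X → Matrix (Fin n) (Fin n) ℂ}
    {x : X} (hf : ∀ i j, ContinuousAt (fun x => f x i j) x) :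
    ContinuousAt (fun x => entrySum (f x)) x :=
  tendsto_finsetSum _ fun i _ => tendsto_finsetSum _ fun j _ => (hf i j).norm

/-- A local property of triples near the diagonal of a compact set holds uniformly. -/
theorem IsCompact.exists_ball_of_eventually {X : Type*} [PseudoMetricSpace X] {K : Set X}
    (hK : IsCompact K) {Q : X × X × X → Prop} (hQ : ∀ a ∈ K, ∀ᶠ q in 𝓝 (a, a, a), Q q) :
    ∃ δ > 0, ∀ a ∈ K, ∀ x ∈ Metric.ball a δ, ∀ y ∈ Metric.ball a δ, Q (a, x, y) := by
  have h : ∀ a : K, ∃ r > 0, ∀ q ∈ Metric.ball ((a : X), (a : X), (a : X)) r, Q q := fun a =>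
    Metric.eventually_nhds_iff_ball.1 (hQ a a.2)
  choose r hr hrQ using h
  -- For a Lebesgue number δ, the δ-ball about a lies in one ball about some b of K, so all three
  -- points are near the same b.
  obtain ⟨δ, hδ, hball⟩ := lebesgue_number_lemma_of_metric hK
    (c := fun a : K => Metric.ball (a : X) (r a)) (fun _ => Metric.isOpen_ball)
    (fun a ha => mem_iUnion.2 ⟨⟨a, ha⟩, Metric.mem_ball_self (hr _)⟩)
  refine ⟨δ, hδ, fun a ha x hx y hy => ?_⟩
  obtain ⟨b, hb⟩ := hball a ha
  refine hrQ b _ ?_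
  rw [← ball_prod_same, ← ball_prod_same]
  exact ⟨hb (Metric.mem_ball_self hδ), hb hx, hb hy⟩

theorem mem_enlarge_of_near {Ω : Set (Cotan n)} {ρ : ℝ} {p q : Cotan n} (hp : p ∈ Ω)
    (h1 : ‖q.1 - p.1‖ ≤ ρ) (h2 : ‖q.2 - p.2‖ ≤ ρ * ‖p.2‖) : q ∈ enlarge Ω ρ :=
  subset_closure ⟨p, hp, q.1 - p.1, q.2 - p.2, h1, h2, by simp⟩

/-- The closure in `enlarge` is absorbed by increasing ρ. The fibre tolerance is relative to ‖p.2‖,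
hence the need for ‖q.2‖ > 0, which bounds ‖p.2‖ from below. -/
theorem exists_near_of_mem_enlarge {Ω : Set (Cotan n)} {ρ ρ' : ℝ} (hρ0 : 0 < ρ) (hρ : ρ < ρ')
    {q : Cotan n} (hq : q ∈ enlarge Ω ρ) (hq0 : 0 < ‖q.2‖) :
    ∃ p ∈ Ω, ‖q.1 - p.1‖ ≤ ρ' ∧ ‖q.2 - p.2‖ ≤ ρ' * ‖p.2‖ := by
  have hδ : 0 < min (ρ' - ρ) (min (‖q.2‖ / 2) ((ρ' - ρ) * (‖q.2‖ / 2 / (1 + ρ)))) := by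
    have : 0 < ρ' - ρ := sub_pos.2 hρ
    positivity
  obtain ⟨q', ⟨p, hp, z', ζ', hz, hζ, rfl⟩, hd⟩ := Metric.mem_closure_iff.1 hq _ hδ
  rw [dist_eq_norm, lt_min_iff, lt_min_iff] at hd
  obtain ⟨hd1, hd2, hd3⟩ := hd
  have e1 : ‖q.1 - (p.1 + z')‖ ≤ ‖q - (p.1 + z', p.2 + ζ')‖ := norm_fst_le (q - (p.1 + z', p.2 + ζ'))
  have e2 : ‖q.2 - (p.2 + ζ')‖ ≤ ‖q - (p.1 + z', p.2 + ζ')‖ := norm_snd_le (q - (p.1 + z', p.2 + ζ'))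
  have e3 : ‖q.2‖ ≤ ‖q.2 - (p.2 + ζ')‖ + (‖p.2‖ + ‖ζ'‖) := by
    calc ‖q.2‖ = ‖(q.2 - (p.2 + ζ')) + (p.2 + ζ')‖ := by congr 1; abel
      _ ≤ _ := (norm_add_le _ _).trans (by gcongr; exact norm_add_le _ _)
  have e4 : ‖q.2‖ / 2 / (1 + ρ) ≤ ‖p.2‖ := by
    rw [div_le_iff₀ (by positivity)]
    nlinarith
  refine ⟨p, hp, ?_, ?_⟩
  · calc ‖q.1 - p.1‖ = ‖(q.1 - (p.1 + z')) + z'‖ := by congr 1; abel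
      _ ≤ _ := (norm_add_le _ _).trans (by linarith)
  · calc ‖q.2 - p.2‖ = ‖(q.2 - (p.2 + ζ')) + ζ'‖ := by congr 1; abel
      _ ≤ ‖q.2 - (p.2 + ζ')‖ + ‖ζ'‖ := norm_add_le _ _
      _ ≤ (ρ' - ρ) * ‖p.2‖ + ρ * ‖p.2‖ := by
        have := mul_le_mul_of_nonneg_left e4 (sub_pos.2 hρ).le
        linarith
      _ = _ := by ring

theorem isCompact_closure_base {Ω : Set (Cotan n)} (h : ConicRelCompact Ω) :
    IsCompact (closure (Prod.fst '' Ω)) := by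
  obtain ⟨K, hK, hΩ⟩ := h
  have hK' := hK.image continuous_fst
  refine hK'.of_isClosed_subset isClosed_closure (closure_minimal ?_ hK'.isClosed)
  rintro _ ⟨p, hp, rfl⟩
  obtain ⟨q, hq, t, -, rfl⟩ := hΩ p hp
  exact ⟨q, hq, rfl⟩

theorem exists_entrySum_bound {X : Type*} [TopologicalSpace X] {K : Set X} (hK : IsCompact K)
    {f : X → Matrix (Fin n) (Fin n) ℂ} (hf : ∀ x ∈ K, ∀ i j, ContinuousAt (fun x => f x i j) x) :
    ∃ M : ℝ, 1 ≤ M ∧ ∀ x ∈ K, entrySum (f x) ≤ M := by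
  obtain ⟨M, hM⟩ := hK.exists_bound_of_continuousOn (f := fun x => entrySum (f x)) fun x hx =>
    (continuousAt_entrySum (hf x hx)).continuousWithinAt
  exact ⟨max M 1, le_max_right _ _, fun x hx =>
    ((le_abs_self _).trans (hM x hx)).trans (le_max_left _ _)⟩

/-- In changed coordinates, a whole polydisc of points `(Φ(w), ζ' + ᵗJ*_Φ(Φ(w) + z', Φ(w)) λ)`
belongs to the original domain. -/
theorem exists_polydisc_in_symDom {Ω : Set (Cotan n)} (hcomp : ConicRelCompact Ω)
    {Φ : OpenPartialHomeomorph (CSp n) (CSp n)} (hΦ : IsCoordChange Φ Ω)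
    {J : CSp n → CSp n → Matrix (Fin n) (Fin n) ℂ} (hJ : IsJStar Φ J) {d ρ : ℝ} (hd : 0 < d)
    (hρ : ρ ∈ Ioo (0 : ℝ) 1) :
    ∃ d' > 0, ∃ ρ' ∈ Ioo (0 : ℝ) 1, ∃ ε > 0, ∃ c > 0, ∃ c' > 0, ∀ Z : Set ℂ,
      ∀ x ∈ symDom (inCoord Φ Ω) d' ρ' Z, x.1 ∈ Φ.source ∧ 0 < ‖x.2.1‖ ∧
        ∀ z' ζ' : CSp n, ‖z'‖ ≤ ε → ‖ζ'‖ ≤ ε * ‖x.2.1‖ →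
          (∀ i j, AnalyticAt ℂ (fun z' => J (Φ x.1 + z') (Φ x.1) i j) z') ∧
          (Φ x.1, ζ' + (J (Φ x.1 + z') (Φ x.1)).transpose.mulVec x.2.1, x.2.2) ∈ symDom Ω d ρ Z ∧
          c * ‖x.2.1‖ ≤ ‖ζ' + (J (Φ x.1 + z') (Φ x.1)).transpose.mulVec x.2.1‖ ∧
          ‖ζ' + (J (Φ x.1 + z') (Φ x.1)).transpose.mulVec x.2.1‖ ≤ c' * ‖x.2.1‖ := by
  obtain ⟨hρ0, hρ1⟩ := hρ
  set K := closure (Prod.fst '' Ω)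
  have hK : IsCompact K := isCompact_closure_base hcomp
  set L := Φ.symm '' K
  have hL : IsCompact L := hK.image_of_continuousOn (Φ.continuousOn_symm.mono hΦ.closure_subset)
  have hLs : L ⊆ Φ.source := by
    rintro _ ⟨z, hz, rfl⟩
    exact Φ.map_target (hΦ.closure_subset hz)
  have hJd : ∀ z ∈ Φ.target, ∀ i j, ContinuousAt (fun z => J z z i j) z := fun z hz i j =>
    ((hJ z hz).1 i j).continuousAt.comp_of_eq (f := fun z => (z, z)) (by fun_prop) rfl
  obtain ⟨M, hM1, hM⟩ := exists_entrySum_bound hK (f := fun z => J z z) fun z hz =>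
    hJd z (hΦ.closure_subset hz)
  obtain ⟨M', hM'1, hM'⟩ := exists_entrySum_bound hL (f := jacobianMat Φ) fun w hw i j =>
    (analyticAt_jacobianMat (hΦ.holo w (hLs hw)) i j).continuousAt
  -- The deviation of ζ' + ᵗJ*λ from the covector ζ₀ of a point of Ω will be split into three parts,
  -- each at most (ρ/3)‖ζ₀‖. Since ‖λ‖ ≤ 2‖λ₀‖ ≤ 2M'‖ζ₀‖, a factor τ in front of ‖λ‖ suffices for
  -- two of them.
  set τ := ρ / (6 * M') with hτ
  have hτ0 : 0 < τ := by positivity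
  obtain ⟨δ₁, hδ₁, h₁⟩ := hK.exists_ball_of_eventually
    (Q := fun q => (∀ i j, AnalyticAt ℂ (fun p : CSp n × CSp n => J p.1 p.2 i j) (q.2.2, q.2.1)) ∧
      entrySum (J q.2.2 q.2.1 - J q.1 q.1) ≤ τ) (by
    intro a ha
    have ha' := hΦ.closure_subset ha
    have hc : Tendsto (fun q : CSp n × CSp n × CSp n => (q.2.2, q.2.1)) (𝓝 (a, a, a))
        (𝓝 (a, a)) := (by fun_prop : Continuous fun q : CSp n × CSp n × CSp n =>
          (q.2.2, q.2.1)).tendsto (a, a, a)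
    refine (hc.eventually (eventually_all.2 fun i => eventually_all.2 fun j =>
      ((hJ a ha').1 i j).eventually_analyticAt)).and ?_
    have hcont : ContinuousAt (fun q : CSp n × CSp n × CSp n =>
        entrySum (J q.2.2 q.2.1 - J q.1 q.1)) (a, a, a) :=
      continuousAt_entrySum fun i j => (((hJ a ha').1 i j).continuousAt.comp_of_eq
        (f := fun q : CSp n × CSp n × CSp n => (q.2.2, q.2.1)) (by fun_prop) rfl).sub
        ((hJd a ha' i j).comp_of_eq (f := fun q : CSp n × CSp n × CSp n => q.1) (by fun_prop) rfl)
    refine hcont.eventually_le_const ?_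
    simpa [entrySum] using hτ0)
  obtain ⟨δ₂, hδ₂, h₂⟩ := hL.exists_ball_of_eventually
    (Q := fun q => q.2.1 ∈ Φ.source ∧ ‖Φ q.2.1 - Φ q.1‖ ≤ min (δ₁ / 3) ρ) (by
    intro a ha
    have ha' := hLs ha
    have hc : Tendsto (fun q : CSp n × CSp n × CSp n => q.2.1) (𝓝 (a, a, a))
        (𝓝 a) := (by fun_prop : Continuous fun q : CSp n × CSp n × CSp n => q.2.1).tendsto (a, a, a)
    refine (hc.eventually (Φ.open_source.mem_nhds ha')).and ?_
    have hΦc : ContinuousAt Φ a := Φ.continuousAt ha'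
    have hcont : ContinuousAt (fun q : CSp n × CSp n × CSp n => ‖Φ q.2.1 - Φ q.1‖) (a, a, a) :=
      ((hΦc.comp_of_eq (f := fun q : CSp n × CSp n × CSp n => q.2.1) (by fun_prop) rfl).sub
        (hΦc.comp_of_eq (f := fun q : CSp n × CSp n × CSp n => q.1) (by fun_prop) rfl)).norm
    refine hcont.eventually_le_const ?_
    simp only [sub_self, norm_zero]
    positivity)
  -- The closure costs a factor 2: points lie within 2ρ' of Ω^Φ. The bound δ₂/4 controls the base
  -- point, 1/4 makes ‖λ‖ and ‖λ₀‖ comparable up to 2, and the last bound serves the third part of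
  -- the deviation.
  set ρ' := min (δ₂ / 4) (min (1 / 4) (ρ / (6 * (M * M')))) with hρ'
  have hρ'0 : 0 < ρ' := by positivity
  have hρ'1 : ρ' ≤ δ₂ / 4 := min_le_left _ _
  have hρ'2 : ρ' ≤ 1 / 4 := (min_le_right _ _).trans (min_le_left _ _)
  have hρ'3 : ρ' * (6 * (M * M')) ≤ ρ := by
    rw [← le_div_iff₀ (by positivity)]
    exact (min_le_right _ _).trans (min_le_right _ _)
  set ε := min (δ₁ / 3) τ with hε
  have hε0 : 0 < ε := by positivity
  set c := (1 - ρ) / (2 * M') with hc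
  have hc0 : 0 < c := div_pos (sub_pos.2 hρ1) (by positivity)
  have hρ'4 : 0 < 1 - ρ' := by linarith
  -- This choice gives d'(1 - ρ') = d/c, so that c‖λ‖ ≥ d. The upper constant 4M comes from ‖ξ‖ ≤
  -- 2‖ζ₀‖ ≤ 2M‖λ₀‖ ≤ 4M‖λ‖.
  refine ⟨d / (c * (1 - ρ')), by positivity, ρ', ⟨hρ'0, by linarith⟩, ε, hε0, c, hc0, 4 * M,
    by positivity, fun Z x hx => ?_⟩
  obtain ⟨hx1, hx2, hx3⟩ := hx
  have hdx : d ≤ c * ‖x.2.1‖ := by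
    have e : d / (c * (1 - ρ')) * (1 - ρ') = d / c := by field_simp
    rw [e, div_le_iff₀ hc0] at hx2
    linarith
  have hx0 : 0 < ‖x.2.1‖ := by
    by_contra h
    have := mul_nonpos_of_nonneg_of_nonpos hc0.le (not_lt.1 h)
    linarith
  obtain ⟨p, ⟨hp1, hp2⟩, hw, hlam⟩ := exists_near_of_mem_enlarge hρ'0 (by linarith : ρ' < 2 * ρ')
    hx1 hx0
  simp only at hw hlam
  set z₀ := Φ p.1 with hz₀
  have hz₀K : z₀ ∈ K := subset_closure ⟨_, hp2, rfl⟩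
  have hp1L : p.1 ∈ L := ⟨z₀, hz₀K, Φ.left_inv hp1⟩
  obtain ⟨hxs, hxz⟩ := h₂ p.1 hp1L x.1 (by rw [mem_ball_iff_norm]; linarith) p.1
    (Metric.mem_ball_self hδ₂)
  simp only at hxs hxz
  refine ⟨hxs, hx0, fun z' ζ' hz' hζ' => ?_⟩
  have hz1 : Φ x.1 ∈ Metric.ball z₀ δ₁ := by
    rw [mem_ball_iff_norm]
    linarith [hxz.trans (min_le_left _ _)]
  have hz2 : Φ x.1 + z' ∈ Metric.ball z₀ δ₁ := by
    rw [mem_ball_iff_norm]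
    calc ‖Φ x.1 + z' - z₀‖ = ‖(Φ x.1 - z₀) + z'‖ := by congr 1; abel
      _ ≤ ‖Φ x.1 - z₀‖ + ‖z'‖ := norm_add_le _ _
      _ < δ₁ := by linarith [hxz.trans (min_le_left _ _), hz'.trans (min_le_left _ _)]
  obtain ⟨hJan, hJs⟩ := h₁ z₀ hz₀K _ hz1 _ hz2
  simp only at hJan hJs
  set lam := x.2.1
  set lam₀ := p.2
  have hJ0 : J z₀ z₀ = jacobianMat Φ.symm z₀ := hJ.eq_jacobianMat (Φ.map_source hp1)
    (hΦ.holo_symm _ (Φ.map_source hp1)).differentiableAt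
  set ζ₀ := (J z₀ z₀).transpose.mulVec lam₀ with hζ₀
  rw [← hJ0] at hp2
  have hlam₀ : lam₀ = (jacobianMat Φ p.1).transpose.mulVec ζ₀ := by
    rw [hζ₀, hJ0, Matrix.mulVec_mulVec, ← Matrix.transpose_mul,
      jacobianMat_symm_mul hΦ.holo hΦ.holo_symm hp1, Matrix.transpose_one, Matrix.one_mulVec]
  have n1 : ‖lam₀‖ ≤ M' * ‖ζ₀‖ := by
    rw [hlam₀]
    exact (norm_transpose_mulVec_le _ _).trans
      (mul_le_mul_of_nonneg_right (hM' _ hp1L) (norm_nonneg _))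
  have n2 : ‖ζ₀‖ ≤ M * ‖lam₀‖ := (norm_transpose_mulVec_le _ _).trans
    (mul_le_mul_of_nonneg_right (hM _ hz₀K) (norm_nonneg _))
  have n3 : ‖lam‖ ≤ 2 * ‖lam₀‖ := by
    have := norm_le_norm_add_norm_sub' lam lam₀
    nlinarith [norm_nonneg lam₀]
  have n4 : ‖lam₀‖ ≤ 2 * ‖lam‖ := by
    have := norm_le_norm_add_norm_sub' lam₀ lam
    rw [norm_sub_rev] at this
    nlinarith [norm_nonneg lam₀]
  set ξ := ζ' + (J (Φ x.1 + z') (Φ x.1)).transpose.mulVec lam with hξ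
  have n5 : ‖ξ - ζ₀‖ ≤ ρ * ‖ζ₀‖ := by
    -- The three errors: the shift ζ', the variation of J*, and the distance from λ to λ₀.
    have e : ξ - ζ₀ = ζ' + (J (Φ x.1 + z') (Φ x.1) - J z₀ z₀).transpose.mulVec lam +
        (J z₀ z₀).transpose.mulVec (lam - lam₀) := by
      rw [hξ, hζ₀, Matrix.transpose_sub, Matrix.sub_mulVec, Matrix.mulVec_sub]
      abel
    have b1 : ‖ζ'‖ ≤ τ * ‖lam‖ := hζ'.trans
      (mul_le_mul_of_nonneg_right (min_le_right _ _) (norm_nonneg _))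
    have b2 := (norm_transpose_mulVec_le (J (Φ x.1 + z') (Φ x.1) - J z₀ z₀) lam).trans
      (mul_le_mul_of_nonneg_right hJs (norm_nonneg _))
    have b3 := (norm_transpose_mulVec_le (J z₀ z₀) (lam - lam₀)).trans
      (mul_le_mul (hM _ hz₀K) hlam (norm_nonneg _) (by positivity))
    have b4 : τ * ‖lam‖ ≤ ρ / 3 * ‖ζ₀‖ := by
      calc τ * ‖lam‖ ≤ τ * (2 * (M' * ‖ζ₀‖)) := by gcongr; linarith
        _ = ρ / 3 * ‖ζ₀‖ := by rw [hτ]; field_simp; ring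
    have b5 : M * (2 * ρ' * ‖lam₀‖) ≤ ρ / 3 * ‖ζ₀‖ := by
      calc M * (2 * ρ' * ‖lam₀‖) ≤ M * (2 * ρ' * (M' * ‖ζ₀‖)) := by gcongr
        _ = (ρ' * (6 * (M * M'))) / 3 * ‖ζ₀‖ := by ring
        _ ≤ ρ / 3 * ‖ζ₀‖ := by gcongr
    rw [e]
    refine (norm_add₃_le).trans ?_
    linarith
  have n6 : c * ‖lam‖ ≤ ‖ξ‖ := by
    have := norm_le_norm_add_norm_sub' ζ₀ ξ
    rw [norm_sub_rev] at this
    calc c * ‖lam‖ ≤ c * (2 * (M' * ‖ζ₀‖)) := by gcongr; linarith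
      _ = (1 - ρ) * ‖ζ₀‖ := by rw [hc]; field_simp
      _ ≤ ‖ξ‖ := by linarith
  have n7 : ‖ξ‖ ≤ 4 * M * ‖lam‖ := by
    have := norm_le_norm_add_norm_sub' ξ ζ₀
    have h1 : ρ * ‖ζ₀‖ ≤ ‖ζ₀‖ := mul_le_of_le_one_left (norm_nonneg _) hρ1.le
    have h2 : M * ‖lam₀‖ ≤ M * (2 * ‖lam‖) := by gcongr
    linarith
  refine ⟨fun i j => ?_, ⟨mem_enlarge_of_near hp2 (hxz.trans (min_le_right _ _)) n5, ?_, hx3⟩,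
    n6, n7⟩
  · exact (hJan i j).fun_comp_of_eq (f := fun z' => (Φ x.1 + z', Φ x.1))
      ((analyticAt_const.add analyticAt_id).prod analyticAt_const) rfl
  · calc d * (1 - ρ) ≤ d * 1 := by gcongr; linarith
      _ ≤ ‖ξ‖ := by linarith

end Geometry

/-! ### Estimates for the transform of a formal symbol -/

section Estimates

variable {n : ℕ}

/-- Expand (1 + ⋯ + 1)^l: every multinomial coefficient is at least 1. -/
theorem card_piAntidiag_univ_le (l : ℕ) :
    (Finset.piAntidiag (Finset.univ : Finset (Fin n)) l).card ≤ n ^ l := by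
  have h := Finset.sum_pow_eq_sum_piAntidiag (Finset.univ : Finset (Fin n)) (fun _ => (1 : ℕ)) l
  simp only [Finset.sum_const, Finset.card_univ, Fintype.card_fin, smul_eq_mul, mul_one, one_pow,
    Finset.prod_const_one] at h
  rw [h, Finset.card_eq_sum_ones]
  exact Finset.sum_le_sum fun α _ => Nat.multinomial_pos _ _

theorem norm_fibreOp_le {B : CSp n → Matrix (Fin n) (Fin n) ℂ} {p : CSp n → ℂ} {lam : CSp n}
    {ε M : ℝ} (hε : 0 < ε) (hlam : 0 < ‖lam‖)
    (h : ∀ z' ζ' : CSp n, ‖z'‖ ≤ ε → ‖ζ'‖ ≤ ε * ‖lam‖ →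
      (∀ i j, AnalyticAt ℂ (fun z => B z i j) z') ∧
      AnalyticAt ℂ p (ζ' + (B z').transpose.mulVec lam) ∧
      ‖p (ζ' + (B z').transpose.mulVec lam)‖ ≤ M) (l : ℕ) :
    ‖fibreOp B l p lam‖ ≤ M * (l.factorial * (n / ε ^ 2) ^ l) / ‖lam‖ ^ l := by
  have hM : 0 ≤ M := (norm_nonneg _).trans
    (h 0 0 (by simpa using hε.le) (by simpa using (mul_pos hε hlam).le)).2.2
  have hterm : ∀ α ∈ Finset.piAntidiag (Finset.univ : Finset (Fin n)) l,
      ‖(∏ i, ((α i).factorial : ℂ))⁻¹ * mixedDeriv α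
        (fun y : CSp n × CSp n => p (y.2 + (B y.1).transpose.mulVec lam)) (0, 0)‖ ≤
        M * l.factorial / (ε ^ 2 * ‖lam‖) ^ l := by
    intro α hα
    have hsum : ∑ i, α i = l := (Finset.mem_piAntidiag.1 hα).1
    -- Radius ε in each z'-coordinate and ε‖λ‖ in each ζ'-coordinate; the latter produces the gain
    -- ‖λ‖^{-l}. Cauchy gives (α!)², one factor of which is cancelled by the 1/α! of the operator.
    set R : Fin n ⊕ Fin n → ℝ := Sum.elim (fun _ => ε) (fun _ => ε * ‖lam‖) with hR
    have hR0 : ∀ i, 0 < R i := by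
      rintro (i | i)
      · exact hε
      · exact mul_pos hε hlam
    have hdir : ∀ s : Fin n ⊕ Fin n → ℂ,
        ((mixedList n).map fun i => s i • mixedDirection n i).sum =
          ((fun i => s (Sum.inl i)), fun i => s (Sum.inr i)) := by
      intro s
      simp only [mixedList, List.map_append, List.map_map, List.sum_append]
      rw [← List.ofFn_eq_map, ← List.ofFn_eq_map, List.sum_ofFn, List.sum_ofFn]
      ext j <;> simp [mixedDirection, Pi.single_apply, Prod.fst_sum, Prod.snd_sum]
    have hC := norm_iterDir_le (mixedDirection n) hR0 M (Sum.elim α α)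
      (fun y : CSp n × CSp n => p (y.2 + (B y.1).transpose.mulVec lam)) (mixedList n)
      nodup_mixedList (0, 0) fun s hs => by
        rw [hdir]
        have hz : ‖(fun i => s (Sum.inl i) : CSp n)‖ ≤ ε :=
          (pi_norm_le_iff_of_nonneg hε.le).2 fun i => hs (Sum.inl i)
        have hζ : ‖(fun i => s (Sum.inr i) : CSp n)‖ ≤ ε * ‖lam‖ :=
          (pi_norm_le_iff_of_nonneg (mul_pos hε hlam).le).2 fun i => hs (Sum.inr i)
        obtain ⟨h1, h2, h3⟩ := h _ _ hz hζ
        simp only [Prod.mk_add_mk, zero_add]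
        refine ⟨h2.fun_comp_of_eq (f := fun y : CSp n × CSp n =>
          y.2 + (B y.1).transpose.mulVec lam) (analyticAt_snd.add (analyticAt_mulVec
            (fun i j => (h1 j i).fun_comp_of_eq analyticAt_fst rfl) analyticAt_const)) rfl, h3⟩
    have hprod : ((mixedList n).map fun i => ((Sum.elim α α i).factorial : ℝ) /
        R i ^ Sum.elim α α i).prod = (∏ i, ((α i).factorial : ℝ)) ^ 2 / (ε ^ 2 * ‖lam‖) ^ l := by
      simp only [mixedList, List.map_append, List.map_map, List.prod_append]
      rw [← List.ofFn_eq_map, ← List.ofFn_eq_map, List.prod_ofFn, List.prod_ofFn]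
      simp only [Function.comp_apply, Sum.elim_inl, Sum.elim_inr, hR, Finset.prod_div_distrib,
        Finset.prod_pow_eq_pow_sum, hsum]
      rw [div_mul_div_comm, ← mul_pow, ← sq]
      congr 2
      ring
    have hfac : (∏ i, ((α i).factorial : ℝ)) ≤ l.factorial := by
      rw [← hsum]
      exact_mod_cast Nat.le_of_dvd (Nat.factorial_pos _) (Nat.prod_factorial_dvd_factorial_sum _ _)
    have hpos : 0 < ∏ i, ((α i).factorial : ℝ) :=
      Finset.prod_pos fun i _ => Nat.cast_pos.2 (Nat.factorial_pos _)
    rw [hprod, ← mixedDeriv_eq_iterDir] at hC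
    rw [norm_mul, norm_inv, norm_prod]
    simp only [Complex.norm_natCast]
    calc (∏ i, ((α i).factorial : ℝ))⁻¹ * _ ≤ (∏ i, ((α i).factorial : ℝ))⁻¹ *
          (M * ((∏ i, ((α i).factorial : ℝ)) ^ 2 / (ε ^ 2 * ‖lam‖) ^ l)) :=
        mul_le_mul_of_nonneg_left hC (inv_nonneg.2 hpos.le)
      _ = M * (∏ i, ((α i).factorial : ℝ)) / (ε ^ 2 * ‖lam‖) ^ l := by field_simp
      _ ≤ _ := by gcongr
  refine (norm_sum_le _ _).trans ((Finset.sum_le_sum hterm).trans ?_)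
  rw [Finset.sum_const, nsmul_eq_mul]
  have hcard : ((Finset.piAntidiag (Finset.univ : Finset (Fin n)) l).card : ℝ) ≤ (n : ℝ) ^ l := by
    exact_mod_cast card_piAntidiag_univ_le l
  calc _ ≤ (n : ℝ) ^ l * (M * l.factorial / (ε ^ 2 * ‖lam‖) ^ l) :=
        mul_le_mul_of_nonneg_right hcard (by positivity)
    _ = _ := by
      rw [mul_pow, div_pow]
      field_simp

theorem sum_range_factorial_mul_pow_le {a b : ℝ} (ha : 0 ≤ a) (hb : 0 ≤ b) (m : ℕ) :
    ∑ l ∈ Finset.range (m + 1),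
      (((m - l).factorial : ℝ) * a ^ (m - l)) * (l.factorial * b ^ l) ≤
      m.factorial * (a + b) ^ m := by
  rw [add_comm a b, add_pow, Finset.mul_sum]
  refine Finset.sum_le_sum fun l hl => ?_
  have hlm : l ≤ m := Nat.lt_succ_iff.1 (Finset.mem_range.1 hl)
  have h1 : ((m - l).factorial : ℝ) * l.factorial ≤ m.factorial * m.choose l := by
    have h2 : (m - l).factorial * l.factorial ≤ m.factorial * m.choose l := by
      have h3 := Nat.choose_mul_factorial_mul_factorial hlm
      have h4 : 1 ≤ m.choose l := Nat.choose_pos hlm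
      calc (m - l).factorial * l.factorial ≤ m.choose l * ((m - l).factorial * l.factorial) :=
            Nat.le_mul_of_pos_left _ h4
        _ = m.factorial := by rw [← h3]; ring
        _ ≤ _ := Nat.le_mul_of_pos_right _ h4
    exact_mod_cast h2
  calc _ = ((m - l).factorial * l.factorial : ℝ) * (a ^ (m - l) * b ^ l) := by ring
    _ ≤ (m.factorial * m.choose l : ℝ) * (a ^ (m - l) * b ^ l) := by gcongr
    _ = _ := by ring

/-- Stated for an arbitrary q with the bound of order k, so that it serves both a coefficient of a
symbol and a partial sum of a null-symbol. The exponent h/c' becomes h because ‖ξ‖ ≤ c'‖λ‖, and ‖η‖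
≤ 1 allows ‖λ‖^{-l} to be replaced by ‖ηλ‖^{-l}. -/
theorem norm_fibreOp_symbol_le {B : CSp n → Matrix (Fin n) (Fin n) ℂ} {q : CSp n → ℂ}
    {lam : CSp n} {η : ℂ} {ε c c' C A h : ℝ} (hε : 0 < ε) (hc : 0 < c) (hc' : 0 < c') (hC : 0 < C)
    (hA : 0 < A) (hh : 0 < h) (hlam : 0 < ‖lam‖) (hη : 0 < ‖η‖) (hη1 : ‖η‖ ≤ 1) (k l : ℕ)
    (hq : ∀ z' ζ' : CSp n, ‖z'‖ ≤ ε → ‖ζ'‖ ≤ ε * ‖lam‖ →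
      (∀ i j, AnalyticAt ℂ (fun z => B z i j) z') ∧
      AnalyticAt ℂ q (ζ' + (B z').transpose.mulVec lam) ∧
      ‖q (ζ' + (B z').transpose.mulVec lam)‖ ≤ C * k.factorial * A ^ k *
        Real.exp (h / c' * ‖ζ' + (B z').transpose.mulVec lam‖) /
          ‖η • (ζ' + (B z').transpose.mulVec lam)‖ ^ k ∧
      c * ‖lam‖ ≤ ‖ζ' + (B z').transpose.mulVec lam‖ ∧
      ‖ζ' + (B z').transpose.mulVec lam‖ ≤ c' * ‖lam‖) :
    ‖fibreOp B l q lam‖ ≤ C * Real.exp (h * ‖lam‖) / ‖η • lam‖ ^ (k + l) *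
      ((k.factorial * (A / c) ^ k) * (l.factorial * (n / ε ^ 2) ^ l)) := by
  have hy : 0 < ‖η • lam‖ := by rw [norm_smul]; positivity
  have hyl : ‖η • lam‖ ≤ ‖lam‖ := by
    rw [norm_smul]; exact mul_le_of_le_one_left (norm_nonneg _) hη1
  have h1 := norm_fibreOp_le (M := C * k.factorial * A ^ k * Real.exp (h * ‖lam‖) /
    (c * ‖η • lam‖) ^ k) hε hlam (fun z' ζ' hz hζ => by
      obtain ⟨b1, b2, b3, b4, b5⟩ := hq z' ζ' hz hζ
      refine ⟨b1, b2, b3.trans ?_⟩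
      have e1 : h / c' * ‖ζ' + (B z').transpose.mulVec lam‖ ≤ h * ‖lam‖ := by
        calc _ ≤ h / c' * (c' * ‖lam‖) := by gcongr
          _ = h * ‖lam‖ := by field_simp
      have e2 : c * ‖η • lam‖ ≤ ‖η • (ζ' + (B z').transpose.mulVec lam)‖ := by
        rw [norm_smul, norm_smul]
        calc c * (‖η‖ * ‖lam‖) = ‖η‖ * (c * ‖lam‖) := by ring
          _ ≤ _ := by gcongr
      gcongr) l
  refine h1.trans ?_
  calc _ ≤ C * k.factorial * A ^ k * Real.exp (h * ‖lam‖) / (c * ‖η • lam‖) ^ k *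
        (l.factorial * (n / ε ^ 2) ^ l) / ‖η • lam‖ ^ l := by gcongr
    _ = _ := by
      rw [mul_pow, div_pow A, pow_add]
      field_simp

theorem pullback_eq_sum_range (Φ : OpenPartialHomeomorph (CSp n) (CSp n))
    (J : CSp n → CSp n → Matrix (Fin n) (Fin n) ℂ) (P : FormalSer n) (ν : ℕ)
    (x : CSp n × CSp n × ℂ) :
    pullback Φ J P ν x = ∑ l ∈ Finset.range (ν + 1),
      fibreOp (fun z' => J (Φ x.1 + z') (Φ x.1)) l (fun ζ => P (ν - l) (Φ x.1, ζ, x.2.2))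
        x.2.1 := by
  rw [pullback_eq_sum_fibreOp, ← Finset.Nat.sum_antidiagonal_swap]
  exact Finset.Nat.sum_antidiagonal_eq_sum_range_succ (fun l k =>
    fibreOp (fun z' => J (Φ x.1 + z') (Φ x.1)) l (fun ζ => P k (Φ x.1, ζ, x.2.2)) x.2.1) ν

theorem analyticAt_fibre {f : CSp n × CSp n × ℂ → ℂ} {z ζ : CSp n} {η : ℂ}
    (hf : AnalyticAt ℂ f (z, ζ, η)) : AnalyticAt ℂ (fun ζ => f (z, ζ, η)) ζ :=
  hf.fun_comp_of_eq (f := fun ζ => (z, ζ, η))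
    (analyticAt_const.prod (analyticAt_id.prod analyticAt_const)) rfl

/-- Summing the triangle k + l < m by l first exposes the partial sums of P, the only quantities
that the null-symbol condition controls. -/
theorem sum_range_pullback {Φ : OpenPartialHomeomorph (CSp n) (CSp n)}
    {J : CSp n → CSp n → Matrix (Fin n) (Fin n) ℂ} (hJ : IsJStar Φ J) {P : FormalSer n}
    {x : CSp n × CSp n × ℂ} (hx : x.1 ∈ Φ.source)
    (hP : ∀ k, AnalyticAt ℂ (P k)
      (Φ x.1, (J (Φ x.1) (Φ x.1)).transpose.mulVec x.2.1, x.2.2)) (m : ℕ) :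
    ∑ ν ∈ Finset.range m, pullback Φ J P ν x = ∑ l ∈ Finset.range m,
      fibreOp (fun z' => J (Φ x.1 + z') (Φ x.1)) l
        (fun ζ => ∑ k ∈ Finset.range (m - l), P k (Φ x.1, ζ, x.2.2)) x.2.1 := by
  simp only [pullback_eq_sum_range]
  rw [Finset.sum_range_diag_flip m fun l k =>
    fibreOp (fun z' => J (Φ x.1 + z') (Φ x.1)) l (fun ζ => P k (Φ x.1, ζ, x.2.2)) x.2.1]
  refine Finset.sum_congr rfl fun l _ => ?_
  have := fibreOp_sum (Finset.range (m - l)) (fun _ => 1)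
    (fun i j => hJ.analyticAt_shift (Φ.map_source hx) i j)
    (p := fun k ζ => P k (Φ x.1, ζ, x.2.2)) (lam := x.2.1)
    (fun k _ => by simpa using analyticAt_fibre (hP k)) l
  simpa using this.symm

theorem analyticAt_pullback {Φ : OpenPartialHomeomorph (CSp n) (CSp n)}
    (hΦ : AnalyticOnNhd ℂ Φ Φ.source)
    {J : CSp n → CSp n → Matrix (Fin n) (Fin n) ℂ} (hJ : IsJStar Φ J) {P : FormalSer n}
    {x : CSp n × CSp n × ℂ} (hx : x.1 ∈ Φ.source)
    (hP : ∀ k, AnalyticAt ℂ (P k)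
      (Φ x.1, (J (Φ x.1) (Φ x.1)).transpose.mulVec x.2.1, x.2.2)) (ν : ℕ) :
    AnalyticAt ℂ (pullback Φ J P ν) x := by
  refine Finset.analyticAt_fun_sum _ fun kl _ => Finset.analyticAt_fun_sum _ fun α _ =>
    analyticAt_const.mul ?_
  have hΦx : AnalyticAt ℂ (fun q : (CSp n × CSp n × ℂ) × (CSp n × CSp n) => Φ q.1.1)
      (x, (0, 0)) := (hΦ _ hx).fun_comp_of_eq (analyticAt_fst.fun_comp analyticAt_fst) rfl
  have hF : AnalyticAt ℂ (fun q : (CSp n × CSp n × ℂ) × (CSp n × CSp n) =>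
      P kl.1 (Φ q.1.1, q.2.2 + (J (Φ q.1.1 + q.2.1) (Φ q.1.1)).transpose.mulVec q.1.2.1,
        q.1.2.2)) (x, (0, 0)) := by
    refine (hP kl.1).fun_comp_of_eq (f := fun q : (CSp n × CSp n × ℂ) × (CSp n × CSp n) =>
      (Φ q.1.1, q.2.2 + (J (Φ q.1.1 + q.2.1) (Φ q.1.1)).transpose.mulVec q.1.2.1, q.1.2.2))
      (hΦx.prod (((analyticAt_snd.fun_comp analyticAt_snd).add (analyticAt_mulVec
        (fun i j => ?_) ?_)).prod ?_)) (by simp)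
    · exact ((hJ _ (Φ.map_source hx)).1 j i).fun_comp_of_eq
        (f := fun q : (CSp n × CSp n × ℂ) × (CSp n × CSp n) => (Φ q.1.1 + q.2.1, Φ q.1.1))
        ((hΦx.add (analyticAt_fst.fun_comp analyticAt_snd)).prod hΦx) (by simp)
    · exact analyticAt_fst.fun_comp (analyticAt_snd.fun_comp analyticAt_fst)
    · exact analyticAt_snd.fun_comp (analyticAt_snd.fun_comp analyticAt_fst)
  exact analyticAt_mixedDeriv_slice α hF

/-- The variable η is a mere parameter of the operators, and mixed derivatives commute. -/
theorem etaDeriv_pullback {Φ : OpenPartialHomeomorph (CSp n) (CSp n)}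
    {J : CSp n → CSp n → Matrix (Fin n) (Fin n) ℂ} (hJ : IsJStar Φ J) {P : FormalSer n}
    {x : CSp n × CSp n × ℂ} (hx : x.1 ∈ Φ.source)
    (hP : ∀ k, AnalyticAt ℂ (P k)
      (Φ x.1, (J (Φ x.1) (Φ x.1)).transpose.mulVec x.2.1, x.2.2)) (ν : ℕ) :
    etaDeriv (pullback Φ J P) ν x = pullback Φ J (etaDeriv P) ν x := by
  have hF : ∀ k, AnalyticAt ℂ (fun q : ℂ × (CSp n × CSp n) =>
      P k (Φ x.1, q.2.2 + (J (Φ x.1 + q.2.1) (Φ x.1)).transpose.mulVec x.2.1, q.1))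
      (x.2.2, (0, 0)) := by
    intro k
    refine (hP k).fun_comp_of_eq (f := fun q : ℂ × (CSp n × CSp n) =>
      (Φ x.1, q.2.2 + (J (Φ x.1 + q.2.1) (Φ x.1)).transpose.mulVec x.2.1, q.1))
      (analyticAt_const.prod (((analyticAt_snd.fun_comp analyticAt_snd).add (analyticAt_mulVec
        (fun i j => ?_) analyticAt_const)).prod analyticAt_fst)) (by simp)
    exact (hJ.analyticAt_shift (Φ.map_source hx) j i).fun_comp_of_eq
      (f := fun q : ℂ × (CSp n × CSp n) => q.2.1)
      (analyticAt_fst.fun_comp analyticAt_snd) rfl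
  have hD : ∀ k α, AnalyticAt ℂ (fun s => mixedDeriv α (fun y : CSp n × CSp n =>
      P k (Φ x.1, y.2 + (J (Φ x.1 + y.1) (Φ x.1)).transpose.mulVec x.2.1, s)) (0, 0)) x.2.2 :=
    fun k α => analyticAt_mixedDeriv_slice α (hF k)
  have hswap : ∀ k α, deriv (fun s => mixedDeriv α (fun y : CSp n × CSp n =>
      P k (Φ x.1, y.2 + (J (Φ x.1 + y.1) (Φ x.1)).transpose.mulVec x.2.1, s)) (0, 0)) x.2.2 =
      mixedDeriv α (fun y : CSp n × CSp n => etaDeriv P k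
        (Φ x.1, y.2 + (J (Φ x.1 + y.1) (Φ x.1)).transpose.mulVec x.2.1, x.2.2)) (0, 0) := by
    intro k α
    have := iterate_dirDeriv_mixedDeriv α (hF k) 1 1
    rwa [dirDeriv_one] at this
  have hd : HasDerivAt (fun s => pullback Φ J P ν (x.1, x.2.1, s))
      (pullback Φ J (etaDeriv P) ν x) x.2.2 := by
    refine HasDerivAt.fun_sum fun kl _ => HasDerivAt.fun_sum fun α _ => HasDerivAt.const_mul _ ?_
    rw [← hswap]
    exact (hD kl.1 α).differentiableAt.hasDerivAt
  exact hd.deriv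

theorem analyticAt_etaDeriv {P : FormalSer n} {ν : ℕ} {x : CSp n × CSp n × ℂ}
    (hP : AnalyticAt ℂ (P ν) x) : AnalyticAt ℂ (etaDeriv P ν) x := by
  refine (hP.dirDeriv (0, 0, 1)).congr (Eventually.of_forall fun y => ?_)
  have := congrFun (dirDeriv_comp_affine (fun s : ℂ => (y.1, y.2.1, s)) 1 (0, 0, 1)
    (fun s t => by simp) (P ν)) y.2.2
  rw [dirDeriv_one] at this
  exact this.symm

theorem IsNullSymbol.pullback {Ω : Set (Cotan n)} (hcomp : ConicRelCompact Ω)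
    {Φ : OpenPartialHomeomorph (CSp n) (CSp n)} (hΦ : IsCoordChange Φ Ω)
    {J : CSp n → CSp n → Matrix (Fin n) (Fin n) ℂ} (hJ : IsJStar Φ J) {S : Set ℂ}
    (hS : ∀ η ∈ S, 0 < ‖η‖ ∧ ‖η‖ ≤ 1) {P : FormalSer n} (hP : IsNullSymbol Ω S P) :
    IsNullSymbol (inCoord Φ Ω) S (pullback Φ J P) := by
  obtain ⟨d, hd, ρ, hρ, hPan, A, hA, hbound⟩ := hP
  obtain ⟨d', hd', ρ', hρ', ε, hε, c, hc, c', hc', hdom⟩ :=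
    exists_polydisc_in_symDom hcomp hΦ hJ hd hρ
  have hcenter : ∀ Z, ∀ x ∈ symDom (inCoord Φ Ω) d' ρ' Z,
      (Φ x.1, (J (Φ x.1) (Φ x.1)).transpose.mulVec x.2.1, x.2.2) ∈ symDom Ω d ρ Z := by
    intro Z x hx
    obtain ⟨-, h0, h⟩ := hdom Z x hx
    simpa using (h 0 0 (by simpa using hε.le) (by simpa using (mul_pos hε h0).le)).2.1
  refine ⟨d', hd', ρ', hρ', fun ν x hx => analyticAt_pullback hΦ.holo hJ (hdom S x hx).1
    (fun k => hPan k _ (hcenter S x hx)) ν, A / c + n / ε ^ 2, by positivity,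
    fun Z hZ hZS h hh => ?_⟩
  obtain ⟨C, hC, hCb⟩ := hbound Z hZ hZS (h / c') (by positivity)
  refine ⟨C, hC, fun m hm x hx => ?_⟩
  obtain ⟨hxs, hx0, hx1⟩ := hdom Z x hx
  have hsub : ∀ y ∈ symDom Ω d ρ Z, y ∈ symDom Ω d ρ S := fun y hy =>
    ⟨hy.1, hy.2.1, hZS hy.2.2⟩
  obtain ⟨hη, hη1⟩ := hS _ (hZS hx.2.2)
  rw [sum_range_pullback hJ hxs (fun k => hPan k _ (hsub _ (hcenter Z x hx)))]
  refine (norm_sum_le _ _).trans ?_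
  have hterm : ∀ l ∈ Finset.range m, ‖fibreOp (fun z' => J (Φ x.1 + z') (Φ x.1)) l
      (fun ζ => ∑ k ∈ Finset.range (m - l), P k (Φ x.1, ζ, x.2.2)) x.2.1‖ ≤
      C * Real.exp (h * ‖x.2.1‖) / ‖x.2.2 • x.2.1‖ ^ m *
        (((m - l).factorial * (A / c) ^ (m - l)) * (l.factorial * (n / ε ^ 2) ^ l)) := by
    intro l hl
    have hlm := Finset.mem_range.1 hl
    have := norm_fibreOp_symbol_le (B := fun z' => J (Φ x.1 + z') (Φ x.1))
      (q := fun ζ => ∑ k ∈ Finset.range (m - l), P k (Φ x.1, ζ, x.2.2)) hε hc hc' hC hA hh hx0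
      hη hη1 (m - l) l fun z' ζ' hz hζ => by
        obtain ⟨b1, b2, b3, b4⟩ := hx1 z' ζ' hz hζ
        exact ⟨b1, Finset.analyticAt_fun_sum _ fun k _ => analyticAt_fibre (hPan k _ (hsub _ b2)),
          hCb (m - l) (by omega) _ b2, b3, b4⟩
    rwa [Nat.sub_add_cancel hlm.le] at this
  have hnn : ∀ l, 0 ≤ C * Real.exp (h * ‖x.2.1‖) / ‖x.2.2 • x.2.1‖ ^ m *
        (((m - l).factorial * (A / c) ^ (m - l)) * (l.factorial * (n / ε ^ 2) ^ l)) :=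
    fun l => by positivity
  -- Here l < m, so m - l ≥ 1 and the hypothesis applied. Adding the nonnegative term l = m
  -- completes the binomial sum.
  refine (Finset.sum_le_sum hterm).trans ((Finset.sum_le_sum_of_subset_of_nonneg
    (Finset.range_mono (Nat.le_succ m)) fun l _ _ => hnn l).trans ?_)
  rw [← Finset.mul_sum]
  refine (mul_le_mul_of_nonneg_left (sum_range_factorial_mul_pow_le (by positivity)
    (by positivity) m) (by positivity)).trans (le_of_eq ?_)
  ring

theorem enlarge_mono (Ω : Set (Cotan n)) {ρ ρ' : ℝ} (h : ρ ≤ ρ') : enlarge Ω ρ ⊆ enlarge Ω ρ' := by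
  refine closure_mono ?_
  rintro q ⟨p, hp, z', ζ', hz, hζ, rfl⟩
  exact ⟨p, hp, z', ζ', hz.trans h, hζ.trans (mul_le_mul_of_nonneg_right h (norm_nonneg _)), rfl⟩

theorem exists_symDom_subset_inter (Ω : Set (Cotan n)) {d₁ ρ₁ d₂ ρ₂ : ℝ} (hd₁ : 0 < d₁)
    (hρ₁ : ρ₁ ∈ Ioo (0 : ℝ) 1) (hρ₂ : ρ₂ ∈ Ioo (0 : ℝ) 1) :
    ∃ d > 0, ∃ ρ ∈ Ioo (0 : ℝ) 1, ∀ Z, symDom Ω d ρ Z ⊆ symDom Ω d₁ ρ₁ Z ∩ symDom Ω d₂ ρ₂ Z := by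
  have hρ : min ρ₁ ρ₂ ∈ Ioo (0 : ℝ) 1 := ⟨lt_min hρ₁.1 hρ₂.1, min_lt_of_left_lt hρ₁.2⟩
  have h1 : 0 < 1 - min ρ₁ ρ₂ := sub_pos.2 hρ.2
  -- With the smaller ρ, this d makes d(1 - ρ) the larger of the two thresholds.
  refine ⟨max (d₁ * (1 - ρ₁)) (d₂ * (1 - ρ₂)) / (1 - min ρ₁ ρ₂),
    div_pos (lt_max_of_lt_left (mul_pos hd₁ (sub_pos.2 hρ₁.2))) h1, _, hρ, fun Z x hx => ?_⟩
  obtain ⟨hx1, hx2, hx3⟩ := hx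
  rw [div_mul_cancel₀ _ h1.ne'] at hx2
  exact ⟨⟨enlarge_mono Ω (min_le_left _ _) hx1, (le_max_left _ _).trans hx2, hx3⟩,
    ⟨enlarge_mono Ω (min_le_right _ _) hx1, (le_max_right _ _).trans hx2, hx3⟩⟩

/-- Analyticity of Q is a separate hypothesis: agreement on the set `symDom` alone says nothing
about a neighbourhood of it. -/
theorem IsNullSymbol.congr {Ω : Set (Cotan n)} {S : Set ℂ} {P Q : FormalSer n}
    (hP : IsNullSymbol Ω S P) {d ρ : ℝ} (hd : 0 < d) (hρ : ρ ∈ Ioo (0 : ℝ) 1)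
    (hQ : ∀ ν, AnalyticOnNhd ℂ (Q ν) (symDom Ω d ρ S))
    (hPQ : ∀ ν, EqOn (P ν) (Q ν) (symDom Ω d ρ S)) : IsNullSymbol Ω S Q := by
  obtain ⟨d₁, hd₁, ρ₁, hρ₁, -, A, hA, hb⟩ := hP
  obtain ⟨d₂, hd₂, ρ₂, hρ₂, hsub⟩ := exists_symDom_subset_inter Ω (d₂ := d₁) hd hρ hρ₁
  refine ⟨d₂, hd₂, ρ₂, hρ₂, fun ν x hx => hQ ν x (hsub S hx).1, A, hA, fun Z hZ hZS h hh => ?_⟩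
  obtain ⟨C, hC, hCb⟩ := hb Z hZ hZS h hh
  refine ⟨C, hC, fun m hm x hx => ?_⟩
  have hx1 := (hsub Z hx).1
  rw [← Finset.sum_congr rfl fun ν _ => hPQ ν ⟨hx1.1, hx1.2.1, hZS hx1.2.2⟩]
  exact hCb m hm x (hsub Z hx).2

theorem IsSymbol.pullback {Ω : Set (Cotan n)} (hcomp : ConicRelCompact Ω)
    {Φ : OpenPartialHomeomorph (CSp n) (CSp n)} (hΦ : IsCoordChange Φ Ω)
    {J : CSp n → CSp n → Matrix (Fin n) (Fin n) ℂ} (hJ : IsJStar Φ J) {S : Set ℂ}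
    (hS : ∀ η ∈ S, 0 < ‖η‖ ∧ ‖η‖ ≤ 1) {P : FormalSer n} (hP : IsSymbol Ω S P) :
    IsSymbol (inCoord Φ Ω) S (pullback Φ J P) := by
  obtain ⟨⟨d, hd, ρ, hρ, hPan, A, hA, hbound⟩, hnull⟩ := hP
  obtain ⟨d', hd', ρ', hρ', ε, hε, c, hc, c', hc', hdom⟩ :=
    exists_polydisc_in_symDom hcomp hΦ hJ hd hρ
  have hcenter : ∀ Z, ∀ x ∈ symDom (inCoord Φ Ω) d' ρ' Z,
      (Φ x.1, (J (Φ x.1) (Φ x.1)).transpose.mulVec x.2.1, x.2.2) ∈ symDom Ω d ρ Z := by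
    intro Z x hx
    obtain ⟨-, h0, h⟩ := hdom Z x hx
    simpa using (h 0 0 (by simpa using hε.le) (by simpa using (mul_pos hε h0).le)).2.1
  have hPan' : ∀ ν, AnalyticOnNhd ℂ (_root_.pullback Φ J P ν) (symDom (inCoord Φ Ω) d' ρ' S) :=
    fun ν x hx => analyticAt_pullback hΦ.holo hJ (hdom S x hx).1
      (fun k => hPan k _ (hcenter S x hx)) ν
  refine ⟨⟨d', hd', ρ', hρ', hPan', A / c + n / ε ^ 2, by positivity, fun Z hZ hZS h hh => ?_⟩, ?_⟩
  · obtain ⟨C, hC, hCb⟩ := hbound Z hZ hZS (h / c') (by positivity)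
    refine ⟨C, hC, fun ν x hx => ?_⟩
    obtain ⟨hxs, hx0, hx1⟩ := hdom Z x hx
    have hsub : ∀ y ∈ symDom Ω d ρ Z, y ∈ symDom Ω d ρ S := fun y hy =>
      ⟨hy.1, hy.2.1, hZS hy.2.2⟩
    obtain ⟨hη, hη1⟩ := hS _ (hZS hx.2.2)
    rw [pullback_eq_sum_range]
    refine (norm_sum_le _ _).trans ?_
    have hterm : ∀ l ∈ Finset.range (ν + 1), ‖fibreOp (fun z' => J (Φ x.1 + z') (Φ x.1)) l
        (fun ζ => P (ν - l) (Φ x.1, ζ, x.2.2)) x.2.1‖ ≤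
        C * Real.exp (h * ‖x.2.1‖) / ‖x.2.2 • x.2.1‖ ^ ν *
          (((ν - l).factorial * (A / c) ^ (ν - l)) * (l.factorial * (n / ε ^ 2) ^ l)) := by
      intro l hl
      have hlm := Nat.lt_succ_iff.1 (Finset.mem_range.1 hl)
      have := norm_fibreOp_symbol_le (B := fun z' => J (Φ x.1 + z') (Φ x.1))
        (q := fun ζ => P (ν - l) (Φ x.1, ζ, x.2.2)) hε hc hc' hC hA hh hx0
        hη hη1 (ν - l) l fun z' ζ' hz hζ => by
          obtain ⟨b1, b2, b3, b4⟩ := hx1 z' ζ' hz hζ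
          exact ⟨b1, analyticAt_fibre (hPan _ _ (hsub _ b2)), hCb (ν - l) _ b2, b3, b4⟩
      rwa [Nat.sub_add_cancel hlm] at this
    refine (Finset.sum_le_sum hterm).trans ?_
    rw [← Finset.mul_sum]
    refine (mul_le_mul_of_nonneg_left (sum_range_factorial_mul_pow_le (by positivity)
      (by positivity) ν) (by positivity)).trans (le_of_eq ?_)
    ring
  -- ∂_η(Φ*P) agrees with Φ*(∂_ηP), which is a null-symbol by the case already treated.
  · exact (hnull.pullback hcomp hΦ hJ hS).congr hd' hρ'
      (fun ν x hx => analyticAt_etaDeriv (hPan' ν x hx)) fun ν x hx =>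
      (etaDeriv_pullback hJ (hdom S x hx).1 (fun k => hPan k _ (hcenter S x hx)) ν).symm

end Estimates

/-! ### The identity and composite transformations -/

section Functoriality

variable {n : ℕ}

theorem sector_norm {r θ : ℝ} (hr : r ∈ Ioo (0 : ℝ) (1 / 2)) :
    ∀ η ∈ sector r θ, 0 < ‖η‖ ∧ ‖η‖ ≤ 1 := fun η hη =>
  ⟨hη.1, by linarith [hη.2.1, hr.2]⟩

theorem jacobianMat_trans_symm {Φ Ψ : OpenPartialHomeomorph (CSp n) (CSp n)}
    (hΦ : AnalyticOnNhd ℂ Φ.symm Φ.target) (hΨ : AnalyticOnNhd ℂ Ψ.symm Ψ.target) {v : CSp n}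
    (hv : v ∈ Ψ.source) (hv' : Ψ v ∈ Φ.source) :
    jacobianMat (Ψ.trans Φ).symm (Φ (Ψ v)) =
      jacobianMat Ψ.symm (Ψ v) * jacobianMat Φ.symm (Φ (Ψ v)) := by
  have h := jacobianMat_comp (f := Ψ.symm) (g := Φ.symm) (z := Φ (Ψ v))
    (by rw [Φ.left_inv hv']; exact (hΨ _ (Ψ.map_source hv)).differentiableAt)
    (hΦ _ (Φ.map_source hv')).differentiableAt
  rw [Φ.left_inv hv'] at h
  exact h

theorem inCoord_inCoord {Ω : Set (Cotan n)} {Φ Ψ : OpenPartialHomeomorph (CSp n) (CSp n)}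
    (hΦ : AnalyticOnNhd ℂ Φ.symm Φ.target) (hΨ : AnalyticOnNhd ℂ Ψ.symm Ψ.target) :
    inCoord Ψ (inCoord Φ Ω) = inCoord (Ψ.trans Φ) Ω := by
  ext p
  have key : p.1 ∈ Ψ.source → Ψ p.1 ∈ Φ.source →
      (jacobianMat Φ.symm (Φ (Ψ p.1))).transpose.mulVec
        ((jacobianMat Ψ.symm (Ψ p.1)).transpose.mulVec p.2) =
      (jacobianMat (Ψ.trans Φ).symm (Φ (Ψ p.1))).transpose.mulVec p.2 := by
    intro h1 h2
    rw [jacobianMat_trans_symm hΦ hΨ h1 h2, Matrix.transpose_mul, Matrix.mulVec_mulVec]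
  constructor
  · rintro ⟨h1, h2, h3⟩
    refine ⟨by rw [OpenPartialHomeomorph.trans_source]; exact ⟨h1, h2⟩, ?_⟩
    simp only at h3
    rw [key h1 h2] at h3
    exact h3
  · rintro ⟨h1, h3⟩
    rw [OpenPartialHomeomorph.trans_source] at h1
    refine ⟨h1.1, h1.2, ?_⟩
    simp only
    rw [key h1.1 h1.2]
    exact h3

theorem IsCoordChange.trans {Ω : Set (Cotan n)} {Φ Ψ : OpenPartialHomeomorph (CSp n) (CSp n)}
    (hΦ : IsCoordChange Φ Ω) (hΨ : IsCoordChange Ψ (inCoord Φ Ω)) :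
    IsCoordChange (Ψ.trans Φ) Ω where
  holo := by
    intro v hv
    rw [OpenPartialHomeomorph.trans_source] at hv
    exact (hΦ.holo _ hv.2).comp (hΨ.holo _ hv.1)
  holo_symm := by
    intro z hz
    rw [OpenPartialHomeomorph.trans_target] at hz
    exact (hΨ.holo_symm _ hz.2).comp (hΦ.holo_symm _ hz.1)
  closure_subset := by
    intro z hz
    have hzΦ := hΦ.closure_subset hz
    rw [OpenPartialHomeomorph.trans_target]
    refine ⟨hzΦ, hΨ.closure_subset ?_⟩
    -- By continuity of Φ⁻¹ it is enough to map the base of Ω itself into the base of Ω^Φ; the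
    -- covector over the image point is transported by the transposed Jacobian of Φ.
    have hc : ContinuousAt Φ.symm z := Φ.continuousAt_symm hzΦ
    refine closure_mono ?_ (hc.continuousWithinAt.mem_closure_image hz)
    rintro _ ⟨_, ⟨p, hp, rfl⟩, rfl⟩
    have hp1 : p.1 ∈ Φ.target := hΦ.closure_subset (subset_closure ⟨p, hp, rfl⟩)
    have hs := Φ.map_target hp1
    refine ⟨(Φ.symm p.1, (jacobianMat Φ (Φ.symm p.1)).transpose.mulVec p.2), ⟨hs, ?_⟩, rfl⟩
    have h1 := mul_eq_one_comm.1 (jacobianMat_symm_mul hΦ.holo hΦ.holo_symm hs)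
    simp only
    rw [Matrix.mulVec_mulVec, ← Matrix.transpose_mul, h1, Φ.right_inv hp1, Matrix.transpose_one,
      Matrix.one_mulVec]
    exact hp

theorem sum_antidiagonal_assoc {M : Type*} [AddCommMonoid M] (f : ℕ → ℕ → ℕ → M) (ν : ℕ) :
    ∑ am ∈ Finset.HasAntidiagonal.antidiagonal ν,
      ∑ kl ∈ Finset.HasAntidiagonal.antidiagonal am.1, f kl.1 kl.2 am.2 =
    ∑ kj ∈ Finset.HasAntidiagonal.antidiagonal ν,
      ∑ lm ∈ Finset.HasAntidiagonal.antidiagonal kj.2, f kj.1 lm.1 lm.2 := by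
  rw [Finset.sum_sigma', Finset.sum_sigma']
  refine Finset.sum_bij' (fun x _ => ⟨(x.2.1, x.2.2 + x.1.2), (x.2.2, x.1.2)⟩)
    (fun x _ => ⟨(x.1.1 + x.2.1, x.2.2), (x.1.1, x.2.1)⟩) ?_ ?_ ?_ ?_ fun _ _ => rfl
  all_goals
    rintro ⟨⟨a, b⟩, ⟨c, d⟩⟩ h
    simp only [Finset.mem_sigma, Finset.HasAntidiagonal.mem_antidiagonal] at h
    obtain ⟨rfl, rfl⟩ := h
  · simp [add_assoc]
  · simp [add_assoc]
  · rfl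
  · rfl

theorem pullback_pullback {Φ Ψ : OpenPartialHomeomorph (CSp n) (CSp n)}
    (hΦ : AnalyticOnNhd ℂ Φ.symm Φ.target) (hΨ : AnalyticOnNhd ℂ Ψ.symm Ψ.target)
    {J₁ J₂ J₃ : CSp n → CSp n → Matrix (Fin n) (Fin n) ℂ} (h₁ : IsJStar Φ J₁) (h₂ : IsJStar Ψ J₂)
    (h₃ : IsJStar (Ψ.trans Φ) J₃) {P : FormalSer n} {x : CSp n × CSp n × ℂ}
    (hx : x.1 ∈ Ψ.source) (hx' : Ψ x.1 ∈ Φ.source)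
    (hP : ∀ k, AnalyticAt ℂ (P k) (Φ (Ψ x.1),
      (J₃ (Φ (Ψ x.1)) (Φ (Ψ x.1))).transpose.mulVec x.2.1, x.2.2)) (ν : ℕ) :
    pullback Ψ J₂ (pullback Φ J₁ P) ν x = pullback (Ψ.trans Φ) J₃ P ν x := by
  set v := x.1
  set w := Ψ v with hw
  set z := Φ w with hz
  have hwt : w ∈ Ψ.target := Ψ.map_source hx
  have hzt : z ∈ Φ.target := Φ.map_source hx'
  have hzt' : z ∈ (Ψ.trans Φ).target := (Ψ.trans Φ).map_source (x := v) (by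
    rw [OpenPartialHomeomorph.trans_source]; exact ⟨hx, hx'⟩)
  have hdiff : DifferentiableAt ℂ (Ψ.trans Φ).symm z := by
    rw [OpenPartialHomeomorph.trans_target] at hzt'
    exact ((hΨ _ hzt'.2).comp (hΦ _ hzt'.1)).differentiableAt
  have hJ : J₃ z z = J₂ w w * J₁ z z := by
    rw [h₃.eq_jacobianMat hzt' hdiff, h₂.eq_jacobianMat hwt (hΨ _ hwt).differentiableAt,
      h₁.eq_jacobianMat hzt (hΦ _ hzt).differentiableAt]
    exact jacobianMat_trans_symm hΦ hΨ hx hx'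
  set B₁ : CSp n → Matrix (Fin n) (Fin n) ℂ := fun z' => J₁ (z + z') z with hB₁
  set B₂ : CSp n → Matrix (Fin n) (Fin n) ℂ := fun w' => J₂ (w + w') w with hB₂
  set B₃ : CSp n → Matrix (Fin n) (Fin n) ℂ := fun z' => J₃ (z + z') z with hB₃
  have a₁ : ∀ i j, AnalyticAt ℂ (fun z => B₁ z i j) 0 := h₁.analyticAt_shift hzt
  have a₂ : ∀ i j, AnalyticAt ℂ (fun z => B₂ z i j) 0 := h₂.analyticAt_shift hwt
  have a₃ : ∀ i j, AnalyticAt ℂ (fun z => B₃ z i j) 0 := h₃.analyticAt_shift hzt'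
  set lam := (J₂ w w).transpose.mulVec x.2.1 with hlam
  set ζ := (J₁ z z).transpose.mulVec lam with hζ
  have hζ' : (J₃ z z).transpose.mulVec x.2.1 = ζ := by
    rw [hJ, hζ, hlam, Matrix.transpose_mul, Matrix.mulVec_mulVec]
  -- After multiplication by t, both sides are the displacement Ψ⁻¹(Φ⁻¹(z + ty)) - Ψ⁻¹(w). This is
  -- the only place where the three matrices are related off the diagonal.
  have hcomp : ∀ y : CSp n, ∀ᶠ t : ℂ in 𝓝[≠] 0,
      (B₂ (t • (B₁ (t • y)).mulVec y)).mulVec ((B₁ (t • y)).mulVec y) =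
        (B₃ (t • y)).mulVec y := by
    intro y
    have ht : Tendsto (fun t : ℂ => t • y) (𝓝[≠] 0) (𝓝 0) := by
      have : Continuous fun t : ℂ => t • y := by fun_prop
      exact (by simpa using this.tendsto 0 : Tendsto (fun t : ℂ => t • y) (𝓝 0) (𝓝 0)).mono_left
        nhdsWithin_le_nhds
    have hκ : Tendsto (fun t : ℂ => Φ.symm (z + t • y) - w) (𝓝[≠] 0) (𝓝 0) := by
      have h1 : Tendsto (fun t : ℂ => z + t • y) (𝓝[≠] 0) (𝓝 z) := by
        simpa using ht.const_add z
      have h2 := ((Φ.continuousAt_symm hzt).tendsto.comp h1).sub_const w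
      rwa [hz, Φ.left_inv hx', sub_self] at h2
    filter_upwards [ht.eventually (h₁.eventually_shift hzt),
      ht.eventually (h₃.eventually_shift hzt'), hκ.eventually (h₂.eventually_shift hwt),
      self_mem_nhdsWithin] with t e1 e3 e2 ht0
    have hzw : Φ.symm z = w := Φ.left_inv hx'
    have e1' : t • (B₁ (t • y)).mulVec y = Φ.symm (z + t • y) - w := by
      rw [← Matrix.mulVec_smul, ← e1, hzw]
    have e3' : t • (B₃ (t • y)).mulVec y = Ψ.symm (Φ.symm (z + t • y)) - Ψ.symm w := by
      rw [← Matrix.mulVec_smul, ← e3, ← hzw]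
      rfl
    refine smul_right_injective (CSp n) (ht0 : t ≠ 0) ?_
    simp only
    rw [← Matrix.mulVec_smul, e1', e3', hB₂, ← e2, add_sub_cancel]
  have hp : ∀ k, AnalyticAt ℂ (fun ζ => P k (z, ζ, x.2.2)) ζ := fun k =>
    analyticAt_fibre (by rw [← hζ']; exact hP k)
  have hlam0 : (B₂ 0).transpose.mulVec x.2.1 = lam := by simp [hB₂, hlam]
  have hζ0 : (B₁ 0).transpose.mulVec lam = ζ := by simp [hB₁, hζ]
  have hζ'0 : (B₃ 0).transpose.mulVec x.2.1 = ζ := by simpa [hB₃] using hζ'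
  have hfc := fun (k j : ℕ) => fibreOp_comp a₁ a₂ a₃ hcomp hlam0 hζ0 hζ'0 (hp k) j
  have hL : pullback Ψ J₂ (pullback Φ J₁ P) ν x =
      ∑ am ∈ Finset.HasAntidiagonal.antidiagonal ν,
        ∑ kl ∈ Finset.HasAntidiagonal.antidiagonal am.1,
          fibreOp B₂ am.2 (fibreOp B₁ kl.2 fun ζ => P kl.1 (z, ζ, x.2.2)) x.2.1 := by
    rw [pullback_eq_sum_fibreOp]
    refine Finset.sum_congr rfl fun am _ => ?_
    have := fibreOp_sum (Finset.HasAntidiagonal.antidiagonal am.1) (fun _ => 1) a₂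
      (p := fun kl => fibreOp B₁ kl.2 fun ζ => P kl.1 (z, ζ, x.2.2)) (lam := x.2.1)
      (fun kl _ => analyticAt_fibreOp a₁ (by rw [hlam0, hζ0]; exact hp kl.1) kl.2) am.2
    simp only [one_mul] at this
    exact this
  -- The triple sum over k + l + m = ν is regrouped by k, leaving for each k the sum over l + m = j
  -- to which `fibreOp_comp` applies.
  rw [hL, sum_antidiagonal_assoc fun k l m =>
    fibreOp B₂ m (fibreOp B₁ l fun ζ => P k (z, ζ, x.2.2)) x.2.1, pullback_eq_sum_fibreOp]
  exact Finset.sum_congr rfl fun kj _ => hfc kj.1 kj.2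

theorem pullback_ofSet {V : Set (CSp n)} (hV : IsOpen V)
    {J : CSp n → CSp n → Matrix (Fin n) (Fin n) ℂ}
    (hJ : IsJStar (OpenPartialHomeomorph.ofSet V hV) J) {P : FormalSer n}
    {x : CSp n × CSp n × ℂ} (hx : x.1 ∈ V) (hP : ∀ k, AnalyticAt ℂ (P k) x) (ν : ℕ) :
    pullback (OpenPartialHomeomorph.ofSet V hV) J P ν x = P ν x := by
  have hJ1 : J x.1 x.1 = 1 := (hJ.eq_jacobianMat hx differentiableAt_id).trans (jacobianMat_id x.1)
  -- J* need not be the identity matrix off the diagonal, but it fixes the vector y along the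
  -- displacement ty, which is all that the generating function sees.
  have hself : ∀ y : CSp n, ∀ᶠ t : ℂ in 𝓝[≠] 0, (J (x.1 + t • y) x.1).mulVec y = y := by
    intro y
    have ht : Tendsto (fun t : ℂ => t • y) (𝓝[≠] 0) (𝓝 0) := by
      have : Continuous fun t : ℂ => t • y := by fun_prop
      exact (by simpa using this.tendsto 0 : Tendsto (fun t : ℂ => t • y) (𝓝 0) (𝓝 0)).mono_left
        nhdsWithin_le_nhds
    filter_upwards [ht.eventually (hJ.eventually_shift hx), self_mem_nhdsWithin] with t e ht0
    refine smul_right_injective (CSp n) (ht0 : t ≠ 0) ?_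
    simp only
    rw [← Matrix.mulVec_smul, ← e]
    simp
  rw [pullback_eq_sum_fibreOp]
  have hterm : ∀ kl : ℕ × ℕ, fibreOp (fun z' => J (x.1 + z') x.1) kl.2
      (fun ζ => P kl.1 (x.1, ζ, x.2.2)) x.2.1 = if kl.2 = 0 then P kl.1 x else 0 := fun kl =>
    fibreOp_of_mulVec_self (hJ.analyticAt_shift hx) hself (by simp [hJ1])
      (analyticAt_fibre (hP kl.1)) kl.2
  have e := Finset.sum_congr rfl fun kl (_ : kl ∈ Finset.HasAntidiagonal.antidiagonal ν) => hterm kl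
  refine Eq.trans e ?_
  rw [Finset.sum_eq_single (ν, 0)]
  · simp
  · rintro ⟨k, l⟩ h1 h2
    refine if_neg fun h3 => h2 ?_
    rw [Finset.HasAntidiagonal.mem_antidiagonal] at h1
    simp only at h1 h3
    rw [h3, add_zero] at h1
    rw [h1, h3]
  · intro h
    simp [Finset.HasAntidiagonal.mem_antidiagonal] at h

theorem symDom_center {Ω : Set (Cotan n)} (hcomp : ConicRelCompact Ω)
    {Φ : OpenPartialHomeomorph (CSp n) (CSp n)} (hΦ : IsCoordChange Φ Ω)
    {J : CSp n → CSp n → Matrix (Fin n) (Fin n) ℂ} (hJ : IsJStar Φ J) {d ρ : ℝ} (hd : 0 < d)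
    (hρ : ρ ∈ Ioo (0 : ℝ) 1) :
    ∃ d' > 0, ∃ ρ' ∈ Ioo (0 : ℝ) 1, ∀ Z : Set ℂ, ∀ x ∈ symDom (inCoord Φ Ω) d' ρ' Z,
      x.1 ∈ Φ.source ∧
        (Φ x.1, (J (Φ x.1) (Φ x.1)).transpose.mulVec x.2.1, x.2.2) ∈ symDom Ω d ρ Z := by
  obtain ⟨d', hd', ρ', hρ', ε, hε, c, hc, c', hc', hdom⟩ :=
    exists_polydisc_in_symDom hcomp hΦ hJ hd hρ
  refine ⟨d', hd', ρ', hρ', fun Z x hx => ?_⟩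
  obtain ⟨h1, h0, h⟩ := hdom Z x hx
  exact ⟨h1, by
    simpa using (h 0 0 (by simpa using hε.le) (by simpa using (mul_pos hε h0).le)).2.1⟩

theorem isCoordChange_ofSet {Ω : Set (Cotan n)} {V : Set (CSp n)} (hV : IsOpen V)
    (h : closure (Prod.fst '' Ω) ⊆ V) : IsCoordChange (OpenPartialHomeomorph.ofSet V hV) Ω where
  holo := fun _ _ => analyticAt_id
  holo_symm := fun _ _ => analyticAt_id
  closure_subset := h

theorem inCoord_ofSet {Ω : Set (Cotan n)} {V : Set (CSp n)} (hV : IsOpen V)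
    (h : closure (Prod.fst '' Ω) ⊆ V) : inCoord (OpenPartialHomeomorph.ofSet V hV) Ω = Ω := by
  ext p
  have e : jacobianMat (OpenPartialHomeomorph.ofSet V hV).symm p.1 = 1 := jacobianMat_id p.1
  constructor
  · rintro ⟨-, h2⟩
    change (p.1, (jacobianMat (OpenPartialHomeomorph.ofSet V hV).symm p.1).transpose.mulVec p.2) ∈ Ω
      at h2
    rwa [e, Matrix.transpose_one, Matrix.one_mulVec] at h2
  · intro hp
    refine ⟨h (subset_closure ⟨p, hp, rfl⟩), ?_⟩
    change (p.1, (jacobianMat (OpenPartialHomeomorph.ofSet V hV).symm p.1).transpose.mulVec p.2) ∈ Ω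
    rwa [e, Matrix.transpose_one, Matrix.one_mulVec]

end Functoriality

theorem theoremS (n : ℕ) (r θ : ℝ) (hr : r ∈ Ioo (0 : ℝ) (1 / 2)) (hθ : θ ∈ Ioo (0 : ℝ) (1 / 2))
    (Ω : Set (Cotan n)) (hopen : IsOpen Ω) (hconic : IsConic Ω) (hcomp : ConicRelCompact Ω) :
    -- symbols are mapped to symbols and null-symbols to null-symbols
    (∀ Φ : OpenPartialHomeomorph (CSp n) (CSp n), IsCoordChange Φ Ω →
      (∃ J, IsJStar Φ J) ∧
      ∀ J, IsJStar Φ J → ∀ P : FormalSer n,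
        (IsSymbol Ω (sector r θ) P → IsSymbol (inCoord Φ Ω) (sector r θ) (pullback Φ J P)) ∧
        (IsNullSymbol Ω (sector r θ) P →
          IsNullSymbol (inCoord Φ Ω) (sector r θ) (pullback Φ J P))) ∧
    -- the identity transformation, on any open neighbourhood of the base, acts as the identity
    (∀ (V : Set (CSp n)) (hV : IsOpen V), closure (Prod.fst '' Ω) ⊆ V →
      ∀ J, IsJStar (OpenPartialHomeomorph.ofSet V hV) J → ∀ P : FormalSer n,
        IsSymbol Ω (sector r θ) P →
          SymEq Ω (sector r θ) (pullback (OpenPartialHomeomorph.ofSet V hV) J P) P) ∧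
    -- functoriality: `z = Φ(w)`, `w = Ψ(v)`; `Ψ.trans Φ` is the composite `v ↦ Φ(Ψ(v))`
    (∀ Φ Ψ : OpenPartialHomeomorph (CSp n) (CSp n),
      IsCoordChange Φ Ω → IsCoordChange Ψ (inCoord Φ Ω) →
      inCoord Ψ (inCoord Φ Ω) = inCoord (Ψ.trans Φ) Ω ∧
      ∀ J₁ J₂ J₃, IsJStar Φ J₁ → IsJStar Ψ J₂ → IsJStar (Ψ.trans Φ) J₃ →
        ∀ P : FormalSer n, IsSymbol Ω (sector r θ) P →
          SymEq (inCoord (Ψ.trans Φ) Ω) (sector r θ)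
            (pullback Ψ J₂ (pullback Φ J₁ P)) (pullback (Ψ.trans Φ) J₃ P)) := by
  have hS := sector_norm (θ := θ) hr
  refine ⟨fun Φ hΦ => ⟨⟨_, isJStar_meanJacobian hΦ.holo_symm⟩, fun J hJ P =>
    ⟨fun hP => hP.pullback hcomp hΦ hJ hS, fun hP => hP.pullback hcomp hΦ hJ hS⟩⟩, ?_, ?_⟩
  · intro V hV hΩV J hJ P hP
    obtain ⟨⟨d, hd, ρ, hρ, hPan, -⟩, -⟩ := hP
    obtain ⟨d', hd', ρ', hρ', h⟩ := symDom_center hcomp (isCoordChange_ofSet hV hΩV) hJ hd hρ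
    rw [inCoord_ofSet hV hΩV] at h
    refine ⟨d', hd', ρ', hρ', fun ν x hx => ?_⟩
    obtain ⟨h1, h2⟩ := h _ x hx
    have hJ1 : J x.1 x.1 = 1 :=
      (hJ.eq_jacobianMat h1 differentiableAt_id).trans (jacobianMat_id x.1)
    refine pullback_ofSet hV hJ h1 (fun k => hPan k x ?_) ν
    have h3 : (x.1, (J x.1 x.1).transpose.mulVec x.2.1, x.2.2) ∈ symDom Ω d ρ (sector r θ) := h2
    simpa [hJ1] using h3
  · intro Φ Ψ hΦ hΨ
    have hΦΨ := hΦ.trans hΨ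
    refine ⟨inCoord_inCoord hΦ.holo_symm hΨ.holo_symm, fun J₁ J₂ J₃ h₁ h₂ h₃ P hP => ?_⟩
    obtain ⟨⟨d, hd, ρ, hρ, hPan, -⟩, -⟩ := hP
    -- The common domain is governed by the composite alone: the pointwise identity needs only that
    -- P be analytic at the image point in the original coordinates.
    obtain ⟨d', hd', ρ', hρ', h⟩ := symDom_center hcomp hΦΨ h₃ hd hρ
    refine ⟨d', hd', ρ', hρ', fun ν x hx => ?_⟩
    obtain ⟨hs, hc⟩ := h _ x hx
    rw [OpenPartialHomeomorph.trans_source] at hs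
    exact pullback_pullback hΦ.holo_symm hΨ.holo_symm h₁ h₂ h₃ hs.1 hs.2
      (fun k => hPan k _ hc) ν
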